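/- Let $\mathcal C$ be a small category. Write $r(g)$ and $s(g)$ for the codomain and domain of an arrow $g$, and $gh$ for the composite when $s(g)=r(h)$. **Fibrations.** A functor $F\colon\mathcal E\to\mathcal C$ from a small category is a *discrete Conduché fibration* if for every arrow $\varphi$ of $\mathcal E$, every factorisation $F(\varphi)=\varrho\lambda$ in $\mathcal C$ lifts uniquely to a factorisation $\varphi=\tilde\varrho\tilde\lambda$ with $F(\tilde\varrho)=\varrho$, $F(\tilde\lambda)=\lambda$. It is *row-finite* if for every object $X$ of $\mathcal E$ and every arrow $g\colon x\to F(X)$ in $\mathcal C$, the set of arrows $\alpha$ of $\mathcal E$ with $r(\alpha)=X$ and $F(\alpha)=g$ is finite. Two fibrations $F\colon\mathcal E\to\mathcal C$, $F'\colon\mathcal E'\to\mathcal C$ are isomorphic if there is an isomorphism of categories $\Phi\colon\mathcal E\to\mathcal E'$ with $F'\Phi=F$. If $F$ is row-finite, $C^*(F)$ is the universal C*-algebra generated by projections $P_X$ ($X\in\mathcal E^0$) and partial isometries $S_\alpha$ ($\alpha$ an arrow of $\mathcal E$) with the relations: $P_XP_Y=0$ for $X\ne Y$; $S_{\alpha\beta}=S_\alpha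 S_\beta$ for composable $\alpha,\beta$; $P_X=S_{\mathrm{id}_X}$; $S_\alpha^*S_\alpha=P_{s(\alpha)}$; $S_\beta^*S_\alpha=0$ if $F(\alpha)=F(\beta)$ and $\alpha\neq\beta$; and $\sum_{F(\alpha)=g,\ r(\alpha)=X}S_\alpha S_\alpha^*=P_X$ for every object $X$ of $\mathcal E$ and every arrow $g\colon x\to F(X)$. **Homomorphisms.** Let $\mathfrak{Gr}$ be the bicategory whose objects are étale groupoids with locally compact Hausdorff object space; whose arrows $\mathcal H\leftarrow\mathcal G$ are groupoid correspondences, that is, spaces $\mathcal X$ with commuting actions of $\mathcal H$ on the left (anchor map $r$) and of $\mathcal G$ on the right (anchor map $s$) such that $s$ is a local homeomorphism and the right action is free and proper; whose 2-arrows are injective continuous biequivariant maps; and whose composition $\mathcal X\circ_{\mathcal G}\mathcal Y$ is the orbit space of the diagonal $\mathcal G$-action on $\mathcal X\times_{s,\mathcal G^0,r}\mathcal Y$. A bicategory homomorphism $\mathcal C\to\mathfrak{Gr}$ is given by groupoids $\mathcal G_x$, correspondences $\mathcal X_g\colon\mathcal G_{r(g)}\leftarrow\mathcal G_{s(g)}$,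 and biequivariant homeomorphisms $\sigma_{g,h}\colon\mathcal X_g\circ\mathcal X_h\to\mathcal X_{gh}$ and $\mathcal G_x\cong\mathcal X_{1_x}$ satisfying the usual associativity and unit conditions. It is *proper* if for every $g$ the map $\mathcal X_g/\mathcal G_{s(g)}\to\mathcal G_{r(g)}^0$ induced by $r$ is proper. Call it *discrete* if each $\mathcal G_x$ is a discrete set with only identity arrows. An isomorphism of homomorphisms consists of isomorphisms of topological groupoids $\mathcal G_x\cong\mathcal G'_x$ and equivariant homeomorphisms $\mathcal X_g\cong\mathcal X'_g$ that are compatible with all the structure; an equivalence of homomorphisms is a strong transformation whose components are equivalences in $\mathfrak{Gr}$. **Product systems.** A product system over $\mathcal C$ is a bicategory homomorphism from $\mathcal C$ to the bicategory of C*-correspondences, given by C*-algebras $A_x$, correspondences $E_g\colon A_{r(g)}\leftarrow A_{s(g)}$ and unitary multiplication maps $E_g\otimes E_h\to E_{gh}$ and $A_x\cong E_{1_x}$; it is proper if each $A_{r(g)}$ acts on $E_g$ by compact operators. The absolute Cuntz–Pimsner algebra of a proper product system is the universal C*-algebra for its Cuntz–Pimsner covariant representations, that is, families of $^*$-homomorphisms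 $\pi_x$ on $A_x$ with mutually orthogonal ranges and linear maps $\pi_g$ on $E_g$ with $\pi_{1_x}=\pi_x$, $\pi_g(\xi)\pi_h(\eta)=\pi_{gh}(\xi\eta)$, $\pi_g(\xi)^*\pi_g(\eta)=\pi_{s(g)}(\langle\xi,\eta\rangle)$, such that for every $g$ and every $a\in A_{r(g)}$, $\pi_{r(g)}(a)$ is the image of the compact operator by which $a$ acts on $E_g$ under the map $|\xi\rangle\langle\eta|\mapsto\pi_g(\xi)\pi_g(\eta)^*$. The product system associated to a homomorphism $\mathcal C\to\mathfrak{Gr}$ has $A_x=C^*(\mathcal G_x)$ and $E_g=C^*(\mathcal X_g)$, the completions of the spaces of compactly supported quasi-continuous functions on $\mathcal G_x$ and $\mathcal X_g$ with the usual convolution structure and inner products, and the multiplication induced by $\sigma$. **Theorem.** For a discrete Conduché fibration $F\colon\mathcal E\to\mathcal C$, the discrete sets $\mathcal G_x=F^{-1}(x)\subseteq\mathcal E^0$ and $\mathcal X_g=F^{-1}(g)$, with the range and source maps as anchor maps and with $\sigma$ given by the composition in $\mathcal E$, form a discrete homomorphism $\tilde F\colon\mathcal C\to\mathfrak{Gr}$.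 1. $F\mapsto\tilde F$ induces a bijection from isomorphism classes of discrete Conduché fibrations over $\mathcal C$ to isomorphism classes of discrete homomorphisms $\mathcal C\to\mathfrak{Gr}$. Two discrete homomorphisms are isomorphic if and only if they are equivalent. 2. $F$ is row-finite if and only if $\tilde F$ (or any homomorphism isomorphic to $\tilde F$) is proper. 3. If $F$ is row-finite, then the product system associated to $\tilde F$ is proper, and there is a unique isomorphism from $C^*(F)$ to the absolute Cuntz–Pimsner algebra of this product system that maps $P_X\mapsto\pi_{F(X)}(\delta_X)$ and $S_\alpha\mapsto\pi_{F(\alpha)}(\delta_\alpha)$ for all objects $X$ and arrows $\alpha$ of $\mathcal E$, where $\delta$ denotes delta functions. The same holds for every homomorphism $H$ with an isomorphism $\theta\colon\tilde F\cong H$, with the delta functions transported along $\theta$. -/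

import Mathlib

open CategoryTheory

universe u

/-! ## Étale groupoids and groupoid correspondences -/

/-- A locally compact étale groupoid: a groupoid with topologies on its sets of objects and arrows
such that range and source are local homeomorphisms, multiplication and inversion are continuous,
and the object space is locally compact and Hausdorff.  `mul a b` is the product `a · b`, defined
if `s a = r b`. -/
structure EtGroupoid : Type (u + 1) where
  Obj : Type u
  Arr : Type u
  [topObj : TopologicalSpace Obj]
  [topArr : TopologicalSpace Arr]
  r : Arr → Obj
  s : Arr → Obj
  unit : Obj → Arr
  inv : Arr → Arr
  mul (a b : Arr) : s a = r b → Arr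
  r_unit : ∀ x, r (unit x) = x
  s_unit : ∀ x, s (unit x) = x
  r_inv : ∀ a, r (inv a) = s a
  s_inv : ∀ a, s (inv a) = r a
  r_mul : ∀ a b e, r (mul a b e) = r a
  s_mul : ∀ a b e, s (mul a b e) = s b
  unit_mul : ∀ a, mul (unit (r a)) a (s_unit _) = a
  mul_unit : ∀ a, mul a (unit (s a)) (r_unit _).symm = a
  inv_mul : ∀ a, mul (inv a) a (s_inv a) = unit (s a)
  mul_inv : ∀ a, mul a (inv a) (r_inv a).symm = unit (r a)
  mul_assoc : ∀ a b c (e₁ : s a = r b) (e₂ : s b = r c),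
    mul (mul a b e₁) c ((s_mul a b e₁).trans e₂) =
      mul a (mul b c e₂) (e₁.trans (r_mul b c e₂).symm)
  isLocalHomeomorph_r : IsLocalHomeomorph r
  isLocalHomeomorph_s : IsLocalHomeomorph s
  continuous_mul : Continuous fun p : {p : Arr × Arr // s p.1 = r p.2} => mul p.1.1 p.1.2 p.2
  continuous_inv : Continuous inv
  t2Space : T2Space Obj
  locallyCompactSpace : LocallyCompactSpace Obj

attribute [instance] EtGroupoid.topObj EtGroupoid.topArr

/-- The groupoid is a discrete set of objects with only identity arrows. -/
def EtGroupoid.IsDiscreteSet (G : EtGroupoid.{u}) : Prop :=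
  DiscreteTopology G.Obj ∧ ∀ a : G.Arr, a = G.unit (G.s a)

/-- A topological space with commuting actions of the groupoid `H` on the left, with anchor map `r`,
and of the groupoid `G` on the right, with anchor map `s`.  The topological conditions of a groupoid
correspondence are the separate predicate `BiSpace.IsCorr`. -/
structure BiSpace (H G : EtGroupoid.{u}) : Type (u + 1) where
  carrier : Type u
  [top : TopologicalSpace carrier]
  r : carrier → H.Obj
  s : carrier → G.Obj
  lact (h : H.Arr) (x : carrier) : H.s h = r x → carrier
  ract (x : carrier) (g : G.Arr) : s x = G.r g → carrier
  r_lact : ∀ h x e, r (lact h x e) = H.r h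
  s_lact : ∀ h x e, s (lact h x e) = s x
  r_ract : ∀ x g e, r (ract x g e) = r x
  s_ract : ∀ x g e, s (ract x g e) = G.s g
  unit_lact : ∀ x, lact (H.unit (r x)) x (H.s_unit _) = x
  ract_unit : ∀ x, ract x (G.unit (s x)) (G.r_unit _).symm = x
  mul_lact : ∀ h₁ h₂ x (e₁ : H.s h₁ = H.r h₂) (e₂ : H.s h₂ = r x),
    lact (H.mul h₁ h₂ e₁) x ((H.s_mul _ _ _).trans e₂) =
      lact h₁ (lact h₂ x e₂) (e₁.trans (r_lact _ _ _).symm)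
  ract_mul : ∀ x g₁ g₂ (e₁ : s x = G.r g₁) (e₂ : G.s g₁ = G.r g₂),
    ract x (G.mul g₁ g₂ e₂) (e₁.trans (G.r_mul _ _ _).symm) =
      ract (ract x g₁ e₁) g₂ ((s_ract _ _ _).trans e₂)
  lact_ract : ∀ h x g (e₁ : H.s h = r x) (e₂ : s x = G.r g),
    ract (lact h x e₁) g ((s_lact _ _ _).trans e₂) =
      lact h (ract x g e₂) (e₁.trans (r_ract _ _ _).symm)

attribute [instance] BiSpace.top

namespace BiSpace

variable {H G K : EtGroupoid.{u}}

/-- `X` is an (étale) groupoid correspondence `H ← G`: the actions are continuous, the right anchor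
map is a local homeomorphism, and the right action is free and proper. -/
structure IsCorr (X : BiSpace H G) : Prop where
  continuous_r : Continuous X.r
  isLocalHomeomorph_s : IsLocalHomeomorph X.s
  continuous_lact : Continuous fun p : {p : H.Arr × X.carrier // H.s p.1 = X.r p.2} =>
    X.lact p.1.1 p.1.2 p.2
  continuous_ract : Continuous fun p : {p : X.carrier × G.Arr // X.s p.1 = G.r p.2} =>
    X.ract p.1.1 p.1.2 p.2
  free : ∀ x g e, X.ract x g e = x → g = G.unit (X.s x)
  proper : IsProperMap fun p : {p : X.carrier × G.Arr // X.s p.1 = G.r p.2} =>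
    (X.ract p.1.1 p.1.2 p.2, p.1.1)

/-- The relation of lying in the same orbit of the right action. -/
def OrbitRel (X : BiSpace H G) (x y : X.carrier) : Prop :=
  ∃ (g : G.Arr) (e : X.s x = G.r g), X.ract x g e = y

/-- The map `r_* : X/G → H⁰` induced by `r` on the orbit space of the right action. -/
def orbitR (X : BiSpace H G) : Quot X.OrbitRel → H.Obj :=
  Quot.lift X.r (by rintro x _ ⟨g, e, rfl⟩; exact (X.r_ract x g e).symm)

/-- A correspondence `H ← G` is proper if `r_* : X/G → H⁰` is a proper map. -/
def IsProper (X : BiSpace H G) : Prop := IsProperMap X.orbitR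

/-- The fibre product `X ×_{s, G⁰, r} Y`. -/
abbrev FibProd (X : BiSpace H G) (Y : BiSpace G K) : Type u :=
  {p : X.carrier × Y.carrier // X.s p.1 = Y.r p.2}

/-- The orbit relation of the diagonal action `g · (x, y) = (x · g⁻¹, g · y)` of `G` on the fibre
product. -/
def DiagRel (X : BiSpace H G) (Y : BiSpace G K) (p q : FibProd X Y) : Prop :=
  ∃ (g : G.Arr) (e₁ : X.s p.1.1 = G.r (G.inv g)) (e₂ : G.s g = Y.r p.1.2),
    X.ract p.1.1 (G.inv g) e₁ = q.1.1 ∧ Y.lact g p.1.2 e₂ = q.1.2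

section comp

variable (X : BiSpace H G) (Y : BiSpace G K)

/-- The underlying space of the composite. -/
abbrev CompCarrier : Type u := Quot (DiagRel X Y)

def compR : CompCarrier X Y → H.Obj :=
  Quot.lift (fun p => X.r p.1.1) (by
    rintro p q ⟨g, e₁, e₂, h₁, h₂⟩
    simp only [← h₁, X.r_ract])

def compS : CompCarrier X Y → K.Obj :=
  Quot.lift (fun p => Y.s p.1.2) (by
    rintro p q ⟨g, e₁, e₂, h₁, h₂⟩
    simp only [← h₂, Y.s_lact])

def compL (h : H.Arr) (q : CompCarrier X Y) : H.s h = compR X Y q → CompCarrier X Y :=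
  Quot.hrecOn q (motive := fun q => H.s h = compR X Y q → CompCarrier X Y)
    (fun p e => Quot.mk _ ⟨(X.lact h p.1.1 e, p.1.2), (X.s_lact _ _ _).trans p.2⟩)
    (by
      rintro p q ⟨g, e₁, e₂, h₁, h₂⟩
      have hr : X.r p.1.1 = X.r q.1.1 := by rw [← h₁, X.r_ract]
      refine Function.hfunext (by simp only [compR, hr]) fun e e' _ => heq_of_eq ?_
      refine Quot.sound ⟨g, (X.s_lact _ _ _).trans e₁, e₂, ?_, h₂⟩
      have e₀ : H.s h = X.r p.1.1 := e
      have e₀' : H.s h = X.r q.1.1 := e'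
      change X.ract (X.lact h p.1.1 e₀) _ _ = X.lact h q.1.1 e₀'
      rw [X.lact_ract h p.1.1 (G.inv g) e₀ e₁]
      congr 1)

def compA (q : CompCarrier X Y) (k : K.Arr) : compS X Y q = K.r k → CompCarrier X Y :=
  Quot.hrecOn q (motive := fun q => compS X Y q = K.r k → CompCarrier X Y)
    (fun p e => Quot.mk _ ⟨(p.1.1, Y.ract p.1.2 k e), p.2.trans (Y.r_ract _ _ _).symm⟩)
    (by
      rintro p q ⟨g, e₁, e₂, h₁, h₂⟩
      have hs : Y.s p.1.2 = Y.s q.1.2 := by rw [← h₂, Y.s_lact]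
      refine Function.hfunext (by simp only [compS, hs]) fun e e' _ => heq_of_eq ?_
      refine Quot.sound ⟨g, e₁, e₂.trans (Y.r_ract _ _ _).symm, h₁, ?_⟩
      have e₀ : Y.s p.1.2 = K.r k := e
      have e₀' : Y.s q.1.2 = K.r k := e'
      change Y.lact g (Y.ract p.1.2 k e₀) _ = Y.ract q.1.2 k e₀'
      rw [← Y.lact_ract g p.1.2 k e₂ e₀]
      congr 1)

/-- The composite `X ∘_G Y` of correspondences `X : H ← G` and `Y : G ← K`: the orbit space of the
diagonal `G`-action on `X ×_{s, G⁰, r} Y` with the quotient topology and the actions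
`h · [x, y] = [h · x, y]` and `[x, y] · k = [x, y · k]`. -/
def comp : BiSpace H K where
  carrier := CompCarrier X Y
  r := compR X Y
  s := compS X Y
  lact := compL X Y
  ract := compA X Y
  r_lact h x := Quot.ind (β := fun x => ∀ e, compR X Y (compL X Y h x e) = H.r h)
    (fun _ _ => X.r_lact _ _ _) x
  s_lact h x := Quot.ind (β := fun x => ∀ e, compS X Y (compL X Y h x e) = compS X Y x)
    (fun _ _ => rfl) x
  r_ract x k := Quot.ind (β := fun x => ∀ e, compR X Y (compA X Y x k e) = compR X Y x)
    (fun _ _ => rfl) x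
  s_ract x k := Quot.ind (β := fun x => ∀ e, compS X Y (compA X Y x k e) = K.s k)
    (fun _ _ => Y.s_ract _ _ _) x
  unit_lact := Quot.ind fun _ => congrArg (Quot.mk _) (Subtype.ext (Prod.ext (X.unit_lact _) rfl))
  ract_unit := Quot.ind fun _ => congrArg (Quot.mk _) (Subtype.ext (Prod.ext rfl (Y.ract_unit _)))
  mul_lact _ _ := Quot.ind fun _ _ _ =>
    congrArg (Quot.mk _) (Subtype.ext (Prod.ext (X.mul_lact _ _ _ _ _) rfl))
  ract_mul := Quot.ind fun _ _ _ _ _ =>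
    congrArg (Quot.mk _) (Subtype.ext (Prod.ext rfl (Y.ract_mul _ _ _ _ _)))
  lact_ract _ := Quot.ind fun _ _ _ _ => rfl

variable {X Y}

/-- The class `[x, y]` in `X ∘_G Y`. -/
def compMk (x : X.carrier) (y : Y.carrier) (e : X.s x = Y.r y) : (comp X Y).carrier :=
  Quot.mk _ ⟨(x, y), e⟩

end comp

/-- The identity correspondence on `G`: the arrow space of `G` with left and right
multiplication. -/
def idCorr (G : EtGroupoid.{u}) : BiSpace G G where
  carrier := G.Arr
  r := G.r
  s := G.s
  lact := G.mul
  ract := G.mul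
  r_lact := G.r_mul
  s_lact := G.s_mul
  r_ract := G.r_mul
  s_ract := G.s_mul
  unit_lact := G.unit_mul
  ract_unit := G.mul_unit
  mul_lact := G.mul_assoc
  ract_mul a b c e₁ e₂ := (G.mul_assoc a b c e₁ e₂).symm
  lact_ract := G.mul_assoc

/-- Invertible 2-arrows: biequivariant homeomorphisms. -/
structure BiIso (X Y : BiSpace H G) where
  toHomeo : X.carrier ≃ₜ Y.carrier
  r_map : ∀ x, Y.r (toHomeo x) = X.r x
  s_map : ∀ x, Y.s (toHomeo x) = X.s x
  map_lact : ∀ h x e, toHomeo (X.lact h x e) = Y.lact h (toHomeo x) (e.trans (r_map x).symm)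
  map_ract : ∀ x g e, toHomeo (X.ract x g e) = Y.ract (toHomeo x) g ((s_map x).trans e)

/-- A correspondence is invertible up to 2-isomorphism, that is, it is an equivalence in the
bicategory of groupoid correspondences. -/
def IsEquivalence (W : BiSpace H G) : Prop :=
  ∃ V : BiSpace G H, V.IsCorr ∧ Nonempty (BiIso (comp W V) (idCorr H)) ∧
    Nonempty (BiIso (comp V W) (idCorr G))

end BiSpace

open BiSpace

/-! ## Bicategory homomorphisms from a category to groupoid correspondences -/

/-- A bicategory homomorphism from the small category `C` (with only identity 2-arrows) to the
bicategory of groupoid correspondences: groupoids `G x`, correspondences `X g : G y ← G x` for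
`g : x ⟶ y`, and invertible 2-arrows `σ f g : X g ∘ X f ⇒ X (g f)` and `ι x : 1 ⇒ X (1 x)` subject to
the associativity and unit coherence conditions.  The product `g f` in `C` is `f ≫ g` in Lean.
Heterogeneous equality only accounts for equations such as `(f ≫ g) ≫ h = f ≫ (g ≫ h)`. -/
structure GrHom (C : Type u) [SmallCategory C] : Type (u + 1) where
  G : C → EtGroupoid.{u}
  X {x y : C} (g : x ⟶ y) : BiSpace (G y) (G x)
  isCorr {x y : C} (g : x ⟶ y) : (X g).IsCorr
  σ {x y z : C} (f : x ⟶ y) (g : y ⟶ z) : BiIso (comp (X g) (X f)) (X (f ≫ g))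
  ι (x : C) : BiIso (idCorr (G x)) (X (𝟙 x))
  assoc : ∀ {w x y z : C} (f : w ⟶ x) (g : x ⟶ y) (h : y ⟶ z)
    (a : (X h).carrier) (b : (X g).carrier) (c : (X f).carrier)
    (e₁ : (X h).s a = (X g).r b) (e₂ : (X g).s b = (X f).r c) (e₃ e₄),
    HEq ((σ (f ≫ g) h).toHomeo (compMk a ((σ f g).toHomeo (compMk b c e₂)) e₃))
      ((σ f (g ≫ h)).toHomeo (compMk ((σ g h).toHomeo (compMk a b e₁)) c e₄))
  unit_left : ∀ {x y : C} (g : x ⟶ y) (a : (G y).Arr) (b : (X g).carrier)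
    (e : (G y).s a = (X g).r b) (e'),
    HEq ((σ g (𝟙 y)).toHomeo (compMk ((ι y).toHomeo a) b e')) ((X g).lact a b e)
  unit_right : ∀ {x y : C} (g : x ⟶ y) (b : (X g).carrier) (a : (G x).Arr)
    (e : (X g).s b = (G x).r a) (e'),
    HEq ((σ (𝟙 x) g).toHomeo (compMk b ((ι x).toHomeo a) e')) ((X g).ract b a e)

namespace GrHom

variable {C : Type u} [SmallCategory C]

/-- Each groupoid in the diagram is a discrete set with only identity arrows. -/
def IsDiscrete (H : GrHom C) : Prop := ∀ x, (H.G x).IsDiscreteSet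

/-- The homomorphism is proper: each correspondence in the diagram is proper. -/
def IsProper (H : GrHom C) : Prop := ∀ {x y : C} (g : x ⟶ y), (H.X g).IsProper

/-- An isomorphism of homomorphisms in the strict sense: isomorphisms of topological groupoids and
equivariant homeomorphisms of correspondences that are compatible with all the structure. -/
structure Iso (H H' : GrHom C) where
  obj (x : C) : (H.G x).Obj ≃ₜ (H'.G x).Obj
  arr (x : C) : (H.G x).Arr ≃ₜ (H'.G x).Arr
  arr_r : ∀ x a, (H'.G x).r (arr x a) = obj x ((H.G x).r a)
  arr_s : ∀ x a, (H'.G x).s (arr x a) = obj x ((H.G x).s a)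
  arr_mul : ∀ x a b e e', arr x ((H.G x).mul a b e) = (H'.G x).mul (arr x a) (arr x b) e'
  corr {x y : C} (g : x ⟶ y) : (H.X g).carrier ≃ₜ (H'.X g).carrier
  corr_r : ∀ {x y : C} (g : x ⟶ y) (a), (H'.X g).r (corr g a) = obj y ((H.X g).r a)
  corr_s : ∀ {x y : C} (g : x ⟶ y) (a), (H'.X g).s (corr g a) = obj x ((H.X g).s a)
  corr_lact : ∀ {x y : C} (g : x ⟶ y) (h a e e'),
    corr g ((H.X g).lact h a e) = (H'.X g).lact (arr y h) (corr g a) e'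
  corr_ract : ∀ {x y : C} (g : x ⟶ y) (a h e e'),
    corr g ((H.X g).ract a h e) = (H'.X g).ract (corr g a) (arr x h) e'
  corr_σ : ∀ {x y z : C} (f : x ⟶ y) (g : y ⟶ z) (a b e e'),
    corr (f ≫ g) ((H.σ f g).toHomeo (compMk a b e)) =
      (H'.σ f g).toHomeo (compMk (corr g a) (corr f b) e')
  corr_ι : ∀ (x : C) (a), corr (𝟙 x) ((H.ι x).toHomeo a) = (H'.ι x).toHomeo (arr x a)

/-- An equivalence of homomorphisms in the bicategorical sense: a strong transformation all of whose
components `W x : G' x ← G x` are equivalences in the bicategory of groupoid correspondences, with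
invertible 2-arrows `nat g : W y ∘ X g ⇒ X' g ∘ W x` for `g : x ⟶ y`. -/
structure Equivalence (H H' : GrHom C) where
  W (x : C) : BiSpace (H'.G x) (H.G x)
  isCorr : ∀ x, (W x).IsCorr
  isEquivalence : ∀ x, (W x).IsEquivalence
  nat {x y : C} (g : x ⟶ y) : BiIso (comp (W y) (H.X g)) (comp (H'.X g) (W x))
  nat_comp : ∀ {x y z : C} (f : x ⟶ y) (g : y ⟶ z)
    (w : (W z).carrier) (a : (H.X g).carrier) (b : (H.X f).carrier)
    (a' : (H'.X g).carrier) (w' : (W y).carrier) (b' : (H'.X f).carrier) (w'' : (W x).carrier)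
    (e₁ e₂ e₃ e₄ e₅ e₆ e₇ e₈),
    (nat g).toHomeo (compMk w a e₁) = compMk a' w' e₂ →
    (nat f).toHomeo (compMk w' b e₃) = compMk b' w'' e₄ →
    (nat (f ≫ g)).toHomeo (compMk w ((H.σ f g).toHomeo (compMk a b e₅)) e₆) =
      compMk ((H'.σ f g).toHomeo (compMk a' b' e₇)) w'' e₈
  nat_id : ∀ (x : C) (w : (W x).carrier) (a : (H.G x).Arr) (e : (W x).s w = (H.G x).r a) (e₁ e₂),
    (nat (𝟙 x)).toHomeo (compMk w ((H.ι x).toHomeo a) e₁) =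
      compMk ((H'.ι x).toHomeo ((H'.G x).unit ((W x).r w))) ((W x).ract w a e) e₂

end GrHom

/-! ## Discrete Conduché fibrations -/

/-- The unique factorisation lifting property of a functor `F : E ⥤ C`: for every arrow `φ` of `E`,
each factorisation `F φ = ρ ∘ l` lifts uniquely to a factorisation of `φ`. -/
def IsConduche {E C : Type u} [SmallCategory E] [SmallCategory C] (F : E ⥤ C) : Prop :=
  ∀ {y x : E} (φ : y ⟶ x) (z : C) (l : F.obj y ⟶ z) (ρ : z ⟶ F.obj x), l ≫ ρ = F.map φ →
    ∃! t : (Σ z' : E, (y ⟶ z') × (z' ⟶ x)), t.2.1 ≫ t.2.2 = φ ∧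
      ∃ h : F.obj t.1 = z, F.map t.2.1 ≫ eqToHom h = l ∧ eqToHom h.symm ≫ F.map t.2.2 = ρ

/-- A discrete Conduché fibration over `C`. -/
structure ConducheFibration (C : Type u) [SmallCategory C] : Type (u + 1) where
  E : Type u
  [cat : SmallCategory E]
  F : E ⥤ C
  isConduche : IsConduche F

attribute [instance] ConducheFibration.cat

namespace ConducheFibration

variable {C : Type u} [SmallCategory C]

/-- Isomorphism of fibrations over `C`: an isomorphism of the total categories over `C`. -/
def Isomorphic (F F' : ConducheFibration C) : Prop :=
  ∃ (Φ : F.E ⥤ F'.E) (Ψ : F'.E ⥤ F.E), Φ ⋙ Ψ = 𝟭 F.E ∧ Ψ ⋙ Φ = 𝟭 F'.E ∧ Φ ⋙ F'.F = F.F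

/-- The fibre `F⁻¹(g)`: the arrows of `E` that are mapped to `g`. -/
structure ArrFib (F : ConducheFibration C) {x y : C} (g : x ⟶ y) : Type u where
  src : F.E
  tgt : F.E
  obj_src : F.F.obj src = x
  obj_tgt : F.F.obj tgt = y
  hom : src ⟶ tgt
  map_hom : F.F.map hom = eqToHom obj_src ≫ g ≫ eqToHom obj_tgt.symm

/-- Row-finiteness: each arrow `g : x ⟶ F X` in `C` has only finitely many lifts with range `X`. -/
def IsRowFinite (F : ConducheFibration C) : Prop :=
  ∀ (X : F.E) {x : C} (g : x ⟶ F.F.obj X), {α : F.ArrFib g | α.tgt = X}.Finite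

end ConducheFibration

/-! ## The homomorphism associated to a discrete Conduché fibration -/

theorem isLocalHomeomorph_of_discrete {X Y : Type*} [TopologicalSpace X] [TopologicalSpace Y]
    [DiscreteTopology X] [DiscreteTopology Y] (f : X → Y) : IsLocalHomeomorph f := by
  refine IsLocalHomeomorph.mk f fun x => ?_
  refine ⟨{ toFun := f, invFun := fun _ => x, source := {x}, target := {f x},
            map_source' := ?_, map_target' := ?_, left_inv' := ?_, right_inv' := ?_,
            open_source := isOpen_discrete _, open_target := isOpen_discrete _,
            continuousOn_toFun := continuous_of_discreteTopology.continuousOn,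
            continuousOn_invFun := continuous_of_discreteTopology.continuousOn },
          Set.mem_singleton x, fun _ _ => rfl⟩ <;> simp

theorem discreteTopology_quot {X : Type*} [TopologicalSpace X] [DiscreteTopology X]
    (R : X → X → Prop) : DiscreteTopology (Quot R) :=
  discreteTopology_iff_forall_isOpen.2 fun _ =>
    (isQuotientMap_quot_mk (r := R)).isOpen_preimage.1 (isOpen_discrete _)

/-- The set `T` as a groupoid with the discrete topology and only identity arrows. -/
def EtGroupoid.ofSet (T : Type u) : EtGroupoid.{u} where
  Obj := T
  Arr := T
  topObj := ⊥
  topArr := ⊥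
  r := id
  s := id
  unit := id
  inv := id
  mul a _ _ := a
  r_unit _ := rfl
  s_unit _ := rfl
  r_inv _ := rfl
  s_inv _ := rfl
  r_mul _ _ _ := rfl
  s_mul _ _ e := e
  unit_mul _ := rfl
  mul_unit _ := rfl
  inv_mul _ := rfl
  mul_inv _ := rfl
  mul_assoc _ _ _ _ _ := rfl
  isLocalHomeomorph_r := by
    let _ : TopologicalSpace T := ⊥
    have : DiscreteTopology T := ⟨rfl⟩
    exact isLocalHomeomorph_of_discrete _
  isLocalHomeomorph_s := by
    let _ : TopologicalSpace T := ⊥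
    have : DiscreteTopology T := ⟨rfl⟩
    exact isLocalHomeomorph_of_discrete _
  continuous_mul := by
    let _ : TopologicalSpace T := ⊥
    have : DiscreteTopology T := ⟨rfl⟩
    exact continuous_of_discreteTopology
  continuous_inv := continuous_bot
  t2Space := by
    let _ : TopologicalSpace T := ⊥
    have : DiscreteTopology T := ⟨rfl⟩
    infer_instance
  locallyCompactSpace := by
    let _ : TopologicalSpace T := ⊥
    have : DiscreteTopology T := ⟨rfl⟩
    infer_instance

/-- A set `X` with maps `r : X → S` and `s : X → T` as a correspondence between discrete sets. -/
def BiSpace.ofSpan {S T : Type u} (X : Type u) (r : X → S) (s : X → T) :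
    BiSpace (EtGroupoid.ofSet S) (EtGroupoid.ofSet T) where
  carrier := X
  top := ⊥
  r := r
  s := s
  lact _ x _ := x
  ract x _ _ := x
  r_lact _ _ e := e.symm
  s_lact _ _ _ := rfl
  r_ract _ _ _ := rfl
  s_ract _ _ e := e
  unit_lact _ := rfl
  ract_unit _ := rfl
  mul_lact _ _ _ _ _ := rfl
  ract_mul _ _ _ _ _ := rfl
  lact_ract _ _ _ _ _ := rfl

instance (T : Type u) : DiscreteTopology (EtGroupoid.ofSet T).Obj := ⟨rfl⟩
instance (T : Type u) : DiscreteTopology (EtGroupoid.ofSet T).Arr := ⟨rfl⟩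
instance {S T : Type u} (X : Type u) (r : X → S) (s : X → T) :
    DiscreteTopology (BiSpace.ofSpan X r s).carrier := ⟨rfl⟩

theorem BiSpace.isCorr_ofSpan {S T : Type u} (X : Type u) (r : X → S) (s : X → T) :
    (BiSpace.ofSpan X r s).IsCorr where
  continuous_r := continuous_of_discreteTopology
  isLocalHomeomorph_s := isLocalHomeomorph_of_discrete _
  continuous_lact := continuous_of_discreteTopology
  continuous_ract := continuous_of_discreteTopology
  free _ _ e _ := e.symm
  proper := by
    refine (Topology.IsClosedEmbedding.of_continuous_injective_isClosedMap
      continuous_of_discreteTopology ?_ fun s _ => isClosed_discrete _).isProperMap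
    rintro ⟨⟨x, g⟩, h⟩ ⟨⟨x', g'⟩, h'⟩ hx
    obtain rfl : x = x' := congrArg Prod.snd hx
    obtain rfl : g = g' := h.symm.trans h'
    rfl

theorem ofSpan_rel_eq {R S T X Y : Type u} {r : X → R} {s : X → S} {r' : Y → S} {s' : Y → T}
    {p q : FibProd (BiSpace.ofSpan X r s) (BiSpace.ofSpan Y r' s')}
    (h : DiagRel _ _ p q) : p = q := by
  obtain ⟨g, e₁, e₂, h₁, h₂⟩ := h
  exact Subtype.ext (Prod.ext h₁ h₂)

/-- A bijection from a fibre product to a set over and under the given sets gives an invertible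
2-arrow from the composite. -/
noncomputable def BiIso.ofSpan {R S T X Y Z : Type u} {r : X → R} {s : X → S} {r' : Y → S}
    {s' : Y → T} {r'' : Z → R} {s'' : Z → T} (m : (x : X) → (y : Y) → s x = r' y → Z)
    (hm : Function.Bijective fun p : {p : X × Y // s p.1 = r' p.2} => m p.1.1 p.1.2 p.2)
    (hr : ∀ x y e, r'' (m x y e) = r x) (hs : ∀ x y e, s'' (m x y e) = s' y) :
    BiIso (comp (BiSpace.ofSpan X r s) (BiSpace.ofSpan Y r' s')) (BiSpace.ofSpan Z r'' s'') where
  toHomeo :=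
    haveI : DiscreteTopology (comp (BiSpace.ofSpan X r s) (BiSpace.ofSpan Y r' s')).carrier :=
      discreteTopology_quot _
    Equiv.toHomeomorphOfDiscrete <| Equiv.ofBijective
      (Quot.lift (fun p => m p.1.1 p.1.2 p.2) fun p q h => by rw [ofSpan_rel_eq h])
      ⟨by
        rintro ⟨p⟩ ⟨q⟩ h
        exact congrArg (Quot.mk _) (hm.1 h), fun z => by
        obtain ⟨p, hp⟩ := hm.2 z
        exact ⟨Quot.mk _ p, hp⟩⟩
  r_map := Quot.ind fun _ => hr _ _ _
  s_map := Quot.ind fun _ => hs _ _ _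
  map_lact _ := Quot.ind fun _ _ => rfl
  map_ract := Quot.ind fun _ _ _ => rfl

namespace ConducheFibration

variable {C : Type u} [SmallCategory C] {F : ConducheFibration C}

/-- The fibre `F⁻¹(x)` of objects. -/
abbrev ObjFib (F : ConducheFibration C) (x : C) : Type u := {X : F.E // F.F.obj X = x}

namespace ArrFib

/-- The range map `F⁻¹(g) → F⁻¹(y)` for `g : x ⟶ y`. -/
def r {x y : C} {g : x ⟶ y} (α : F.ArrFib g) : F.ObjFib y := ⟨α.tgt, α.obj_tgt⟩

/-- The source map `F⁻¹(g) → F⁻¹(x)` for `g : x ⟶ y`. -/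
def s {x y : C} {g : x ⟶ y} (α : F.ArrFib g) : F.ObjFib x := ⟨α.src, α.obj_src⟩

theorem heq_of {x y : C} {g g' : x ⟶ y} (hg : g = g') {α : F.ArrFib g} {α' : F.ArrFib g'}
    (h₁ : α.src = α'.src) (h₂ : α.tgt = α'.tgt) (h₃ : HEq α.hom α'.hom) : HEq α α' := by
  subst hg
  obtain ⟨X, Y, hX, hY, φ, h⟩ := α
  obtain ⟨X', Y', hX', hY', φ', h'⟩ := α'
  dsimp at h₁ h₂ h₃
  subst h₁ h₂ h₃
  rfl

/-- The composition in `E`, restricted to fibres. -/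
def mul {x y z : C} {f : x ⟶ y} {g : y ⟶ z} (α : F.ArrFib g) (β : F.ArrFib f)
    (e : α.s = β.r) : F.ArrFib (f ≫ g) where
  src := β.src
  tgt := α.tgt
  obj_src := β.obj_src
  obj_tgt := α.obj_tgt
  hom := β.hom ≫ eqToHom (show β.tgt = α.src from (congrArg Subtype.val e).symm) ≫ α.hom
  map_hom := by simp [α.map_hom, β.map_hom, eqToHom_map]

/-- The identity on an object of `E`, as an element of a fibre. -/
def one {x : C} (X : F.ObjFib x) : F.ArrFib (𝟙 x) where
  src := X.1
  tgt := X.1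
  obj_src := X.2
  obj_tgt := X.2
  hom := 𝟙 X.1
  map_hom := by simp

theorem mul_bijective {x y z : C} (f : x ⟶ y) (g : y ⟶ z) :
    Function.Bijective fun p : {p : F.ArrFib g × F.ArrFib f // p.1.s = p.2.r} =>
      mul p.1.1 p.1.2 p.2 := by
  constructor
  · rintro ⟨⟨⟨X, Y, hX, hY, φ, h⟩, ⟨Z, X', hZ, hX', ψ, h'⟩⟩, e⟩
      ⟨⟨⟨X₁, Y₁, hX₁, hY₁, φ₁, h₁⟩, ⟨Z₁, X₁', hZ₁, hX₁', ψ₁, h₁'⟩⟩, e₁⟩ he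
    obtain rfl : X = X' := congrArg Subtype.val e
    obtain rfl : X₁ = X₁' := congrArg Subtype.val e₁
    simp only [mul, eqToHom_refl, Category.id_comp, mk.injEq] at he
    obtain ⟨rfl, rfl, he⟩ := he
    have he := eq_of_heq he
    subst hX hY hZ
    simp only [eqToHom_refl, Category.id_comp, Category.comp_id] at h h' h₁ h₁'
    subst h h'
    obtain ⟨t, -, ht⟩ := F.isConduche (ψ ≫ φ) (F.F.obj X) (F.F.map ψ) (F.F.map φ) (by simp)
    have a₁ := ht ⟨X, ψ, φ⟩ ⟨rfl, rfl, by simp⟩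
    have a₂ := ht ⟨X₁, ψ₁, φ₁⟩ ⟨he.symm, hX₁, by simp [h₁'], by simp [h₁]⟩
    have a := a₁.trans a₂.symm
    simp only [Sigma.mk.injEq] at a
    obtain ⟨rfl, a⟩ := a
    have a := eq_of_heq a
    simp only [Prod.mk.injEq] at a
    obtain ⟨rfl, rfl⟩ := a
    rfl
  · rintro ⟨X, Y, hX, hY, φ, h⟩
    subst hX hY
    simp only [eqToHom_refl, Category.id_comp, Category.comp_id] at h
    obtain ⟨⟨Z, ψ, φ'⟩, ⟨h₁, hZ, h₂, h₃⟩, -⟩ := F.isConduche φ y f g h.symm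
    dsimp at h₁ hZ h₂ h₃
    subst hZ h₁
    refine ⟨⟨⟨⟨Z, Y, rfl, rfl, φ', by simpa using h₃⟩, ⟨X, Z, rfl, rfl, ψ, by simpa using h₂⟩⟩,
      rfl⟩, ?_⟩
    simp [mul]

theorem one_bijective (x : C) : Function.Bijective (one (F := F) (x := x)) := by
  constructor
  · intro X Y h
    exact Subtype.ext (congrArg ArrFib.src h)
  · rintro ⟨X, Y, hX, hY, φ, h⟩
    subst hX
    simp only [eqToHom_refl, Category.id_comp] at h
    obtain ⟨t, -, ht⟩ := F.isConduche φ (F.F.obj X) (𝟙 _) (F.F.map φ) (by simp)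
    have a₁ := ht ⟨X, 𝟙 X, φ⟩ ⟨by simp, rfl, by simp⟩
    have a₂ := ht ⟨Y, φ, 𝟙 Y⟩ ⟨by simp, hY, by simp [h], by simp [h]⟩
    have a := a₁.trans a₂.symm
    simp only [Sigma.mk.injEq] at a
    obtain ⟨rfl, a⟩ := a
    have a := eq_of_heq a
    simp only [Prod.mk.injEq] at a
    obtain ⟨rfl, -⟩ := a
    exact ⟨⟨X, rfl⟩, rfl⟩

end ArrFib

/-- The bicategory homomorphism associated to a discrete Conduché fibration: `x` goes to the discrete
set `F⁻¹(x)`, an arrow `g` to the correspondence `F⁻¹(g)`, and the 2-arrows `σ` are given by the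
composition in `E`. -/
noncomputable def toGrHom (F : ConducheFibration C) : GrHom C where
  G x := EtGroupoid.ofSet (F.ObjFib x)
  X g := BiSpace.ofSpan (F.ArrFib g) ArrFib.r ArrFib.s
  isCorr g := BiSpace.isCorr_ofSpan _ _ _
  σ f g := BiIso.ofSpan (ArrFib.mul (f := f) (g := g)) (ArrFib.mul_bijective f g)
    (fun _ _ _ => rfl) (fun _ _ _ => rfl)
  ι x :=
    { toHomeo :=
        haveI : DiscreteTopology (idCorr (EtGroupoid.ofSet (F.ObjFib x))).carrier := ⟨rfl⟩
        Equiv.toHomeomorphOfDiscrete (Y := (BiSpace.ofSpan (F.ArrFib (𝟙 x)) _ _).carrier)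
          (Equiv.ofBijective _ (ArrFib.one_bijective x))
      r_map := fun _ => rfl
      s_map := fun _ => rfl
      map_lact := fun _ _ e => congrArg ArrFib.one e
      map_ract := fun _ _ _ => rfl }
  assoc f g h a b c e₁ e₂ e₃ e₄ := by
    refine ArrFib.heq_of (Category.assoc f g h) rfl rfl (heq_of_eq ?_)
    change (ArrFib.mul a (ArrFib.mul b c e₂) e₃).hom = (ArrFib.mul (ArrFib.mul a b e₁) c e₄).hom
    simp [ArrFib.mul]
  unit_left g a b e e' := by
    have h : a = b.r := e
    subst h
    refine ArrFib.heq_of (Category.comp_id g) rfl rfl (heq_of_eq ?_)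
    change (ArrFib.mul (ArrFib.one b.r) b e').hom = b.hom
    simp [ArrFib.mul, ArrFib.one, ArrFib.r]
  unit_right g b a e e' := by
    have h : b.s = a := e
    subst h
    refine ArrFib.heq_of (Category.id_comp g) rfl rfl (heq_of_eq ?_)
    change (ArrFib.mul b (ArrFib.one b.s) e').hom = b.hom
    simp [ArrFib.mul, ArrFib.one, ArrFib.s]

end ConducheFibration

/-! ## C⋆-algebras and C⋆-correspondences of groupoids and groupoid correspondences -/

/-- The space `𝔖(X)`: the linear span of the functions that are continuous with compact support on
some open Hausdorff subset `V` and are extended by zero outside `V`. -/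
noncomputable def quasiCont (X : Type u) [TopologicalSpace X] : Submodule ℂ (X → ℂ) :=
  Submodule.span ℂ {f | ∃ V : Set X, IsOpen V ∧ T2Space V ∧ ContinuousOn f V ∧
    ∃ K ⊆ V, IsCompact K ∧ ∀ x ∉ K, f x = 0}

/-- The characteristic function of an isolated point. -/
noncomputable def quasiCont.delta {X : Type u} [TopologicalSpace X] (x : X) (hx : IsOpen {x}) :
    quasiCont X :=
  ⟨Set.indicator {x} 1, Submodule.subset_span ⟨{x}, hx, inferInstance, by
    simp, {x}, subset_rfl, isCompact_singleton, fun y hy => by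
    simpa using hy⟩⟩

/-- A linear map on `𝔖(G)` is a ⋆-homomorphism for the convolution
`(ξ * η)(g) = ∑_{r(h) = r(g)} ξ(h) η(h⁻¹ g)` and the involution `ξ^*(g) = conj (ξ(g⁻¹))`. -/
structure EtGroupoid.IsStarRep (G : EtGroupoid.{u}) {A : Type u} [NonUnitalCStarAlgebra A]
    (ρ : quasiCont G.Arr →ₗ[ℂ] A) : Prop where
  map_conv : ∀ ξ η ζ : quasiCont G.Arr,
    (∀ g, ζ.1 g = ∑ᶠ h : {h : G.Arr // G.r h = G.r g},
      ξ.1 h.1 * η.1 (G.mul (G.inv h.1) g ((G.s_inv _).trans h.2))) → ρ ζ = ρ ξ * ρ η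
  map_star : ∀ ξ ζ : quasiCont G.Arr, (∀ g, ζ.1 g = star (ξ.1 (G.inv g))) → ρ ζ = star (ρ ξ)

/-- `ρ : 𝔖(G) → A` exhibits `A` as the groupoid C⋆-algebra `C⋆(G)`, that is, as the completion of
`𝔖(G)` in the largest C⋆-norm. -/
structure EtGroupoid.IsCStar (G : EtGroupoid.{u}) {A : Type u} [NonUnitalCStarAlgebra A]
    (ρ : quasiCont G.Arr →ₗ[ℂ] A) : Prop where
  isStarRep : G.IsStarRep ρ
  denseRange : DenseRange ρ
  norm_max : ∀ {B : Type u} [NonUnitalCStarAlgebra B] (τ : quasiCont G.Arr →ₗ[ℂ] B),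
    G.IsStarRep τ → ∀ ξ, ‖τ ξ‖ ≤ ‖ρ ξ‖

/-- A C⋆-correspondence `A ← B`: a (right) Hilbert `B`-module, with inner product linear in the
second variable, and a nondegenerate ⋆-representation of `A` by adjointable operators. -/
structure CStarCorr (A B : Type u) [NonUnitalCStarAlgebra A] [NonUnitalCStarAlgebra B] :
    Type (u + 1) where
  carrier : Type u
  [normed : NormedAddCommGroup carrier]
  [space : NormedSpace ℂ carrier]
  [complete : CompleteSpace carrier]
  rsmul : carrier →ₗ[ℂ] B →ₗ[ℂ] carrier
  rsmul_mul : ∀ ξ b c, rsmul ξ (b * c) = rsmul (rsmul ξ b) c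
  inner : carrier → carrier → B
  inner_add : ∀ ξ η ζ, inner ξ (η + ζ) = inner ξ η + inner ξ ζ
  inner_smul : ∀ (c : ℂ) ξ η, inner ξ (c • η) = c • inner ξ η
  inner_rsmul : ∀ ξ η b, inner ξ (rsmul η b) = inner ξ η * b
  star_inner : ∀ ξ η, star (inner ξ η) = inner η ξ
  inner_self_nonneg : ∀ ξ, ∃ b, inner ξ ξ = star b * b
  norm_sq : ∀ ξ, ‖ξ‖ ^ 2 = ‖inner ξ ξ‖
  lsmul : A →ₗ[ℂ] carrier →L[ℂ] carrier
  lsmul_mul : ∀ a b ξ, lsmul (a * b) ξ = lsmul a (lsmul b ξ)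
  inner_lsmul : ∀ a ξ η, inner (lsmul a ξ) η = inner ξ (lsmul (star a) η)
  nondegenerate : Dense (Submodule.span ℂ {ζ | ∃ a ξ, ζ = lsmul a ξ} : Set carrier)

attribute [instance] CStarCorr.normed CStarCorr.space CStarCorr.complete

/-- The operator `T` is the rank-one operator `|ξ⟩⟨η|`. -/
def CStarCorr.IsRankOne {A B : Type u} [NonUnitalCStarAlgebra A] [NonUnitalCStarAlgebra B]
    (E : CStarCorr A B) (ξ η : E.carrier) (T : E.carrier →L[ℂ] E.carrier) : Prop :=
  ∀ ζ, T ζ = E.rsmul ξ (E.inner η ζ)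

/-- The compact operators on a Hilbert module: the closed linear span of the rank-one operators. -/
noncomputable def CStarCorr.compacts {A B : Type u} [NonUnitalCStarAlgebra A] [NonUnitalCStarAlgebra B]
    (E : CStarCorr A B) : Submodule ℂ (E.carrier →L[ℂ] E.carrier) :=
  (Submodule.span ℂ {T | ∃ ξ η, E.IsRankOne ξ η T}).topologicalClosure

/-! ## Product systems over a category and their absolute Cuntz–Pimsner algebras -/

/-- A product system over the category `C`, that is, a bicategory homomorphism from `C` to the
bicategory of C⋆-correspondences: C⋆-algebras `A x`, correspondences `E g : A y ← A x` for
`g : x ⟶ y`, and unitary bimodule maps `E g ⊗ E f → E (g f)` and `A x → E (1 x)` that satisfy the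
coherence conditions.  A unitary from the completed tensor product `E g ⊗ E f` is given as a bilinear
map that is isometric for the tensor product inner product
`⟨ξ ⊗ η, ξ' ⊗ η'⟩ = ⟨η, ⟨ξ, ξ'⟩ η'⟩` and whose range spans a dense subspace. -/
structure ProductSystem (C : Type u) [SmallCategory C] : Type (u + 1) where
  A : C → Type u
  [alg : ∀ x, NonUnitalCStarAlgebra (A x)]
  E {x y : C} (g : x ⟶ y) : CStarCorr (A y) (A x)
  mul {x y z : C} (f : x ⟶ y) (g : y ⟶ z) :
    (E g).carrier →ₗ[ℂ] (E f).carrier →ₗ[ℂ] (E (f ≫ g)).carrier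
  inner_mul : ∀ {x y z : C} (f : x ⟶ y) (g : y ⟶ z) (ξ ξ' η η'),
    (E (f ≫ g)).inner (mul f g ξ η) (mul f g ξ' η') =
      (E f).inner η ((E f).lsmul ((E g).inner ξ ξ') η')
  dense_mul : ∀ {x y z : C} (f : x ⟶ y) (g : y ⟶ z),
    Dense (Submodule.span ℂ {ζ | ∃ ξ η, ζ = mul f g ξ η} : Set (E (f ≫ g)).carrier)
  lsmul_mul : ∀ {x y z : C} (f : x ⟶ y) (g : y ⟶ z) (a ξ η),
    (E (f ≫ g)).lsmul a (mul f g ξ η) = mul f g ((E g).lsmul a ξ) η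
  rsmul_mul : ∀ {x y z : C} (f : x ⟶ y) (g : y ⟶ z) (ξ η b),
    (E (f ≫ g)).rsmul (mul f g ξ η) b = mul f g ξ ((E f).rsmul η b)
  one (x : C) : A x →ₗ[ℂ] (E (𝟙 x)).carrier
  one_surjective : ∀ x, Function.Surjective (one x)
  inner_one : ∀ x a b, (E (𝟙 x)).inner (one x a) (one x b) = star a * b
  lsmul_one : ∀ x a b, (E (𝟙 x)).lsmul a (one x b) = one x (a * b)
  rsmul_one : ∀ x a b, (E (𝟙 x)).rsmul (one x a) b = one x (a * b)
  mul_assoc : ∀ {w x y z : C} (f : w ⟶ x) (g : x ⟶ y) (h : y ⟶ z) (ξ η ζ),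
    HEq (mul (f ≫ g) h ξ (mul f g η ζ)) (mul f (g ≫ h) (mul g h ξ η) ζ)
  one_mul : ∀ {x y : C} (g : x ⟶ y) (a ξ), HEq (mul g (𝟙 y) (one y a) ξ) ((E g).lsmul a ξ)
  mul_one : ∀ {x y : C} (g : x ⟶ y) (ξ a), HEq (mul (𝟙 x) g ξ (one x a)) ((E g).rsmul ξ a)

attribute [instance] ProductSystem.alg

namespace ProductSystem

variable {C : Type u} [SmallCategory C]

/-- A product system is proper if the left actions are by compact operators. -/
def IsProper (P : ProductSystem C) : Prop :=
  ∀ {x y : C} (g : x ⟶ y) (a : P.A y), (P.E g).lsmul a ∈ (P.E g).compacts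

/-- A representation of a product system in a C⋆-algebra `B` that is Cuntz–Pimsner covariant on all
elements of the algebras `A y` that act by compact operators (so on all elements if the product
system is proper).  The linear map `ψ` in `covariant` is the map on compact operators with
`|ξ⟩⟨η| ↦ t(ξ) t(η)^*`. -/
structure CovRep (P : ProductSystem C) (B : Type u) [NonUnitalCStarAlgebra B] where
  π (x : C) : P.A x →⋆ₙₐ[ℂ] B
  t {x y : C} (g : x ⟶ y) : (P.E g).carrier →ₗ[ℂ] B
  orthogonal : ∀ {x y : C}, x ≠ y → ∀ a b, π x a * π y b = 0
  t_one : ∀ x a, t (𝟙 x) (P.one x a) = π x a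
  inner : ∀ {x y : C} (g : x ⟶ y) (ξ η), star (t g ξ) * t g η = π x ((P.E g).inner ξ η)
  lsmul : ∀ {x y : C} (g : x ⟶ y) (a ξ), t g ((P.E g).lsmul a ξ) = π y a * t g ξ
  rsmul : ∀ {x y : C} (g : x ⟶ y) (ξ a), t g ((P.E g).rsmul ξ a) = t g ξ * π x a
  mul : ∀ {x y z : C} (f : x ⟶ y) (g : y ⟶ z) (ξ η), t (f ≫ g) (P.mul f g ξ η) = t g ξ * t f η
  covariant : ∀ {x y : C} (g : x ⟶ y), ∃ ψ : (P.E g).compacts →L[ℂ] B,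
    (∀ ξ η (T : (P.E g).compacts), (P.E g).IsRankOne ξ η T.1 → ψ T = t g ξ * star (t g η)) ∧
    ∀ a (T : (P.E g).compacts), T.1 = (P.E g).lsmul a → ψ T = π y a

/-- The representation `ρ` in `O` is the universal Cuntz–Pimsner covariant representation.  For a
proper product system, this says that `O` is the absolute Cuntz–Pimsner algebra. -/
def CovRep.IsUniversal {P : ProductSystem C} {O : Type u} [NonUnitalCStarAlgebra O]
    (ρ : P.CovRep O) : Prop :=
  ∀ {B : Type u} [NonUnitalCStarAlgebra B] (τ : P.CovRep B), ∃! Φ : O →⋆ₙₐ[ℂ] B,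
    (∀ x a, Φ (ρ.π x a) = τ.π x a) ∧ ∀ {x y : C} (g : x ⟶ y) (ξ), Φ (ρ.t g ξ) = τ.t g ξ

end ProductSystem

/-- The data that exhibit `P` as the product system associated to a homomorphism `H` to groupoid
correspondences, that is, as the composite of `H` with the homomorphism `G ↦ C⋆(G)`,
`X ↦ C⋆(X)` to C⋆-correspondences.  Here `C⋆(X)` is the completion of `𝔖(X)` for the `C⋆(G)`-valued
inner product `⟨ξ, η⟩(g) = ∑_{s(x) = r(g)} conj (ξ(x)) η(x g)`, with the bimodule structure
`(ξ * γ)(x) = ∑_{r(g) = s(x)} ξ(x g) γ(g⁻¹)` and `(ζ * ξ)(x) = ∑_{r(h) = r(x)} ζ(h) ξ(h⁻¹ x)`, and the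
multiplication is induced by
`(f₁ ⊗ f₂)([x, y]) = ∑_{r(k) = s(x)} f₁(x k) f₂(k⁻¹ y)` and the 2-arrows `σ` of `H`. -/
structure GrHom.CStarModel {C : Type u} [SmallCategory C] (H : GrHom C) (P : ProductSystem C) where
  toA (x : C) : quasiCont (H.G x).Arr →ₗ[ℂ] P.A x
  isCStar : ∀ x, (H.G x).IsCStar (toA x)
  toE {x y : C} (g : x ⟶ y) : quasiCont (H.X g).carrier →ₗ[ℂ] (P.E g).carrier
  denseRange : ∀ {x y : C} (g : x ⟶ y), DenseRange (toE g)
  inner : ∀ {x y : C} (g : x ⟶ y) (ξ η : quasiCont (H.X g).carrier) (γ : quasiCont (H.G x).Arr),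
    (∀ a, γ.1 a = ∑ᶠ p : {p : (H.X g).carrier // (H.X g).s p = (H.G x).r a},
      star (ξ.1 p.1) * η.1 ((H.X g).ract p.1 a p.2)) →
    (P.E g).inner (toE g ξ) (toE g η) = toA x γ
  rsmul : ∀ {x y : C} (g : x ⟶ y) (ξ ζ : quasiCont (H.X g).carrier) (γ : quasiCont (H.G x).Arr),
    (∀ p, ζ.1 p = ∑ᶠ a : {a : (H.G x).Arr // (H.G x).r a = (H.X g).s p},
      ξ.1 ((H.X g).ract p a.1 a.2.symm) * γ.1 ((H.G x).inv a.1)) →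
    (P.E g).rsmul (toE g ξ) (toA x γ) = toE g ζ
  lsmul : ∀ {x y : C} (g : x ⟶ y) (ξ ζ : quasiCont (H.X g).carrier) (γ : quasiCont (H.G y).Arr),
    (∀ p, ζ.1 p = ∑ᶠ a : {a : (H.G y).Arr // (H.G y).r a = (H.X g).r p},
      γ.1 a.1 * ξ.1 ((H.X g).lact ((H.G y).inv a.1) p (((H.G y).s_inv _).trans a.2))) →
    (P.E g).lsmul (toA y γ) (toE g ξ) = toE g ζ
  mul : ∀ {x y z : C} (f : x ⟶ y) (g : y ⟶ z) (ξ : quasiCont (H.X g).carrier)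
    (η : quasiCont (H.X f).carrier) (ζ : quasiCont (H.X (f ≫ g)).carrier),
    (∀ p q (e : (H.X g).s p = (H.X f).r q), ζ.1 ((H.σ f g).toHomeo (compMk p q e)) =
      ∑ᶠ k : {k : (H.G y).Arr // (H.G y).r k = (H.X g).s p},
        ξ.1 ((H.X g).ract p k.1 k.2.symm) *
          η.1 ((H.X f).lact ((H.G y).inv k.1) q (((H.G y).s_inv _).trans (k.2.trans e)))) →
    P.mul f g (toE g ξ) (toE f η) = toE (f ≫ g) ζ
  one : ∀ (x : C) (γ : quasiCont (H.G x).Arr) (ζ : quasiCont (H.X (𝟙 x)).carrier),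
    (∀ a, ζ.1 ((H.ι x).toHomeo a) = γ.1 a) → P.one x (toA x γ) = toE (𝟙 x) ζ

/-! ## The C⋆-algebra of a discrete Conduché fibration -/

namespace ConducheFibration

variable {C : Type u} [SmallCategory C]

/-- Families of projections and partial isometries in a C⋆-algebra that satisfy the defining
relations of `C⋆(F)`.  The product `α β` in `E` is `β ≫ α` in Lean. -/
structure Family (F : ConducheFibration C) (A : Type u) [NonUnitalCStarAlgebra A] where
  P : F.E → A
  S {Y X : F.E} : (Y ⟶ X) → A
  isStarProjection : ∀ X, IsStarProjection (P X)
  partial_isometry : ∀ {Y X : F.E} (α : Y ⟶ X), S α * star (S α) * S α = S α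
  orthogonal : ∀ {X Y : F.E}, X ≠ Y → P X * P Y = 0
  S_comp : ∀ {X Y Z : F.E} (β : Z ⟶ Y) (α : Y ⟶ X), S (β ≫ α) = S α * S β
  S_id : ∀ X, P X = S (𝟙 X)
  star_S_mul_S : ∀ {Y X : F.E} (α : Y ⟶ X), star (S α) * S α = P Y
  star_S_mul_S_of_ne : ∀ {x y : C} (g : x ⟶ y) (α β : F.ArrFib g), α ≠ β →
    star (S β.hom) * S α.hom = 0
  sum_eq : ∀ (X : F.E) {x : C} (g : x ⟶ F.F.obj X),
    ∑ᶠ α ∈ {α : F.ArrFib g | α.tgt = X}, S α.hom * star (S α.hom) = P X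

/-- The family `p` in `A` is universal, that is, `A` is the C⋆-algebra `C⋆(F)` with generators given
by `p`. -/
def Family.IsUniversal {F : ConducheFibration C} {A : Type u} [NonUnitalCStarAlgebra A]
    (p : F.Family A) : Prop :=
  ∀ {B : Type u} [NonUnitalCStarAlgebra B] (q : F.Family B), ∃! Φ : A →⋆ₙₐ[ℂ] B,
    (∀ X, Φ (p.P X) = q.P X) ∧ ∀ {Y X : F.E} (α : Y ⟶ X), Φ (p.S α) = q.S α

variable {F : ConducheFibration C} {H : GrHom C}

/-- An object of `E` as a unit arrow of the groupoid `F⁻¹(F X)`. -/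
def objPt (F : ConducheFibration C) (X : F.E) : (F.toGrHom.G (F.F.obj X)).Arr :=
  (⟨X, rfl⟩ : F.ObjFib (F.F.obj X))

/-- An arrow of `E` as an element of the correspondence `F⁻¹(F α)`. -/
def arrPt (F : ConducheFibration C) {Y X : F.E} (α : Y ⟶ X) :
    (F.toGrHom.X (F.F.map α)).carrier :=
  (⟨Y, X, rfl, rfl, α, by simp⟩ : F.ArrFib (F.F.map α))

/-- The delta function `δ_X` for an object `X` of `E`, transported along an isomorphism of the
associated homomorphism with `H`. -/
noncomputable def deltaObj (θ : F.toGrHom.Iso H) (X : F.E) :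
    quasiCont (H.G (F.F.obj X)).Arr :=
  quasiCont.delta (θ.arr (F.F.obj X) (F.objPt X)) (by
    rw [← Set.image_singleton]
    exact (θ.arr _).isOpenMap _ (isOpen_discrete (α := (EtGroupoid.ofSet _).Arr) _))

/-- The delta function `δ_α` for an arrow `α` of `E`, transported along an isomorphism of the
associated homomorphism with `H`. -/
noncomputable def deltaArr (θ : F.toGrHom.Iso H) {Y X : F.E} (α : Y ⟶ X) :
    quasiCont (H.X (F.F.map α)).carrier :=
  quasiCont.delta (θ.corr (F.F.map α) (F.arrPt α)) (by
    rw [← Set.image_singleton]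
    exact (θ.corr _).isOpenMap _ (isOpen_discrete (α := (BiSpace.ofSpan _ _ _).carrier) _))

end ConducheFibration

/-! ## Discrete sets as groupoids -/

namespace EtGroupoid.IsDiscreteSet

variable {G : EtGroupoid.{u}}

theorem eq_unit_s (hG : G.IsDiscreteSet) (a : G.Arr) : a = G.unit (G.s a) := hG.2 a

theorem r_eq_s (hG : G.IsDiscreteSet) (a : G.Arr) : G.r a = G.s a := by
  conv_lhs => rw [hG.2 a]
  exact G.r_unit _

theorem eq_unit_r (hG : G.IsDiscreteSet) (a : G.Arr) : a = G.unit (G.r a) := by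
  rw [hG.r_eq_s]; exact hG.2 a

theorem inv_eq (hG : G.IsDiscreteSet) (a : G.Arr) : G.inv a = a := by
  rw [hG.eq_unit_s (G.inv a), G.s_inv, ← hG.eq_unit_r a]

theorem mul_eq_left (hG : G.IsDiscreteSet) (a b : G.Arr) (e : G.s a = G.r b) :
    G.mul a b e = a := by
  rw [hG.eq_unit_r (G.mul a b e), G.r_mul, ← hG.eq_unit_r a]

theorem mul_eq_right (hG : G.IsDiscreteSet) (a b : G.Arr) (e : G.s a = G.r b) :
    G.mul a b e = b := by
  rw [hG.eq_unit_s (G.mul a b e), G.s_mul, ← hG.eq_unit_s b]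

theorem discreteTopology_arr (hG : G.IsDiscreteSet) : DiscreteTopology G.Arr :=
  haveI := hG.1
  G.isLocalHomeomorph_r.comap_discreteTopology

/-- The arrows of a discrete set, viewed as a groupoid, are its points. -/
def arrEquiv (hG : G.IsDiscreteSet) : G.Arr ≃ G.Obj where
  toFun := G.s
  invFun := G.unit
  left_inv a := (hG.2 a).symm
  right_inv := G.s_unit

end EtGroupoid.IsDiscreteSet

namespace BiSpace

variable {H G K : EtGroupoid.{u}}

theorem IsCorr.discreteTopology {X : BiSpace H G} (hX : X.IsCorr) (hG : G.IsDiscreteSet) :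
    DiscreteTopology X.carrier :=
  haveI := hG.1
  hX.isLocalHomeomorph_s.comap_discreteTopology

theorem lact_eq_self (X : BiSpace H G) (hH : H.IsDiscreteSet) (h : H.Arr) (x : X.carrier)
    (e : H.s h = X.r x) : X.lact h x e = x := by
  obtain rfl : h = H.unit (X.r x) := by rw [← e]; exact hH.2 h
  exact X.unit_lact x

theorem ract_eq_self (X : BiSpace H G) (hG : G.IsDiscreteSet) (x : X.carrier) (g : G.Arr)
    (e : X.s x = G.r g) : X.ract x g e = x := by
  obtain rfl : g = G.unit (X.s x) := by rw [e]; exact hG.eq_unit_r g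
  exact X.ract_unit x

theorem eq_of_diagRel (hG : G.IsDiscreteSet) {X : BiSpace H G} {Y : BiSpace G K}
    {p q : FibProd X Y} (h : DiagRel X Y p q) : p = q := by
  obtain ⟨g, e₁, e₂, h₁, h₂⟩ := h
  rw [X.ract_eq_self hG] at h₁
  rw [Y.lact_eq_self hG] at h₂
  exact Subtype.ext (Prod.ext h₁ h₂)

theorem eq_of_orbitRel (hG : G.IsDiscreteSet) {X : BiSpace H G} {p q : X.carrier}
    (h : X.OrbitRel p q) : p = q := by
  obtain ⟨g, e, h⟩ := h
  rwa [X.ract_eq_self hG] at h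

/-- Over a discrete set, the composite of correspondences is the fibre product. -/
def compEquiv (hG : G.IsDiscreteSet) (X : BiSpace H G) (Y : BiSpace G K) :
    (comp X Y).carrier ≃ FibProd X Y where
  toFun := Quot.lift id fun _ _ h => eq_of_diagRel hG h
  invFun := Quot.mk _
  left_inv := Quot.ind fun _ => rfl
  right_inv _ := rfl

theorem compMk_inj (hG : G.IsDiscreteSet) {X : BiSpace H G} {Y : BiSpace G K}
    {x x' : X.carrier} {y y' : Y.carrier} {e : X.s x = Y.r y} {e' : X.s x' = Y.r y'}
    (h : compMk x y e = compMk x' y' e') : x = x' ∧ y = y' := by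
  have := congrArg (compEquiv hG X Y) h
  exact ⟨congrArg (fun p => p.1.1) this, congrArg (fun p => p.1.2) this⟩

theorem exists_compMk {X : BiSpace H G} {Y : BiSpace G K} (z : (comp X Y).carrier) :
    ∃ x y e, compMk (X := X) (Y := Y) x y e = z := by
  obtain ⟨⟨⟨x, y⟩, e⟩⟩ := z
  exact ⟨x, y, e, rfl⟩

theorem discreteTopology_comp {X : BiSpace H G} {Y : BiSpace G K}
    (hX : DiscreteTopology X.carrier) (hY : DiscreteTopology Y.carrier) :
    DiscreteTopology (comp X Y).carrier :=
  discreteTopology_quot _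

/-- A bijection over and under the given discrete sets is an invertible 2-arrow. -/
def BiIso.ofDiscrete (hH : H.IsDiscreteSet) (hG : G.IsDiscreteSet) {X Y : BiSpace H G}
    (hX : DiscreteTopology X.carrier) (hY : DiscreteTopology Y.carrier)
    (f : X.carrier ≃ Y.carrier) (hr : ∀ x, Y.r (f x) = X.r x) (hs : ∀ x, Y.s (f x) = X.s x) :
    BiIso X Y where
  toHomeo := f.toHomeomorphOfDiscrete
  r_map := hr
  s_map := hs
  map_lact h x e := by
    change f _ = _
    rw [X.lact_eq_self hH, Y.lact_eq_self hH]
    rfl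
  map_ract x g e := by
    change f _ = _
    rw [X.ract_eq_self hG, Y.ract_eq_self hG]
    rfl

end BiSpace

namespace GrHom

variable {C : Type u} [SmallCategory C] {H H' : GrHom C}

theorem IsDiscrete.discreteTopology (hH : H.IsDiscrete) {x y : C} (g : x ⟶ y) :
    DiscreteTopology (H.X g).carrier := (H.isCorr g).discreteTopology (hH x)

theorem s_σ {x y z : C} (f : x ⟶ y) (g : y ⟶ z) (a b e) :
    (H.X (f ≫ g)).s ((H.σ f g).toHomeo (compMk a b e)) = (H.X f).s b :=
  (H.σ f g).s_map _

theorem r_σ {x y z : C} (f : x ⟶ y) (g : y ⟶ z) (a b e) :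
    (H.X (f ≫ g)).r ((H.σ f g).toHomeo (compMk a b e)) = (H.X g).r a :=
  (H.σ f g).r_map _

theorem exists_σ {x y z : C} (f : x ⟶ y) (g : y ⟶ z) (c : (H.X (f ≫ g)).carrier) :
    ∃ a b e, (H.σ f g).toHomeo (compMk a b e) = c := by
  obtain ⟨a, b, e, h⟩ := exists_compMk ((H.σ f g).toHomeo.symm c)
  exact ⟨a, b, e, by rw [h, Homeomorph.apply_symm_apply]⟩

theorem IsDiscrete.σ_inj (hH : H.IsDiscrete) {x y z : C} {f : x ⟶ y} {g : y ⟶ z} {a b e a' b' e'}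
    (h : (H.σ f g).toHomeo (compMk a b e) = (H.σ f g).toHomeo (compMk a' b' e')) :
    a = a' ∧ b = b' :=
  compMk_inj (hH y) ((H.σ f g).toHomeo.injective h)

/-- Compatible bijections between the objects and the correspondences of discrete homomorphisms
form an isomorphism. -/
def Iso.ofDiscrete (hH : H.IsDiscrete) (hH' : H'.IsDiscrete)
    (obj : ∀ x, (H.G x).Obj ≃ (H'.G x).Obj)
    (corr : ∀ {x y : C} (g : x ⟶ y), (H.X g).carrier ≃ (H'.X g).carrier)
    (hr : ∀ {x y : C} (g : x ⟶ y) (a), (H'.X g).r (corr g a) = obj y ((H.X g).r a))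
    (hs : ∀ {x y : C} (g : x ⟶ y) (a), (H'.X g).s (corr g a) = obj x ((H.X g).s a))
    (hσ : ∀ {x y z : C} (f : x ⟶ y) (g : y ⟶ z) (a b e e'),
      corr (f ≫ g) ((H.σ f g).toHomeo (compMk a b e)) =
        (H'.σ f g).toHomeo (compMk (corr g a) (corr f b) e'))
    (hι : ∀ x t, corr (𝟙 x) ((H.ι x).toHomeo ((H.G x).unit t)) =
      (H'.ι x).toHomeo ((H'.G x).unit (obj x t))) : H.Iso H' where
  obj x :=
    haveI := (hH x).1
    haveI := (hH' x).1
    (obj x).toHomeomorphOfDiscrete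
  arr x :=
    haveI := (hH x).discreteTopology_arr
    haveI := (hH' x).discreteTopology_arr
    ((hH x).arrEquiv.trans ((obj x).trans (hH' x).arrEquiv.symm)).toHomeomorphOfDiscrete
  arr_r x a := by
    change (H'.G x).r ((H'.G x).unit (obj x ((H.G x).s a))) = obj x ((H.G x).r a)
    rw [(H'.G x).r_unit, (hH x).r_eq_s]
  arr_s x a := by
    change (H'.G x).s ((H'.G x).unit (obj x ((H.G x).s a))) = obj x ((H.G x).s a)
    rw [(H'.G x).s_unit]
  arr_mul x a b e e' := by
    rw [(hH x).mul_eq_left, (hH' x).mul_eq_left]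
  corr g :=
    haveI := hH.discreteTopology g
    haveI := hH'.discreteTopology g
    (corr g).toHomeomorphOfDiscrete
  corr_r := hr
  corr_s := hs
  corr_lact {x y} g h a e e' := by
    rw [(H.X g).lact_eq_self (hH y), (H'.X g).lact_eq_self (hH' y)]
  corr_ract {x y} g a h e e' := by
    rw [(H.X g).ract_eq_self (hH x), (H'.X g).ract_eq_self (hH' x)]
  corr_σ := hσ
  corr_ι x a := by
    conv_lhs => rw [(hH x).eq_unit_s a]
    exact hι x _

theorem Iso.arr_unit (θ : H.Iso H') (hH' : H'.IsDiscrete) (x : C) (t : (H.G x).Obj) :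
    θ.arr x ((H.G x).unit t) = (H'.G x).unit (θ.obj x t) := by
  rw [(hH' x).eq_unit_s (θ.arr x _), θ.arr_s, (H.G x).s_unit]

/-- The inverse of an isomorphism of discrete homomorphisms. -/
def Iso.symmOfDiscrete (hH : H.IsDiscrete) (hH' : H'.IsDiscrete) (θ : H.Iso H') : H'.Iso H :=
  Iso.ofDiscrete hH' hH (fun x => (θ.obj x).symm.toEquiv) (fun g => (θ.corr g).symm.toEquiv)
    (fun g a => by
      obtain ⟨a, rfl⟩ := (θ.corr g).surjective a
      simp [θ.corr_r])
    (fun g a => by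
      obtain ⟨a, rfl⟩ := (θ.corr g).surjective a
      simp [θ.corr_s])
    (fun f g a b e e' => by
      obtain ⟨a, rfl⟩ := (θ.corr g).surjective a
      obtain ⟨b, rfl⟩ := (θ.corr f).surjective b
      have e₀ : (H.X g).s a = (H.X f).r b := by
        rw [θ.corr_s, θ.corr_r] at e
        exact (θ.obj _).injective e
      have := θ.corr_σ f g a b e₀ e
      simp [← this])
    (fun x t => by
      obtain ⟨t, rfl⟩ := (θ.obj x).surjective t
      have := θ.corr_ι x ((H.G x).unit t)
      rw [θ.arr_unit hH'] at this
      simp [← this])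

theorem Iso.isDiscrete (θ : H.Iso H') (hH : H.IsDiscrete) : H'.IsDiscrete := fun x =>
  ⟨haveI := (hH x).1; (θ.obj x).discreteTopology_iff.1 inferInstance, fun a => by
    obtain ⟨a, rfl⟩ := (θ.arr x).surjective a
    obtain ⟨b, hb⟩ := (θ.arr x).surjective ((H'.G x).unit ((H'.G x).s (θ.arr x a)))
    rw [← hb, (hH x).eq_unit_s a, (hH x).eq_unit_s b]
    congr 2
    have := congrArg (H'.G x).s hb
    rw [(H'.G x).s_unit, θ.arr_s, θ.arr_s] at this
    exact ((θ.obj x).injective this).symm⟩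

end GrHom

theorem ConducheFibration.isDiscrete_toGrHom {C : Type u} [SmallCategory C]
    (F : ConducheFibration C) : F.toGrHom.IsDiscrete := fun x =>
  ⟨inferInstanceAs (DiscreteTopology (EtGroupoid.ofSet (F.ObjFib x)).Obj), fun _ => rfl⟩

namespace ConducheFibration

variable {C : Type u} [SmallCategory C] {F F' : ConducheFibration C}

/-! ## Isomorphisms of fibrations -/

theorem heq_map_of_comp_eq_id {D D' : Type u} [SmallCategory D] [SmallCategory D'] {Φ : D ⥤ D'}
    {Ψ : D' ⥤ D} (h : Φ ⋙ Ψ = 𝟭 D) {X Y : D} (α : X ⟶ Y) : HEq (Ψ.map (Φ.map α)) α :=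
  Functor.hcongr_hom h α

theorem map_eqToHom_conj_heq {D D' : Type u} [SmallCategory D] [SmallCategory D'] (Φ : D ⥤ D')
    {W X Y Z : D} (h : W = X) (h' : Y = Z) (φ : X ⟶ Y) :
    HEq (Φ.map (eqToHom h ≫ φ ≫ eqToHom h')) (Φ.map φ) := by
  subst h h'
  simp

/-- The map on fibres of arrows induced by a functor over `C`. -/
def ArrFib.map (Φ : F.E ⥤ F'.E) (h : Φ ⋙ F'.F = F.F) {x y : C} {g : x ⟶ y}
    (α : F.ArrFib g) : F'.ArrFib g where
  src := Φ.obj α.src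
  tgt := Φ.obj α.tgt
  obj_src := (Functor.congr_obj h _).trans α.obj_src
  obj_tgt := (Functor.congr_obj h _).trans α.obj_tgt
  hom := Φ.map α.hom
  map_hom := by
    have := Functor.congr_hom h α.hom
    simp only [Functor.comp_map] at this
    rw [this, α.map_hom]
    simp

/-- An isomorphism of fibrations induces bijections between the fibres of arrows. -/
def ArrFib.mapEquiv (Φ : F.E ⥤ F'.E) (Ψ : F'.E ⥤ F.E) (h₁ : Φ ⋙ Ψ = 𝟭 F.E)
    (h₂ : Ψ ⋙ Φ = 𝟭 F'.E) (h : Φ ⋙ F'.F = F.F) (h' : Ψ ⋙ F.F = F'.F) {x y : C} (g : x ⟶ y) :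
    F.ArrFib g ≃ F'.ArrFib g where
  toFun := ArrFib.map Φ h
  invFun := ArrFib.map Ψ h'
  left_inv α := eq_of_heq (ArrFib.heq_of rfl (Functor.congr_obj h₁ _) (Functor.congr_obj h₁ _)
    (heq_map_of_comp_eq_id h₁ α.hom))
  right_inv α := eq_of_heq (ArrFib.heq_of rfl (Functor.congr_obj h₂ _) (Functor.congr_obj h₂ _)
    (heq_map_of_comp_eq_id h₂ α.hom))

theorem Isomorphic.nonempty_iso (h : F.Isomorphic F') : Nonempty (F.toGrHom.Iso F'.toGrHom) := by
  obtain ⟨Φ, Ψ, h₁, h₂, h⟩ := h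
  have h' : Ψ ⋙ F.F = F'.F := by
    rw [← h, ← Functor.assoc, h₂, Functor.id_comp]
  refine ⟨GrHom.Iso.ofDiscrete F.isDiscrete_toGrHom F'.isDiscrete_toGrHom
    (fun x => (⟨fun X => ⟨Φ.obj X.1, (Functor.congr_obj h _).trans X.2⟩,
      fun X => ⟨Ψ.obj X.1, (Functor.congr_obj h' _).trans X.2⟩,
      fun X => Subtype.ext (Functor.congr_obj h₁ _),
      fun X => Subtype.ext (Functor.congr_obj h₂ _)⟩ : F.ObjFib x ≃ F'.ObjFib x))
    (fun g => ArrFib.mapEquiv Φ Ψ h₁ h₂ h h' g)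
    (fun _ _ => rfl) (fun _ _ => rfl) (fun f g a b e e' => ?_) (fun x t => ?_)⟩
  · refine eq_of_heq (ArrFib.heq_of rfl rfl rfl (heq_of_eq ?_))
    change Φ.map (ArrFib.mul a b e).hom = (ArrFib.mul (ArrFib.map Φ h a) (ArrFib.map Φ h b) e').hom
    simp [ArrFib.mul, ArrFib.map, eqToHom_map]
  · refine eq_of_heq (ArrFib.heq_of rfl rfl rfl (heq_of_eq ?_))
    exact Φ.map_id _

/-- An arrow of `E` as an element of a fibre. -/
def ArrFib.ofHom {Y X : F.E} (α : Y ⟶ X) : F.ArrFib (F.F.map α) :=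
  ⟨Y, X, rfl, rfl, α, by simp⟩

/-- Every element of a fibre comes from an arrow of `E`. -/
theorem ArrFib.ind {motive : ∀ {x y : C} (g : x ⟶ y), F.ArrFib g → Prop}
    (h : ∀ {Y X : F.E} (α : Y ⟶ X), motive (F.F.map α) (ArrFib.ofHom α)) {x y : C} (g : x ⟶ y)
    (α : F.ArrFib g) : motive g α := by
  obtain ⟨X, Y, rfl, rfl, α, hα⟩ := α
  simp only [eqToHom_refl, Category.id_comp, Category.comp_id] at hα
  subst hα
  exact h α

section

variable (θ : F.toGrHom.Iso F'.toGrHom)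

/-- The action of an isomorphism on fibres of objects. -/
noncomputable def isoObj {x : C} (X : F.ObjFib x) : F'.ObjFib x := θ.obj x X

/-- The action of an isomorphism on fibres of arrows. -/
noncomputable def isoArr {x y : C} {g : x ⟶ y} (α : F.ArrFib g) : F'.ArrFib g := θ.corr g α

theorem isoArr_r {x y : C} {g : x ⟶ y} (α : F.ArrFib g) : (isoArr θ α).r = isoObj θ α.r :=
  θ.corr_r g α

theorem isoArr_s {x y : C} {g : x ⟶ y} (α : F.ArrFib g) : (isoArr θ α).s = isoObj θ α.s :=
  θ.corr_s g α

theorem isoArr_mul {x y z : C} {f : x ⟶ y} {g : y ⟶ z} (α : F.ArrFib g) (β : F.ArrFib f)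
    (e : α.s = β.r) : isoArr θ (α.mul β e) = (isoArr θ α).mul (isoArr θ β)
      (by rw [isoArr_s, isoArr_r, e]) :=
  θ.corr_σ f g α β e
    ((θ.corr_s g α).trans ((congrArg (θ.obj y) e).trans (θ.corr_r f β).symm))

theorem isoArr_one {x : C} (X : F.ObjFib x) :
    isoArr θ (ArrFib.one X) = ArrFib.one (isoObj θ X) := by
  have h := θ.corr_ι x X
  have h' : θ.arr x X = θ.obj x X := θ.arr_unit F'.isDiscrete_toGrHom x X
  rw [h'] at h
  exact h

theorem isoArr_ofHom_tgt {Y X : F.E} (α : Y ⟶ X) :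
    (isoArr θ (ArrFib.ofHom α)).tgt = (isoObj θ (⟨X, rfl⟩ : F.ObjFib _)).1 :=
  congrArg Subtype.val (isoArr_r θ (ArrFib.ofHom α))

theorem isoArr_ofHom_src {Y X : F.E} (α : Y ⟶ X) :
    (isoArr θ (ArrFib.ofHom α)).src = (isoObj θ (⟨Y, rfl⟩ : F.ObjFib _)).1 :=
  congrArg Subtype.val (isoArr_s θ (ArrFib.ofHom α))

theorem heq_hom_of_heq {x y : C} {g g' : x ⟶ y} (hg : g = g') {α : F.ArrFib g} {β : F.ArrFib g'}
    (h : HEq α β) : HEq α.hom β.hom := by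
  subst hg
  obtain rfl := eq_of_heq h
  rfl

theorem heq_isoArr {x y : C} {g g' : x ⟶ y} (hg : g = g') {α : F.ArrFib g} {β : F.ArrFib g'}
    (h : HEq α β) : HEq (isoArr θ α) (isoArr θ β) := by
  subst hg
  obtain rfl := eq_of_heq h
  rfl

theorem ofHom_comp_heq {X Y Z : F.E} (β : Z ⟶ Y) (α : Y ⟶ X) :
    HEq (ArrFib.ofHom (β ≫ α)) (ArrFib.mul (ArrFib.ofHom α) (ArrFib.ofHom β) rfl) :=
  ArrFib.heq_of (F.F.map_comp β α) rfl rfl (by simp [ArrFib.mul, ArrFib.ofHom])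

theorem ofHom_id_heq (X : F.E) :
    HEq (ArrFib.ofHom (𝟙 X)) (ArrFib.one (⟨X, rfl⟩ : F.ObjFib (F.F.obj X))) :=
  ArrFib.heq_of (F.F.map_id X) rfl rfl HEq.rfl

/-- The functor between total categories defined by an isomorphism of associated
homomorphisms. -/
noncomputable def isoFunctor : F.E ⥤ F'.E where
  obj X := (isoObj θ (⟨X, rfl⟩ : F.ObjFib _)).1
  map α := eqToHom (isoArr_ofHom_src θ α).symm ≫ (isoArr θ (ArrFib.ofHom α)).hom ≫
    eqToHom (isoArr_ofHom_tgt θ α)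
  map_id X := by
    refine eq_of_heq ?_
    simp only [eqToHom_comp_heq_iff, comp_eqToHom_heq_iff]
    have h := heq_hom_of_heq (F.F.map_id X) (heq_isoArr θ (F.F.map_id X) (ofHom_id_heq X))
    rw [isoArr_one] at h
    exact h
  map_comp {Z Y X} β α := by
    refine eq_of_heq ?_
    simp only [eqToHom_comp_heq_iff, comp_eqToHom_heq_iff]
    refine (heq_hom_of_heq (F.F.map_comp β α)
      (heq_isoArr θ (F.F.map_comp β α) (ofHom_comp_heq β α))).trans ?_
    refine (heq_hom_of_heq rfl (heq_of_eq
      (isoArr_mul θ (ArrFib.ofHom α) (ArrFib.ofHom β) rfl))).trans ?_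
    simp only [ArrFib.mul, Category.assoc, heq_eqToHom_comp_iff, eqToHom_trans_assoc]
    simp only [← Category.assoc, heq_comp_eqToHom_iff]
    rfl

theorem isoFunctor_map_heq {x y : C} (g : x ⟶ y) (α : F.ArrFib g) :
    HEq ((isoFunctor θ).map α.hom) (isoArr θ α).hom := by
  refine ArrFib.ind (motive := fun g α => HEq ((isoFunctor θ).map α.hom) (isoArr θ α).hom)
    (fun α => ?_) g α
  simp only [isoFunctor, eqToHom_comp_heq_iff, comp_eqToHom_heq_iff]
  rfl

theorem isoFunctor_obj {x : C} (X : F.ObjFib x) : (isoFunctor θ).obj X.1 = (isoObj θ X).1 := by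
  obtain ⟨X, rfl⟩ := X
  rfl

theorem isoFunctor_comp : isoFunctor θ ⋙ F'.F = F.F := by
  refine CategoryTheory.Functor.ext (fun X => (isoObj θ (⟨X, rfl⟩ : F.ObjFib (F.F.obj X))).2) fun Y X α => ?_
  simp only [Functor.comp_map, isoFunctor, Functor.map_comp, eqToHom_map,
    (isoArr θ (ArrFib.ofHom α)).map_hom]
  simp

theorem isoFunctor_comp_isoFunctor (θ' : F'.toGrHom.Iso F.toGrHom)
    (h₁ : ∀ {x : C} (X : F.ObjFib x), isoObj θ' (isoObj θ X) = X)
    (h₂ : ∀ {x y : C} (g : x ⟶ y) (α : F.ArrFib g), isoArr θ' (isoArr θ α) = α) :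
    isoFunctor θ ⋙ isoFunctor θ' = 𝟭 F.E := by
  refine Functor.hext (fun X => ?_) fun Y X α => ?_
  · change (isoFunctor θ').obj (isoObj θ (⟨X, rfl⟩ : F.ObjFib _)).1 = X
    rw [isoFunctor_obj, h₁]
  · have h := isoFunctor_map_heq θ' _ (isoArr θ (ArrFib.ofHom α))
    rw [h₂] at h
    refine HEq.trans ?_ h
    exact map_eqToHom_conj_heq (isoFunctor θ') (isoArr_ofHom_src θ α).symm (isoArr_ofHom_tgt θ α) _

end

theorem isomorphic_iff : F.Isomorphic F' ↔ Nonempty (F.toGrHom.Iso F'.toGrHom) := by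
  refine ⟨Isomorphic.nonempty_iso, fun ⟨θ⟩ => ?_⟩
  let θ' := GrHom.Iso.symmOfDiscrete F.isDiscrete_toGrHom F'.isDiscrete_toGrHom θ
  exact ⟨isoFunctor θ, isoFunctor θ',
    isoFunctor_comp_isoFunctor θ θ' (fun X => (θ.obj _).symm_apply_apply X)
      (fun g α => (θ.corr g).symm_apply_apply α),
    isoFunctor_comp_isoFunctor θ' θ (fun X => (θ.obj _).apply_symm_apply X)
      (fun g α => (θ.corr g).apply_symm_apply α), isoFunctor_comp θ⟩

end ConducheFibration

namespace GrHom

variable {C : Type u} [SmallCategory C]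

/-! ## The fibration of a discrete homomorphism -/

/-- The objects of the fibration of a discrete homomorphism. -/
structure Total (H : GrHom C) : Type u where
  base : C
  pt : (H.G base).Obj

namespace Total

variable {H : GrHom C}

/-- The arrows of the fibration of a discrete homomorphism. -/
@[ext]
structure Hom (a b : H.Total) : Type u where
  base : a.base ⟶ b.base
  pt : (H.X base).carrier
  s_pt : (H.X base).s pt = a.pt
  r_pt : (H.X base).r pt = b.pt

/-- The category whose arrows are the elements of the correspondences of a discrete
homomorphism. -/
@[reducible]
def category (hH : H.IsDiscrete) : SmallCategory H.Total where
  Hom := Hom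
  id a := ⟨𝟙 _, (H.ι _).toHomeo ((H.G _).unit a.pt),
    ((H.ι _).s_map _).trans ((H.G _).s_unit _), ((H.ι _).r_map _).trans ((H.G _).r_unit _)⟩
  comp φ ψ := ⟨φ.base ≫ ψ.base,
    (H.σ φ.base ψ.base).toHomeo (compMk ψ.pt φ.pt (ψ.s_pt.trans φ.r_pt.symm)),
    (s_σ _ _ _ _ _).trans φ.s_pt, (r_σ _ _ _ _ _).trans ψ.r_pt⟩
  id_comp {a b} φ := by
    refine Hom.ext (Category.id_comp _) ?_
    refine (H.unit_right φ.base φ.pt ((H.G _).unit a.pt) ?_ _).trans ?_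
    · rw [(H.G _).r_unit, φ.s_pt]
    · rw [(H.X _).ract_eq_self (hH _)]
  comp_id {a b} φ := by
    refine Hom.ext (Category.comp_id _) ?_
    refine (H.unit_left φ.base ((H.G _).unit b.pt) φ.pt ?_ _).trans ?_
    · rw [(H.G _).s_unit, φ.r_pt]
    · rw [(H.X _).lact_eq_self (hH _)]
  assoc φ ψ χ := Hom.ext (Category.assoc _ _ _)
    (H.assoc φ.base ψ.base χ.base χ.pt ψ.pt φ.pt _ _ _ _)

theorem heq_of_heq_mk {a b : H.Total} {φ ψ : Hom a b} (h : φ = ψ) : HEq φ.pt ψ.pt := by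
  rw [h]

theorem mk_heq_mk {x y : C} {g : x ⟶ y} {p q : (H.X g).carrier} (h : p = q)
    {v v' : (H.G x).Obj} {w w' : (H.G y).Obj} (hv : v = v') (hw : w = w')
    (h₁ : (H.X g).s p = v) (h₂ : (H.X g).r p = w) (h₃ : (H.X g).s q = v')
    (h₄ : (H.X g).r q = w') : HEq (⟨g, p, h₁, h₂⟩ : Total.Hom ⟨x, v⟩ ⟨y, w⟩)
      (⟨g, q, h₃, h₄⟩ : Total.Hom ⟨x, v'⟩ ⟨y, w'⟩) := by
  subst h hv hw
  rfl

theorem comp_eqToHom_comp (hH : H.IsDiscrete) {a c : H.Total} {y : C} {t t' : (H.G y).Obj}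
    (ht : t = t') (φ : Hom a ⟨y, t⟩) (ψ : Hom ⟨y, t'⟩ c) (h : (⟨y, t⟩ : H.Total) = ⟨y, t'⟩)
    (e : (H.X ψ.base).s ψ.pt = (H.X φ.base).r φ.pt) :
    letI := category hH
    (CategoryStruct.comp (obj := H.Total) φ (CategoryStruct.comp (eqToHom h) ψ) : a ⟶ c) =
      (⟨φ.base ≫ ψ.base, (H.σ φ.base ψ.base).toHomeo (compMk ψ.pt φ.pt e),
        (s_σ _ _ _ _ _).trans φ.s_pt, (r_σ _ _ _ _ _).trans ψ.r_pt⟩ : Hom a c) := by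
  subst ht
  let := category hH
  have h₀ : CategoryStruct.comp (eqToHom h) ψ = ψ := Category.id_comp (obj := H.Total) ψ
  rw [h₀]
  rfl

end Total

/-- The projection of the total category of a discrete homomorphism. -/
def proj {H : GrHom C} (hH : H.IsDiscrete) :
    letI := Total.category hH
    H.Total ⥤ C :=
  letI := Total.category hH
  { obj := Total.base
    map := Total.Hom.base
    map_id _ := rfl
    map_comp _ _ := rfl }

theorem isConduche_proj {H : GrHom C} (hH : H.IsDiscrete) :
    letI := Total.category hH
    IsConduche (proj hH) := by
  let := Total.category hH
  rintro ⟨y, v⟩ ⟨x, w⟩ ⟨g, p, hs, hr⟩ z l ρ h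
  change y ⟶ z at l
  change z ⟶ x at ρ
  change l ≫ ρ = g at h
  subst h
  dsimp only at p hs hr
  obtain ⟨a, b, e, rfl⟩ := H.exists_σ l ρ p
  have hs' : (H.X l).s b = v := (s_σ _ _ _ _ _).symm.trans hs
  have hr' : (H.X ρ).r a = w := (r_σ _ _ _ _ _).symm.trans hr
  refine ⟨⟨⟨z, (H.X ρ).s a⟩, ⟨l, b, hs', e.symm⟩, ⟨ρ, a, rfl, hr'⟩⟩,
    ⟨rfl, rfl, Category.comp_id _, Category.id_comp _⟩, ?_⟩
  rintro ⟨⟨z', t⟩, ⟨l', b', hb', hb''⟩, ⟨ρ', a', ha', ha''⟩⟩ ⟨h₁, h₂, h₃, h₄⟩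
  change z' = z at h₂
  subst h₂
  dsimp only at l' ρ' b' a' hb' hb'' ha' ha''
  have h₃ : l' ≫ 𝟙 z' = l := h₃
  have h₄ : 𝟙 z' ≫ ρ' = ρ := h₄
  rw [Category.comp_id] at h₃
  rw [Category.id_comp] at h₄
  subst h₃ h₄
  have h₅ : (H.σ l' ρ').toHomeo (compMk a' b' (ha'.trans hb''.symm)) =
      (H.σ l' ρ').toHomeo (compMk a b e) :=
    eq_of_heq (Total.heq_of_heq_mk (φ := (⟨l' ≫ ρ', (H.σ l' ρ').toHomeo (compMk a' b' _),
      (s_σ _ _ _ _ _).trans hb', (r_σ _ _ _ _ _).trans ha''⟩ : Total.Hom ⟨y, v⟩ ⟨x, w⟩)) h₁)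
  obtain ⟨rfl, rfl⟩ := hH.σ_inj h₅
  obtain rfl : t = (H.X ρ').s a' := ha'.symm
  rfl

/-- The discrete Conduché fibration of a discrete homomorphism. -/
def fibration {H : GrHom C} (hH : H.IsDiscrete) : ConducheFibration C :=
  letI := Total.category hH
  { E := H.Total
    F := proj hH
    isConduche := isConduche_proj hH }

section

variable {H : GrHom C} (hH : H.IsDiscrete)

/-- The objects over `x` of the fibration of `H` are the points of the discrete set `H.G x`. -/
def fibrationObj (x : C) : (H.G x).Obj ≃ (fibration hH).ObjFib x where
  toFun t := ⟨(⟨x, t⟩ : H.Total), rfl⟩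
  invFun := fun ⟨⟨_, t⟩, rfl⟩ => t
  left_inv _ := rfl
  right_inv := by rintro ⟨⟨_, t⟩, rfl⟩; rfl

/-- An element of `H.X g` as an arrow over `g` of the fibration of `H`. -/
def fibrationArr {x y : C} (g : x ⟶ y) (p : (H.X g).carrier) : (fibration hH).ArrFib g where
  src := (⟨x, (H.X g).s p⟩ : H.Total)
  tgt := (⟨y, (H.X g).r p⟩ : H.Total)
  obj_src := rfl
  obj_tgt := rfl
  hom := (⟨g, p, rfl, rfl⟩ : Total.Hom _ _)
  map_hom := by
    change g = 𝟙 x ≫ g ≫ 𝟙 y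
    simp

theorem fibrationArr_bijective {x y : C} (g : x ⟶ y) :
    Function.Bijective (fibrationArr hH g) := by
  constructor
  · intro p q h
    have hs : (H.X g).s p = (H.X g).s q := by
      have := congrArg ConducheFibration.ArrFib.src h
      change (⟨x, _⟩ : H.Total) = ⟨x, _⟩ at this
      simpa using this
    have hr : (H.X g).r p = (H.X g).r q := by
      have := congrArg ConducheFibration.ArrFib.tgt h
      change (⟨y, _⟩ : H.Total) = ⟨y, _⟩ at this
      simpa using this
    have hh : HEq (fibrationArr hH g p).hom (fibrationArr hH g q).hom := by rw [h]
    have key : ∀ (v v' : (H.G x).Obj) (w w' : (H.G y).Obj) (_ : v = v') (_ : w = w')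
        (h₁ : (H.X g).s p = v) (h₂ : (H.X g).r p = w) (h₃ : (H.X g).s q = v')
        (h₄ : (H.X g).r q = w'), HEq (⟨g, p, h₁, h₂⟩ : Total.Hom ⟨x, v⟩ ⟨y, w⟩)
          (⟨g, q, h₃, h₄⟩ : Total.Hom ⟨x, v'⟩ ⟨y, w'⟩) → p = q := by
      rintro v _ w _ rfl rfl h₁ h₂ h₃ h₄ h
      exact eq_of_heq (Total.heq_of_heq_mk (eq_of_heq h))
    exact key _ _ _ _ hs hr _ _ _ _ hh
  · rintro ⟨⟨x', v⟩, ⟨y', w⟩, h₁, h₂, ⟨g', p, h₃, h₄⟩, h⟩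
    change x' = x at h₁
    change y' = y at h₂
    subst h₁ h₂
    dsimp only at g' p h₃ h₄
    change g' = 𝟙 x' ≫ g ≫ 𝟙 y' at h
    rw [Category.id_comp, Category.comp_id] at h
    subst h h₃ h₄
    exact ⟨p, rfl⟩

theorem exists_fibration (hH : H.IsDiscrete) : ∃ F : ConducheFibration C, Nonempty (F.toGrHom.Iso H) := by
  refine ⟨fibration hH, ⟨Iso.symmOfDiscrete hH (fibration hH).isDiscrete_toGrHom
    (Iso.ofDiscrete hH (fibration hH).isDiscrete_toGrHom (fibrationObj hH)
      (fun g => Equiv.ofBijective (fibrationArr hH g) (fibrationArr_bijective hH g))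
      (fun _ _ => rfl) (fun _ _ => rfl) (fun {x y z} f g a b e e' => ?_) fun x t => ?_)⟩⟩
  · refine eq_of_heq (ConducheFibration.ArrFib.heq_of rfl
      (congrArg (Total.mk x) (s_σ _ _ _ _ _)) (congrArg (Total.mk z) (r_σ _ _ _ _ _)) ?_)
    have h := Total.comp_eqToHom_comp hH e.symm
      (⟨f, b, rfl, rfl⟩ : Total.Hom ⟨x, (H.X f).s b⟩ ⟨y, (H.X f).r b⟩)
      (⟨g, a, rfl, rfl⟩ : Total.Hom ⟨y, (H.X g).s a⟩ ⟨z, (H.X g).r a⟩)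
      (congrArg (Total.mk y) e.symm) e
    refine HEq.trans ?_ (heq_of_eq h.symm)
    exact Total.mk_heq_mk rfl (s_σ _ _ _ _ _) (r_σ _ _ _ _ _) _ _ _ _
  · have hs := ((H.ι x).s_map ((H.G x).unit t)).trans ((H.G x).s_unit t)
    have hr := ((H.ι x).r_map ((H.G x).unit t)).trans ((H.G x).r_unit t)
    exact eq_of_heq (ConducheFibration.ArrFib.heq_of rfl (congrArg (Total.mk x) hs)
      (congrArg (Total.mk x) hr) (Total.mk_heq_mk rfl hs hr _ _ _ _))

end

end GrHom

/-! ## Equivalences of discrete homomorphisms -/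

namespace BiSpace

variable {H G K : EtGroupoid.{u}}

theorem compMk_congr {X : BiSpace H G} {Y : BiSpace G K} {x x' : X.carrier} {y y' : Y.carrier}
    (hx : x = x') (hy : y = y') (e : X.s x = Y.r y) (e' : X.s x' = Y.r y') :
    compMk x y e = compMk x' y' e' := by
  subst hx hy
  rfl

/-- A set with maps to two discrete sets as a correspondence between the corresponding
groupoids. -/
def span (hH : H.IsDiscreteSet) (hG : G.IsDiscreteSet) {X : Type u} (r : X → H.Obj)
    (s : X → G.Obj) : BiSpace H G where
  carrier := X
  top := ⊥
  r := r
  s := s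
  lact _ x _ := x
  ract x _ _ := x
  r_lact h _ e := e.symm.trans (hH.r_eq_s h).symm
  s_lact _ _ _ := rfl
  r_ract _ _ _ := rfl
  s_ract _ g e := e.trans (hG.r_eq_s g)
  unit_lact _ := rfl
  ract_unit _ := rfl
  mul_lact _ _ _ _ _ := rfl
  ract_mul _ _ _ _ _ := rfl
  lact_ract _ _ _ _ _ := rfl

theorem discreteTopology_span (hH : H.IsDiscreteSet) (hG : G.IsDiscreteSet) {X : Type u}
    (r : X → H.Obj) (s : X → G.Obj) : DiscreteTopology (span hH hG r s).carrier := ⟨rfl⟩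

theorem isCorr_span (hH : H.IsDiscreteSet) (hG : G.IsDiscreteSet) {X : Type u} (r : X → H.Obj)
    (s : X → G.Obj) : (span hH hG r s).IsCorr := by
  have := discreteTopology_span hH hG r s
  have := hH.1
  have := hG.1
  have := hH.discreteTopology_arr
  have := hG.discreteTopology_arr
  have : DiscreteTopology ((span hH hG r s).carrier × (span hH hG r s).carrier) := inferInstance
  refine ⟨continuous_of_discreteTopology, isLocalHomeomorph_of_discrete _,
    continuous_of_discreteTopology, continuous_of_discreteTopology, fun x g e _ => ?_, ?_⟩
  · exact (hG.eq_unit_r g).trans (congrArg G.unit e.symm)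
  · refine (Topology.IsClosedEmbedding.of_continuous_injective_isClosedMap
      continuous_of_discreteTopology ?_ fun s _ => isClosed_discrete _).isProperMap
    rintro ⟨⟨x, g⟩, h⟩ ⟨⟨x', g'⟩, h'⟩ hx
    obtain rfl : x = x' := congrArg Prod.snd hx
    obtain rfl : g = g' := by
      rw [hG.eq_unit_r g, hG.eq_unit_r g']
      exact congrArg G.unit (h.symm.trans h')
    rfl

theorem discreteTopology_idCorr (hG : G.IsDiscreteSet) : DiscreteTopology (idCorr G).carrier :=
  hG.discreteTopology_arr

theorem isEquivalence_span (hH : H.IsDiscreteSet) (hG : G.IsDiscreteSet) (f : G.Obj ≃ H.Obj) :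
    (span hH hG f id).IsEquivalence := by
  have h₁ := discreteTopology_span hH hG f id
  have h₂ := discreteTopology_span hG hH id f
  refine ⟨span hG hH id f, isCorr_span hG hH _ _,
    ⟨BiIso.ofDiscrete hH hH (discreteTopology_comp h₁ h₂) (discreteTopology_idCorr hH)
      ((compEquiv hG _ _).trans ⟨fun p => H.unit (f p.1.1),
        fun a => ⟨(f.symm (H.s a), f.symm (H.s a)), rfl⟩, ?_, ?_⟩) ?_ ?_⟩,
    ⟨BiIso.ofDiscrete hG hG (discreteTopology_comp h₂ h₁) (discreteTopology_idCorr hG)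
      ((compEquiv hH _ _).trans ⟨fun p => G.unit p.1.1,
        fun a => ⟨(G.s a, G.s a), rfl⟩, ?_, ?_⟩) ?_ ?_⟩⟩
  · rintro ⟨⟨w, v⟩, e⟩
    obtain rfl : w = v := e
    have h : f.symm (H.s (H.unit (f w))) = w := by
      rw [H.s_unit]
      exact f.symm_apply_apply w
    exact Subtype.ext (Prod.ext h h)
  · intro a
    exact (congrArg H.unit (f.apply_symm_apply (H.s a))).trans (hH.eq_unit_s a).symm
  · rintro ⟨⟨⟨w, v⟩, e⟩⟩
    exact H.r_unit _
  · rintro ⟨⟨⟨w, v⟩, e⟩⟩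
    obtain rfl : w = v := e
    exact H.s_unit _
  · rintro ⟨⟨w, v⟩, e⟩
    obtain rfl : w = v := f.injective e
    exact Subtype.ext (Prod.ext (G.s_unit w) (G.s_unit w))
  · intro a
    exact (hG.eq_unit_s a).symm
  · rintro ⟨⟨⟨w, v⟩, e⟩⟩
    exact G.r_unit _
  · rintro ⟨⟨⟨w, v⟩, e⟩⟩
    obtain rfl : w = v := f.injective e
    exact G.s_unit _

section

variable {W : BiSpace H G} {V : BiSpace G H}

theorem BiIso.r_eq_s_of_comp (hH : H.IsDiscreteSet) (i : BiIso (comp W V) (idCorr H))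
    {w : W.carrier} {v : V.carrier} (e : W.s w = V.r v) : W.r w = V.s v :=
  (i.r_map (compMk w v e)).symm.trans ((hH.r_eq_s _).trans (i.s_map (compMk w v e)))

theorem BiIso.eq_of_r_eq (hH : H.IsDiscreteSet) (hG : G.IsDiscreteSet)
    (i : BiIso (comp W V) (idCorr H)) {w w' : W.carrier} {v v' : V.carrier} (e : W.s w = V.r v)
    (e' : W.s w' = V.r v') (h : W.r w = W.r w') : w = w' ∧ v = v' := by
  refine compMk_inj hG (i.toHomeo.injective (a₁ := compMk w v e) (a₂ := compMk w' v' e') ?_)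
  refine (hH.eq_unit_r _).trans (Eq.trans ?_ (hH.eq_unit_r _).symm)
  exact congrArg H.unit ((i.r_map (compMk w v e)).trans
    (h.trans (i.r_map (compMk w' v' e')).symm))

theorem BiIso.exists_r_eq (i : BiIso (comp W V) (idCorr H)) (t : H.Obj) :
    ∃ w v, W.s w = V.r v ∧ W.r w = t := by
  obtain ⟨z, hz⟩ := i.toHomeo.surjective (H.unit t)
  obtain ⟨w, v, e, rfl⟩ := exists_compMk z
  refine ⟨w, v, e, ?_⟩
  have h := i.r_map (compMk w v e)
  rw [hz] at h
  exact h.symm.trans (H.r_unit t)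

theorem IsEquivalence.bijective (hH : H.IsDiscreteSet) (hG : G.IsDiscreteSet)
    (h : W.IsEquivalence) : Function.Bijective W.s ∧ Function.Bijective W.r := by
  obtain ⟨V, -, ⟨i⟩, ⟨j⟩⟩ := h
  have hs : Function.Injective W.s := fun w₁ w₂ h => by
    obtain ⟨v, w, e, hv⟩ := j.exists_r_eq (W.s w₁)
    have h₁ := BiIso.r_eq_s_of_comp hH i hv.symm
    have h₂ := BiIso.r_eq_s_of_comp hH i (h.symm.trans hv.symm)
    exact (BiIso.eq_of_r_eq hG hH j h₁.symm h₂.symm rfl).2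
  refine ⟨⟨hs, fun t => ?_⟩, ⟨fun w₁ w₂ h => hs ?_, fun t => ?_⟩⟩
  · obtain ⟨v, w, e, hv⟩ := j.exists_r_eq t
    exact ⟨w, (BiIso.r_eq_s_of_comp hG j e).symm.trans hv⟩
  · obtain ⟨w, v, e, hw⟩ := i.exists_r_eq (W.r w₁)
    have hv := BiIso.r_eq_s_of_comp hH i e
    have h₁ := BiIso.r_eq_s_of_comp hG j (hv.symm.trans hw)
    have h₂ := BiIso.r_eq_s_of_comp hG j (hv.symm.trans (hw.trans h))
    exact h₁.symm.trans h₂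
  · obtain ⟨w, v, -, hw⟩ := i.exists_r_eq t
    exact ⟨w, hw⟩

end

end BiSpace

namespace GrHom

variable {C : Type u} [SmallCategory C] {H H' : GrHom C}

section

variable (hH : H.IsDiscrete) (hH' : H'.IsDiscrete) (θ : H.Iso H')

/-- The graph of an isomorphism as a correspondence. -/
abbrev Iso.graph (x : C) : BiSpace (H'.G x) (H.G x) :=
  BiSpace.span (hH' x) (hH x) (θ.obj x) id

/-- The naturality 2-arrow for the graph of an isomorphism. -/
def Iso.graphEquiv {x y : C} (g : x ⟶ y) :
    (comp (θ.graph hH hH' y) (H.X g)).carrier ≃ (comp (H'.X g) (θ.graph hH hH' x)).carrier :=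
  (compEquiv (hH y) _ _).trans (Equiv.trans
    { toFun p := ⟨(θ.corr g p.1.2, (H.X g).s p.1.2), θ.corr_s g _⟩
      invFun p := ⟨((H.X g).r ((θ.corr g).symm p.1.1), (θ.corr g).symm p.1.1), rfl⟩
      left_inv := by
        rintro ⟨⟨w, a⟩, e⟩
        obtain rfl : w = (H.X g).r a := e
        simp
      right_inv := by
        rintro ⟨⟨a, w⟩, e⟩
        obtain ⟨a, rfl⟩ := (θ.corr g).surjective a
        obtain rfl : (H.X g).s a = w := (θ.obj x).injective ((θ.corr_s g a).symm.trans e)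
        simp }
    (compEquiv (hH' x) _ _).symm)

theorem Iso.graphEquiv_compMk {x y : C} (g : x ⟶ y) (w a e) :
    θ.graphEquiv hH hH' g (compMk w a e) = compMk (θ.corr g a) ((H.X g).s a) (θ.corr_s g a) := rfl

/-- An isomorphism of discrete homomorphisms gives an equivalence. -/
def Iso.equivalence : H.Equivalence H' where
  W := θ.graph hH hH'
  isCorr x := isCorr_span _ _ _ _
  isEquivalence x := isEquivalence_span (hH' x) (hH x) (θ.obj x).toEquiv
  nat {x y} g := BiIso.ofDiscrete (hH' y) (hH x)
    (discreteTopology_comp (discreteTopology_span _ _ _ _) (hH.discreteTopology g))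
    (discreteTopology_comp (hH'.discreteTopology g) (discreteTopology_span _ _ _ _))
    (θ.graphEquiv hH hH' g)
    (by
      intro z
      obtain ⟨w, a, e, rfl⟩ := exists_compMk z
      have e : w = (H.X g).r a := e
      exact (θ.corr_r g a).trans (congrArg (θ.obj y) e.symm))
    (by
      intro z
      obtain ⟨w, a, e, rfl⟩ := exists_compMk z
      rfl)
  nat_comp {x y z} f g w a b a' w' b' w'' e₁ e₂ e₃ e₄ e₅ e₆ e₇ e₈ h₁ h₂ := by
    obtain ⟨rfl, rfl⟩ := compMk_inj (hH' y) ((θ.graphEquiv_compMk hH hH' g w a e₁).symm.trans h₁)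
    obtain ⟨rfl, rfl⟩ := compMk_inj (hH' x) ((θ.graphEquiv_compMk hH hH' f _ b e₃).symm.trans h₂)
    exact compMk_congr (θ.corr_σ f g a b e₅ e₇) (s_σ f g a b e₅) _ _
  nat_id x w a e e₁ e₂ := by
    have e : w = (H.G x).r a := e
    refine (θ.graphEquiv_compMk hH hH' (𝟙 x) w _ e₁).trans (compMk_congr ?_ ?_ _ _)
    · refine (θ.corr_ι x a).trans (congrArg (H'.ι x).toHomeo ?_)
      conv_lhs => rw [(hH x).eq_unit_r a, θ.arr_unit hH', ← e]
      rfl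
    · exact ((H.ι x).s_map a).trans (((hH x).r_eq_s a).symm.trans e.symm)

end

namespace Equivalence

variable (T : H.Equivalence H') (hH : H.IsDiscrete) (hH' : H'.IsDiscrete)

/-- The bijection on objects of an equivalence of discrete homomorphisms. -/
noncomputable def objEquiv (x : C) : (H.G x).Obj ≃ (H'.G x).Obj :=
  (Equiv.ofBijective _ ((T.isEquivalence x).bijective (hH' x) (hH x)).1).symm.trans
    (Equiv.ofBijective _ ((T.isEquivalence x).bijective (hH' x) (hH x)).2)

theorem objEquiv_s (x : C) (w : (T.W x).carrier) :
    T.objEquiv hH hH' x ((T.W x).s w) = (T.W x).r w := by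
  have h : (Equiv.ofBijective _ ((T.isEquivalence x).bijective (hH' x) (hH x)).1).symm
      ((T.W x).s w) = w := Equiv.ofBijective_symm_apply_apply _ _ _
  exact congrArg (T.W x).r h

theorem exists_nat (hH : H.IsDiscrete) (hH' : H'.IsDiscrete) {x y : C} (g : x ⟶ y) (a : (H.X g).carrier) :
    ∃ a' w w' e e', (T.nat g).toHomeo (compMk w a e) = compMk a' w' e' := by
  obtain ⟨w, hw⟩ := ((T.isEquivalence y).bijective (hH' y) (hH y)).1.2 ((H.X g).r a)
  obtain ⟨a', w', e', h⟩ := exists_compMk ((T.nat g).toHomeo (compMk w a hw))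
  exact ⟨a', w, w', hw, e', h.symm⟩

theorem nat_r {x y : C} {g : x ⟶ y} {w a e a' w' e'}
    (h : (T.nat g).toHomeo (compMk w a e) = compMk a' w' e') :
    (H'.X g).r a' = (T.W y).r w := by
  have := (T.nat g).r_map (compMk w a e)
  rwa [h] at this

theorem nat_s {x y : C} {g : x ⟶ y} {w a e a' w' e'}
    (h : (T.nat g).toHomeo (compMk w a e) = compMk a' w' e') :
    (T.W x).s w' = (H.X g).s a := by
  have := (T.nat g).s_map (compMk w a e)
  rwa [h] at this

/-- The map on correspondences of an equivalence of discrete homomorphisms. -/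
noncomputable def corrMap {x y : C} (g : x ⟶ y) (a : (H.X g).carrier) : (H'.X g).carrier :=
  (T.exists_nat hH hH' g a).choose

theorem corrMap_eq {x y : C} {g : x ⟶ y} {w a e a' w' e'}
    (h : (T.nat g).toHomeo (compMk w a e) = compMk a' w' e') : T.corrMap hH hH' g a = a' := by
  obtain ⟨w₁, w₁', e₁, e₁', h₁⟩ := (T.exists_nat hH hH' g a).choose_spec
  obtain rfl : w = w₁ :=
    ((T.isEquivalence y).bijective (hH' y) (hH y)).1.1 (e.trans e₁.symm)
  exact (compMk_inj (hH' x) (h₁.symm.trans h)).1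

theorem corrMap_bijective {x y : C} (g : x ⟶ y) :
    Function.Bijective (T.corrMap hH hH' g) := by
  have hy := ((T.isEquivalence y).bijective (hH' y) (hH y))
  have hx := ((T.isEquivalence x).bijective (hH' x) (hH x))
  constructor
  · intro a b h
    obtain ⟨a', w₁, w₁', e₁, e₁', h₁⟩ := T.exists_nat hH hH' g a
    obtain ⟨b', w₂, w₂', e₂, e₂', h₂⟩ := T.exists_nat hH hH' g b
    obtain rfl : a' = b' := by
      rw [← T.corrMap_eq hH hH' h₁, h, T.corrMap_eq hH hH' h₂]
    obtain rfl : w₁' = w₂' := hx.2.1 (e₁'.symm.trans e₂')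
    exact (compMk_inj (hH y) ((T.nat g).toHomeo.injective (h₁.trans h₂.symm))).2
  · intro a'
    obtain ⟨w', hw'⟩ := hx.2.2 ((H'.X g).s a')
    obtain ⟨z, hz⟩ := (T.nat g).toHomeo.surjective (compMk a' w' hw'.symm)
    obtain ⟨w, a, e, rfl⟩ := exists_compMk z
    exact ⟨a, T.corrMap_eq hH hH' hz⟩

/-- An equivalence of discrete homomorphisms gives an isomorphism. -/
noncomputable def iso : H.Iso H' :=
  Iso.ofDiscrete hH hH' (T.objEquiv hH hH')
    (fun g => Equiv.ofBijective _ (T.corrMap_bijective hH hH' g))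
    (fun {x y} g a => by
      obtain ⟨a', w, w', e, e', h⟩ := T.exists_nat hH hH' g a
      have e₀ : (T.W y).s w = (H.X g).r a := e
      change (H'.X g).r (T.corrMap hH hH' g a) = _
      rw [T.corrMap_eq hH hH' h, T.nat_r h, ← e₀, objEquiv_s])
    (fun {x y} g a => by
      obtain ⟨a', w, w', e, e', h⟩ := T.exists_nat hH hH' g a
      have e₀ : (H'.X g).s a' = (T.W x).r w' := e'
      change (H'.X g).s (T.corrMap hH hH' g a) = _
      rw [T.corrMap_eq hH hH' h, ← T.nat_s h, objEquiv_s, e₀])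
    (fun {x y z} f g a b e e' => by
      obtain ⟨a', w, w', e₁, e₁', h₁⟩ := T.exists_nat hH hH' g a
      obtain ⟨b', v, w'', e₂, e₂', h₂⟩ := T.exists_nat hH hH' f b
      obtain rfl : v = w' := ((T.isEquivalence y).bijective (hH' y) (hH y)).1.1
        (e₂.trans (e.symm.trans (T.nat_s h₁).symm))
      have ha := T.corrMap_eq hH hH' h₁
      have hb := T.corrMap_eq hH hH' h₂
      have e₇ : (H'.X g).s a' = (H'.X f).r b' := e₁'.trans (T.nat_r h₂).symm
      have h := T.nat_comp f g w a b a' v b' w'' e₁ e₁' e₂ e₂' e (e₁.trans (r_σ _ _ _ _ _).symm)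
        e₇ ((s_σ _ _ _ _ _).trans e₂') h₁ h₂
      change T.corrMap hH hH' _ _ = _
      rw [T.corrMap_eq hH hH' h]
      exact congrArg _ (compMk_congr ha.symm hb.symm _ _))
    (fun x t => by
      obtain ⟨w, rfl⟩ := ((T.isEquivalence x).bijective (hH' x) (hH x)).1.2 t
      have h := T.nat_id x w ((H.G x).unit ((T.W x).s w)) ((H.G x).r_unit _).symm
        (((H.G x).r_unit _).symm.trans ((H.ι x).r_map _).symm)
        ((((H'.ι x).s_map _).trans ((H'.G x).s_unit _)).trans ((T.W x).r_ract _ _ _).symm)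
      change T.corrMap hH hH' _ _ = _
      rw [T.corrMap_eq hH hH' h, objEquiv_s])

end Equivalence

theorem nonempty_iso_iff (hH : H.IsDiscrete) (hH' : H'.IsDiscrete) :
    Nonempty (H.Iso H') ↔ Nonempty (H.Equivalence H') :=
  ⟨fun ⟨θ⟩ => ⟨θ.equivalence hH hH'⟩, fun ⟨T⟩ => ⟨T.iso hH hH'⟩⟩

end GrHom

/-! ## Proper homomorphisms -/

theorem BiSpace.IsCorr.isProper_iff {H G : EtGroupoid.{u}} {X : BiSpace H G} (hX : X.IsCorr)
    (hH : H.IsDiscreteSet) (hG : G.IsDiscreteSet) :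
    X.IsProper ↔ ∀ t, {p | X.r p = t}.Finite := by
  have := hH.1
  have := hX.discreteTopology hG
  have : DiscreteTopology (Quot X.OrbitRel) := discreteTopology_quot _
  have hinj : Function.Injective (Quot.mk X.OrbitRel) := fun p q h => by
    have := congrArg (Quot.lift id fun _ _ h => eq_of_orbitRel hG h) h
    exact this
  rw [BiSpace.IsProper, isProperMap_iff_isClosedMap_and_compact_fibers]
  simp only [isCompact_iff_finite]
  have key : ∀ t, (X.orbitR ⁻¹' {t}).Finite ↔ {p | X.r p = t}.Finite := fun t => by
    have : X.orbitR ⁻¹' {t} = Quot.mk X.OrbitRel '' {p | X.r p = t} := by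
      ext ⟨p⟩
      constructor
      · exact fun h => ⟨p, h, rfl⟩
      · rintro ⟨q, hq, h⟩
        obtain rfl := hinj h
        exact hq
    rw [this, Set.finite_image_iff hinj.injOn]
  simp only [key]
  exact ⟨fun h => h.2.2, fun h => ⟨continuous_of_discreteTopology,
    fun _ _ => isClosed_discrete _, h⟩⟩

namespace ConducheFibration

variable {C : Type u} [SmallCategory C] {F : ConducheFibration C} {H : GrHom C}

theorem isRowFinite_iff_finite (θ : F.toGrHom.Iso H) :
    F.IsRowFinite ↔ ∀ {x y : C} (g : x ⟶ y) (t), {p | (H.X g).r p = t}.Finite := by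
  have key : ∀ {x y : C} (g : x ⟶ y) (Y : F.ObjFib y),
      {α : F.ArrFib g | α.tgt = Y.1}.Finite ↔ {p | (H.X g).r p = θ.obj y Y}.Finite := by
    intro x y g Y
    have : {p | (H.X g).r p = θ.obj y Y} = θ.corr g '' {α : F.ArrFib g | α.tgt = Y.1} := by
      ext p
      obtain ⟨α, rfl⟩ := (θ.corr g).surjective p
      rw [(θ.corr g).injective.mem_set_image, Set.mem_ofPred_eq, θ.corr_r]
      exact ((θ.obj y).injective.eq_iff (b := Y)).trans Subtype.ext_iff
    rw [this]
    exact (Set.finite_image_iff (θ.corr g).injective.injOn).symm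
  constructor
  · intro h x y g t
    obtain ⟨Y, rfl⟩ := (θ.obj y).surjective t
    refine (key g Y).1 ?_
    obtain ⟨Y, rfl⟩ := Y
    exact h Y g
  · intro h X x g
    exact (key g (⟨X, rfl⟩ : F.ObjFib _)).2 (h g _)

theorem isRowFinite_iff_isProper (θ : F.toGrHom.Iso H) : F.IsRowFinite ↔ H.IsProper := by
  have hH := θ.isDiscrete F.isDiscrete_toGrHom
  rw [isRowFinite_iff_finite θ]
  exact forall₃_congr fun x y g => ((H.isCorr g).isProper_iff (hH y) (hH x)).symm

end ConducheFibration

/-! ## Universal C⋆-algebras -/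

theorem NonUnitalStarAlgHom.continuous_of_cstar {A B : Type*} [NonUnitalCStarAlgebra A]
    [NonUnitalCStarAlgebra B] (Φ : A →⋆ₙₐ[ℂ] B) : Continuous Φ :=
  AddMonoidHomClass.continuous_of_bound Φ 1 (by simpa using NonUnitalStarAlgHom.norm_apply_le Φ)

/-- A linear map on a dense subspace of a C⋆-algebra that is contractive, multiplicative and
⋆-preserving extends to a ⋆-homomorphism. -/
theorem exists_nonUnitalStarAlgHom_of_denseRange {A B V : Type*} [NonUnitalCStarAlgebra A]
    [NonUnitalCStarAlgebra B] [AddCommGroup V] [Module ℂ V] (ρ : V →ₗ[ℂ] A) (τ : V →ₗ[ℂ] B)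
    (hd : DenseRange ρ) (hb : ∀ v, ‖τ v‖ ≤ ‖ρ v‖)
    (hmul : ∀ v w, ∃ z, ρ z = ρ v * ρ w ∧ τ z = τ v * τ w)
    (hstar : ∀ v, ∃ z, ρ z = star (ρ v) ∧ τ z = star (τ v)) :
    ∃ Φ : A →⋆ₙₐ[ℂ] B, ∀ v, Φ (ρ v) = τ v := by
  have h : ∀ v, τ.extendOfNorm ρ (ρ v) = τ v :=
    LinearMap.extendOfNorm_eq hd ⟨1, fun v => by simpa using hb v⟩
  refine ⟨{ toFun := τ.extendOfNorm ρ
            map_smul' := fun c a => by simp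
            map_zero' := by simp
            map_add' := fun a b => by simp
            map_mul' := fun a b => ?_
            map_star' := fun a => ?_ }, h⟩
  · refine hd.induction_on₂ (p := fun a b => τ.extendOfNorm ρ (a * b) =
      τ.extendOfNorm ρ a * τ.extendOfNorm ρ b) ?_ (fun v w => ?_) a b
    · exact isClosed_eq (by fun_prop) (by fun_prop)
    · obtain ⟨z, h₁, h₂⟩ := hmul v w
      rw [← h₁, h, h, h, h₂]
  · refine hd.induction_on (p := fun a => τ.extendOfNorm ρ (star a) =
      star (τ.extendOfNorm ρ a)) a ?_ fun v => ?_
    · exact isClosed_eq (by fun_prop) (by fun_prop)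
    · obtain ⟨z, h₁, h₂⟩ := hstar v
      rw [← h₁, h, h, h₂]

namespace UniversalCStar

/-- ⋆-polynomials in the elements of `Γ`. -/
inductive Term (Γ : Type u) : Type u
  | gen (γ : Γ) : Term Γ
  | zero : Term Γ
  | add (t t' : Term Γ) : Term Γ
  | mul (t t' : Term Γ) : Term Γ
  | smul (c : ℂ) (t : Term Γ) : Term Γ
  | star (t : Term Γ) : Term Γ

/-- Evaluation of a ⋆-polynomial. -/
noncomputable def Term.eval {Γ : Type u} {B : Type*} [NonUnitalCStarAlgebra B] (q : Γ → B) :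
    Term Γ → B
  | gen γ => q γ
  | zero => 0
  | add t t' => t.eval q + t'.eval q
  | mul t t' => t.eval q * t'.eval q
  | smul c t => c • t.eval q
  | star t => Star.star (t.eval q)

theorem Term.map_eval {Γ : Type u} {A B : Type*} [NonUnitalCStarAlgebra A]
    [NonUnitalCStarAlgebra B] (φ : A →⋆ₙₐ[ℂ] B) (q : Γ → A) (t : Term Γ) :
    φ (t.eval q) = t.eval (fun γ => φ (q γ)) := by
  induction t with
  | gen γ => rfl
  | zero => simp [eval]
  | add t t' h h' => simp [eval, h, h']
  | mul t t' h h' => simp [eval, h, h']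
  | smul c t h => simp [eval, h]
  | star t h => simp [eval, h, map_star]

theorem exists_eval_of_mem_adjoin {Γ : Type u} {B : Type*} [NonUnitalCStarAlgebra B] (q : Γ → B)
    {b : B} (hb : b ∈ NonUnitalStarAlgebra.adjoin ℂ (Set.range q)) : ∃ t : Term Γ, t.eval q = b := by
  induction hb using NonUnitalStarAlgebra.adjoin_induction with
  | mem x hx => obtain ⟨γ, rfl⟩ := hx; exact ⟨.gen γ, rfl⟩
  | add x y _ _ hx hy =>
    obtain ⟨t, rfl⟩ := hx; obtain ⟨t', rfl⟩ := hy; exact ⟨.add t t', rfl⟩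
  | zero => exact ⟨.zero, rfl⟩
  | mul x y _ _ hx hy =>
    obtain ⟨t, rfl⟩ := hx; obtain ⟨t', rfl⟩ := hy; exact ⟨.mul t t', rfl⟩
  | smul c x _ hx => obtain ⟨t, rfl⟩ := hx; exact ⟨.smul c t, rfl⟩
  | star x _ hx => obtain ⟨t, rfl⟩ := hx; exact ⟨.star t, rfl⟩

theorem eval_mem_adjoin {Γ : Type u} {B : Type*} [NonUnitalCStarAlgebra B] (q : Γ → B)
    (t : Term Γ) : t.eval q ∈ NonUnitalStarAlgebra.adjoin ℂ (Set.range q) := by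
  induction t with
  | gen γ => exact NonUnitalStarAlgebra.subset_adjoin ℂ _ ⟨γ, rfl⟩
  | zero => exact zero_mem _
  | add t t' h h' => exact add_mem h h'
  | mul t t' h h' => exact mul_mem h h'
  | smul c t h => exact SMulMemClass.smul_mem c h
  | star t h => exact star_mem h

theorem existsUnique_lift {Γ : Type u} {A B : Type*} [NonUnitalCStarAlgebra A]
    [NonUnitalCStarAlgebra B] (q : Γ → A) (hq : DenseRange fun t : Term Γ => t.eval q) (q' : Γ → B)
    (hbound : ∀ t : Term Γ, ‖t.eval q'‖ ≤ ‖t.eval q‖) :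
    ∃! Φ : A →⋆ₙₐ[ℂ] B, ∀ γ, Φ (q γ) = q' γ := by
  let V := NonUnitalStarAlgebra.adjoin ℂ (Set.range fun γ => ((q γ, q' γ) : A × B))
  have heval : ∀ t : Term Γ, t.eval (fun γ => ((q γ, q' γ) : A × B)) = (t.eval q, t.eval q') :=
    fun t => Prod.ext (t.map_eval (NonUnitalStarAlgHom.fst ℂ A B) _)
      (t.map_eval (NonUnitalStarAlgHom.snd ℂ A B) _)
  let V' : Submodule ℂ (A × B) := V.toNonUnitalSubalgebra.toSubmodule
  let ρ : V' →ₗ[ℂ] A := LinearMap.fst ℂ A B ∘ₗ V'.subtype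
  let τ : V' →ₗ[ℂ] B := LinearMap.snd ℂ A B ∘ₗ V'.subtype
  have h₁ : DenseRange ρ := hq.mono (by
    rintro _ ⟨t, rfl⟩
    exact ⟨⟨_, eval_mem_adjoin _ t⟩, congrArg Prod.fst (heval t)⟩)
  have h₂ : ∀ v, ‖τ v‖ ≤ ‖ρ v‖ := by
    rintro ⟨v, hv⟩
    obtain ⟨t, rfl⟩ := exists_eval_of_mem_adjoin _ hv
    have h₁ := congrArg Prod.fst (heval t)
    have h₂ := congrArg Prod.snd (heval t)
    exact (congrArg norm h₂).le.trans ((hbound t).trans (congrArg norm h₁).ge)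
  obtain ⟨Φ, hΦ⟩ := exists_nonUnitalStarAlgHom_of_denseRange ρ τ h₁ h₂
    (fun v w => ⟨⟨v.1 * w.1, V.mul_mem' v.2 w.2⟩, rfl, rfl⟩)
    (fun v => ⟨⟨star v.1, V.star_mem' v.2⟩, rfl, rfl⟩)
  have hΦ' : ∀ γ, Φ (q γ) = q' γ := fun γ =>
    hΦ ⟨(q γ, q' γ), NonUnitalStarAlgebra.subset_adjoin ℂ _ ⟨γ, rfl⟩⟩
  refine ⟨Φ, hΦ', fun Ψ hΨ => ?_⟩
  refine DFunLike.ext' (Continuous.ext_on hq Ψ.continuous_of_cstar Φ.continuous_of_cstar ?_)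
  rintro _ ⟨t, rfl⟩
  simp only [Term.map_eval, hΨ, hΦ']

/-- Evaluation of coordinates, as a ⋆-homomorphism on a bounded product of C⋆-algebras. -/
noncomputable def lpEval {ι : Type*} (B : ι → Type*) [∀ i, NonUnitalCStarAlgebra (B i)] (i : ι) :
    lp B ⊤ →⋆ₙₐ[ℂ] B i where
  toFun f := f i
  map_smul' _ _ := rfl
  map_zero' := rfl
  map_add' _ _ := rfl
  map_mul' _ _ := rfl
  map_star' _ := rfl

theorem exists_universal {Γ : Type u} (R : ∀ {B : Type u} [NonUnitalCStarAlgebra B], (Γ → B) → Prop)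
    (hbdd : ∀ {B : Type u} [NonUnitalCStarAlgebra B] (q : Γ → B), R q → ∀ γ, ‖q γ‖ ≤ 1)
    (hinj : ∀ {ι : Type u} {A : Type u} [NonUnitalCStarAlgebra A] {B : ι → Type u}
      [∀ i, NonUnitalCStarAlgebra (B i)] (φ : ∀ i, A →⋆ₙₐ[ℂ] B i),
      (∀ a b, (∀ i, φ i a = φ i b) → a = b) → ∀ q : Γ → A, (∀ i, R fun γ => φ i (q γ)) → R q) :
    ∃ (A : Type u) (_ : NonUnitalCStarAlgebra A) (q : Γ → A), R q ∧
      ∀ {B : Type u} [NonUnitalCStarAlgebra B] (q' : Γ → B), R q' →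
        ∃! Φ : A →⋆ₙₐ[ℂ] B, ∀ γ, Φ (q γ) = q' γ := by
  let I : Type u := {f : Term Γ → ℝ // ∃ (B : Type u) (_ : NonUnitalCStarAlgebra B) (q : Γ → B),
    R q ∧ ∀ t, f t = ‖t.eval q‖}
  choose B instB qB hR hnorm using fun i : I => i.2
  let d (γ : Γ) : lp B ⊤ := ⟨fun i => qB i γ, memℓp_infty ⟨1, by
    rintro _ ⟨i, rfl⟩; exact hbdd _ (hR i) γ⟩⟩
  let S := (NonUnitalStarAlgebra.adjoin ℂ (Set.range d)).topologicalClosure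
  have hS : IsClosed (S : Set (lp B ⊤)) := NonUnitalStarSubalgebra.isClosed_topologicalClosure _
  have : IsClosed (S : Set (lp B ⊤)) := hS
  let q (γ : Γ) : S := ⟨d γ, NonUnitalStarSubalgebra.le_topologicalClosure _
    (NonUnitalStarAlgebra.subset_adjoin ℂ _ ⟨γ, rfl⟩)⟩
  let incl : S →⋆ₙₐ[ℂ] lp B ⊤ := NonUnitalStarSubalgebraClass.subtype S
  have hincl : ∀ t : Term Γ, ((t.eval q : S) : lp B ⊤) = t.eval d := fun t => t.map_eval incl q
  have hdense : ∀ V : Set S, (∀ t : Term Γ, t.eval q ∈ V) → Dense V := fun V hV => by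
    rw [Subtype.dense_iff]
    intro a ha
    refine closure_mono ?_ ha
    intro b hb
    obtain ⟨t, rfl⟩ := exists_eval_of_mem_adjoin d hb
    exact ⟨t.eval q, hV t, hincl t⟩
  refine ⟨S, inferInstance, q, ?_, fun {B'} _ q' hq' => ?_⟩
  · refine hinj (ι := PUnit) (B := fun _ => lp B ⊤) (fun _ => incl)
      (fun a b h => Subtype.ext (h ⟨⟩)) q fun _ => ?_
    exact hinj (lpEval B) (fun a b h => lp.ext (funext h)) d hR
  · have hbound : ∀ t : Term Γ, ‖t.eval q'‖ ≤ ‖t.eval q‖ := fun t => by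
      let i : I := ⟨fun t => ‖t.eval q'‖, B', _, q', hq', fun _ => rfl⟩
      calc ‖t.eval q'‖ = ‖t.eval (qB i)‖ := hnorm i t
        _ = ‖(t.eval d) i‖ := congrArg norm (t.map_eval (lpEval B i) d).symm
        _ ≤ ‖t.eval d‖ := lp.norm_apply_le_norm (by simp) _ _
        _ = ‖t.eval q‖ := by rw [← hincl]; rfl
    exact existsUnique_lift q (hdense _ fun t => ⟨t, rfl⟩) q' hbound

end UniversalCStar

theorem IsStarProjection.norm_le_one {A : Type*} [NonUnitalCStarAlgebra A] {p : A}
    (hp : IsStarProjection p) : ‖p‖ ≤ 1 := by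
  have h := CStarRing.norm_star_mul_self (x := p)
  rw [hp.isSelfAdjoint.star_eq, hp.isIdempotentElem.eq] at h
  by_contra! h'
  nlinarith

namespace ConducheFibration

variable {C : Type u} [SmallCategory C] {F : ConducheFibration C}

namespace Family

variable {A : Type u} [NonUnitalCStarAlgebra A]

theorem norm_S_le_one (p : F.Family A) {Y X : F.E} (α : Y ⟶ X) : ‖p.S α‖ ≤ 1 := by
  have h := CStarRing.norm_star_mul_self (x := p.S α)
  rw [p.star_S_mul_S] at h
  have := (p.isStarProjection Y).norm_le_one
  by_contra! h'
  nlinarith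

/-- A family of elements satisfies the relations if it does so after applying enough
⋆-homomorphisms. -/
theorem exists_of_injective (hF : F.IsRowFinite) {ι : Type u} {B : ι → Type u}
    [∀ i, NonUnitalCStarAlgebra (B i)] (φ : ∀ i, A →⋆ₙₐ[ℂ] B i)
    (hφ : ∀ a b, (∀ i, φ i a = φ i b) → a = b) (q : (Σ Y X : F.E, (Y ⟶ X)) → A)
    (h : ∀ i, ∃ p : F.Family (B i), ∀ {Y X : F.E} (α : Y ⟶ X), p.S α = φ i (q ⟨Y, X, α⟩)) :
    ∃ p : F.Family A, ∀ {Y X : F.E} (α : Y ⟶ X), p.S α = q ⟨Y, X, α⟩ := by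
  choose p hp using h
  have hP : ∀ i X, φ i (q ⟨X, X, 𝟙 X⟩) = (p i).P X := fun i X => by rw [← hp, (p i).S_id]
  refine ⟨{ P := fun X => q ⟨X, X, 𝟙 X⟩
            S := fun {Y X} α => q ⟨Y, X, α⟩
            isStarProjection := fun X => ⟨hφ _ _ fun i => ?_, hφ _ _ fun i => ?_⟩
            partial_isometry := fun α => hφ _ _ fun i => ?_
            orthogonal := fun h => hφ _ _ fun i => ?_
            S_comp := fun β α => hφ _ _ fun i => ?_
            S_id := fun X => rfl
            star_S_mul_S := fun α => hφ _ _ fun i => ?_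
            star_S_mul_S_of_ne := fun g α β h => hφ _ _ fun i => ?_
            sum_eq := fun X {x} g => hφ _ _ fun i => ?_ }, fun _ => rfl⟩
  · rw [map_mul, hP, ((p i).isStarProjection X).isIdempotentElem.eq]
  · rw [map_star, hP, ((p i).isStarProjection X).isSelfAdjoint.star_eq]
  · simp only [map_mul, map_star, ← hp, (p i).partial_isometry]
  · rw [map_mul, hP, hP, (p i).orthogonal h, map_zero]
  · simp only [map_mul, ← hp, (p i).S_comp]
  · rw [map_mul, map_star, ← hp, (p i).star_S_mul_S, hP]
  · rw [map_mul, map_star, ← hp, ← hp, (p i).star_S_mul_S_of_ne g α β h, map_zero]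
  · rw [hP, ← (p i).sum_eq X g, finsum_mem_eq_finite_toFinset_sum _ (hF X g),
      finsum_mem_eq_finite_toFinset_sum _ (hF X g), map_sum]
    simp only [map_mul, map_star, ← hp]

end Family

theorem exists_universal_family (hF : F.IsRowFinite) :
    ∃ (A : Type u) (_ : NonUnitalCStarAlgebra A) (p : F.Family A), p.IsUniversal := by
  obtain ⟨A, _, q, ⟨p, hp⟩, hq⟩ := UniversalCStar.exists_universal
    (Γ := Σ Y X : F.E, (Y ⟶ X))
    (fun {B} _ q => ∃ p : F.Family B, ∀ {Y X : F.E} (α : Y ⟶ X), p.S α = q ⟨Y, X, α⟩)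
    (by
      rintro B _ q ⟨p, hp⟩ ⟨Y, X, α⟩
      rw [← hp]
      exact p.norm_S_le_one α)
    (fun φ hφ q h => Family.exists_of_injective hF φ hφ q h)
  refine ⟨A, _, p, fun {B} _ q' => ?_⟩
  obtain ⟨Φ, hΦ, huniq⟩ := hq (fun γ => q'.S γ.2.2) ⟨q', fun _ => rfl⟩
  refine ⟨Φ, ⟨fun X => ?_, fun α => ?_⟩, fun Ψ hΨ => huniq Ψ ?_⟩
  · rw [p.S_id, q'.S_id, hp, hΦ]
  · rw [hp, hΦ]
  · rintro ⟨Y, X, α⟩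
    rw [← hp, hΨ.2]

end ConducheFibration

/-! ## Finitely supported functions on discrete spaces -/

namespace quasiCont

variable {X : Type u} [TopologicalSpace X]

theorem finite_support [DiscreteTopology X] (f : quasiCont X) : (Function.support f.1).Finite := by
  obtain ⟨f, hf⟩ := f
  refine Submodule.span_induction (p := fun f _ => (Function.support f).Finite) ?_ ?_ ?_ ?_ hf
  · rintro f ⟨V, -, -, -, K, -, hK, h⟩
    refine hK.finite_of_discrete.subset fun x hx => ?_
    by_contra hxK
    exact hx (h x hxK)
  · simp
  · intro f g _ _ hf hg
    exact (hf.union hg).subset (Function.support_add f g)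
  · intro c f _ hf
    exact hf.subset (Function.support_const_smul_subset c f)

theorem mem_of_finite_support [DiscreteTopology X] {f : X → ℂ} (hf : (Function.support f).Finite) :
    f ∈ quasiCont X :=
  Submodule.subset_span ⟨Set.univ, isOpen_univ, inferInstance,
    continuous_of_discreteTopology.continuousOn, Function.support f, Set.subset_univ _,
    hf.isCompact, fun x hx => by simpa using hx⟩

variable [DiscreteTopology X]

/-- The characteristic function of a point of a discrete space. -/
noncomputable def single (x : X) : quasiCont X := delta x (isOpen_discrete _)

open Classical in
theorem single_apply (x y : X) : (single x).1 y = if y = x then 1 else 0 := by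
  change Set.indicator {x} 1 y = _
  rw [Set.indicator_apply]
  simp

/-- Compactly supported functions on a discrete space as finitely supported functions. -/
noncomputable def toFinsupp : quasiCont X →ₗ[ℂ] X →₀ ℂ where
  toFun f := Finsupp.ofSupportFinite f.1 (finite_support f)
  map_add' _ _ := by ext; rfl
  map_smul' _ _ := by ext; rfl

theorem toFinsupp_apply (f : quasiCont X) (x : X) : toFinsupp f x = f.1 x := rfl

theorem toFinsupp_single (x : X) : toFinsupp (single x) = Finsupp.single x 1 := by
  classical
  ext y
  rw [toFinsupp_apply, single_apply, Finsupp.single_apply]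
  simp only [eq_comm]

theorem eq_sum_single (f : quasiCont X) :
    f = ∑ x ∈ (finite_support f).toFinset, f.1 x • single x := by
  classical
  refine Subtype.ext (funext fun y => ?_)
  rw [Submodule.coe_sum, Finset.sum_apply]
  simp only [Submodule.coe_smul, Pi.smul_apply, single_apply, smul_eq_mul, mul_ite, mul_one,
    mul_zero]
  rw [Finset.sum_ite_eq]
  simp only [Set.Finite.mem_toFinset, Function.mem_support]
  by_cases h : f.1 y = 0 <;> simp [h]

variable {M : Type*} [AddCommGroup M] [Module ℂ M]

/-- The linear map with given values on characteristic functions of points. -/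
noncomputable def lift (v : X → M) : quasiCont X →ₗ[ℂ] M :=
  Finsupp.linearCombination ℂ v ∘ₗ toFinsupp

theorem lift_single (v : X → M) (x : X) : lift v (single x) = v x := by
  simp [lift, toFinsupp_single]

theorem hom_ext {φ ψ : quasiCont X →ₗ[ℂ] M} (h : ∀ x, φ (single x) = ψ (single x)) : φ = ψ := by
  ext f
  rw [eq_sum_single f]
  simp only [map_sum, map_smul, h]

theorem map_eq_sum (φ : quasiCont X →ₗ[ℂ] M) (f : quasiCont X) :
    φ f = ∑ x ∈ (finite_support f).toFinset, f.1 x • φ (single x) := by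
  conv_lhs => rw [eq_sum_single f]
  simp only [map_sum, map_smul]

theorem range_eq_span (φ : quasiCont X →ₗ[ℂ] M) :
    LinearMap.range φ = Submodule.span ℂ (Set.range fun x => φ (single x)) := by
  apply le_antisymm
  · rintro _ ⟨f, rfl⟩
    rw [map_eq_sum]
    exact Submodule.sum_mem _ fun x _ =>
      Submodule.smul_mem _ _ (Submodule.subset_span ⟨x, rfl⟩)
  · rw [Submodule.span_le]
    rintro _ ⟨x, rfl⟩
    exact ⟨_, rfl⟩

end quasiCont

/-! ## The Hilbert module of a map between discrete spaces -/

open scoped ZeroAtInfty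
open Filter Topology

section

variable {T : Type u} [TopologicalSpace T] [DiscreteTopology T]

/-- A function that vanishes at infinity on a discrete space. -/
def c0Mk (f : T → ℂ) (hf : Tendsto f cofinite (𝓝 0)) : C₀(T, ℂ) where
  toFun := f
  continuous_toFun := continuous_of_discreteTopology
  zero_at_infty' := by rwa [cocompact_eq_cofinite]

theorem c0_tendsto (a : C₀(T, ℂ)) : Tendsto a cofinite (𝓝 0) := by
  have := a.zero_at_infty'
  rwa [cocompact_eq_cofinite] at this

theorem c0_norm_apply_le {T : Type*} [TopologicalSpace T] (a : C₀(T, ℂ)) (t : T) :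
    ‖a t‖ ≤ ‖a‖ := by
  rw [← ZeroAtInftyContinuousMap.norm_toBCF_eq_norm]
  exact a.toBCF.norm_coe_le_norm t

theorem c0_norm_le {T : Type*} [TopologicalSpace T] (a : C₀(T, ℂ)) {c : ℝ} (hc : 0 ≤ c)
    (h : ∀ t, ‖a t‖ ≤ c) : ‖a‖ ≤ c := by
  rw [← ZeroAtInftyContinuousMap.norm_toBCF_eq_norm]
  exact (BoundedContinuousFunction.norm_le hc).2 h

theorem tendsto_cofinite_of_finite_support {T : Type*} {f : T → ℂ}
    (hf : (Function.support f).Finite) : Tendsto f cofinite (𝓝 0) :=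
  tendsto_nhds_of_eventually_eq (by
    filter_upwards [hf.compl_mem_cofinite] with t ht
    simpa using ht)

end

/-- The ambient space of bounded families of square-summable functions on the fibres of `s`. -/
abbrev FibreL2 {X T : Type u} (s : X → T) (t : T) : Type u := lp (fun _ : {p // s p = t} => ℂ) 2

/-- The Hilbert module of a map `s : X → T` between discrete sets: families of square-summable
functions on the fibres whose norms vanish at infinity. -/
def HilbMod {X T : Type u} (s : X → T) : Submodule ℂ (lp (FibreL2 s) ⊤) where
  carrier := {ξ | Tendsto (fun t => ‖ξ t‖) cofinite (𝓝 0)}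
  zero_mem' := by
    change Tendsto (fun t => ‖(0 : FibreL2 s t)‖) cofinite (𝓝 0)
    simpa only [norm_zero] using tendsto_const_nhds
  add_mem' {ξ η} hξ hη := by
    refine squeeze_zero (fun t => norm_nonneg _) (fun t => norm_add_le (ξ t) (η t)) ?_
    simpa using hξ.add hη
  smul_mem' c ξ hξ := by
    change Tendsto (fun t => ‖c • ξ t‖) cofinite (𝓝 0)
    simp only [norm_smul]
    simpa using hξ.const_mul ‖c‖

namespace HilbMod

variable {X T : Type u} {s : X → T}

theorem tendsto (ξ : HilbMod s) : Tendsto (fun t => ‖ξ.1 t‖) cofinite (𝓝 0) := ξ.2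

theorem norm_apply_le (ξ : HilbMod s) (t : T) : ‖ξ.1 t‖ ≤ ‖ξ‖ :=
  lp.norm_apply_le_norm (by simp) ξ.1 t

theorem norm_le {ξ : HilbMod s} {c : ℝ} (hc : 0 ≤ c) (h : ∀ t, ‖ξ.1 t‖ ≤ c) : ‖ξ‖ ≤ c :=
  lp.norm_le_of_forall_le hc h

instance : CompleteSpace (HilbMod s) := by
  have : IsClosed (HilbMod s : Set (lp (FibreL2 s) ⊤)) := by
    refine isClosed_of_closure_subset fun ξ hξ => ?_
    change Tendsto (fun t => ‖ξ t‖) cofinite (𝓝 0)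
    rw [Metric.tendsto_nhds]
    intro ε hε
    obtain ⟨η, hη, h⟩ := Metric.mem_closure_iff.1 hξ (ε / 2) (half_pos hε)
    have hη' : Tendsto (fun t => ‖η t‖) cofinite (𝓝 0) := hη
    filter_upwards [Metric.tendsto_nhds.1 hη' (ε / 2) (half_pos hε)] with t ht
    have h₁ : ‖(ξ - η) t‖ ≤ ‖ξ - η‖ := lp.norm_apply_le_norm (by simp) _ t
    have h₂ : ‖ξ t‖ ≤ ‖(ξ - η) t‖ + ‖η t‖ := by
      have : ξ t = (ξ - η) t + η t := by simp
      rw [this]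
      exact norm_add_le _ _
    rw [dist_eq_norm] at h
    simp only [dist_zero_right, norm_norm] at ht ⊢
    linarith
  exact this.completeSpace_coe

/-- The element of the Hilbert module with given components. -/
def mk (ξ : ∀ t, FibreL2 s t) (h : Tendsto (fun t => ‖ξ t‖) cofinite (𝓝 0)) : HilbMod s :=
  ⟨⟨ξ, memℓp_infty (by
    obtain ⟨c, hc⟩ := h.bddAbove_range_of_cofinite
    exact ⟨c, hc⟩)⟩, h⟩

/-- The function on `X` underlying an element of the Hilbert module. -/
def val (ξ : HilbMod s) (p : X) : ℂ := ξ.1 (s p) ⟨p, rfl⟩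

theorem val_eq (ξ : HilbMod s) {t : T} (p : {p // s p = t}) : ξ.1 t p = val ξ p.1 := by
  obtain ⟨p, rfl⟩ := p
  rfl

theorem ext {ξ η : HilbMod s} (h : ∀ p, val ξ p = val η p) : ξ = η := by
  refine Subtype.ext (lp.ext (funext fun t => lp.ext (funext fun p => ?_)))
  rw [val_eq, val_eq, h]

theorem val_add (ξ η : HilbMod s) (p : X) : val (ξ + η) p = val ξ p + val η p := rfl

theorem val_smul (c : ℂ) (ξ : HilbMod s) (p : X) : val (c • ξ) p = c * val ξ p := rfl

theorem summable_inner (ξ η : HilbMod s) (t : T) :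
    Summable fun p : {p // s p = t} => star (val ξ p.1) * val η p.1 := by
  have := lp.summable_inner (𝕜 := ℂ) (ξ.1 t) (η.1 t)
  simpa only [val_eq, RCLike.inner_apply', RCLike.star_def] using this

theorem inner_eq_tsum (ξ η : HilbMod s) (t : T) :
    inner ℂ (ξ.1 t) (η.1 t) = ∑' p : {p // s p = t}, star (val ξ p.1) * val η p.1 := by
  rw [lp.inner_eq_tsum]
  simp only [val_eq, RCLike.inner_apply', RCLike.star_def]

end HilbMod

namespace HilbMod

section fibre

variable {X T : Type u} {s : X → T}

/-- Multiplication by a bounded function on the fibre. -/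
noncomputable def fibreMul {t : T} (b : X → ℂ) {c : ℝ} (hb : ∀ p, ‖b p‖ ≤ c) (v : FibreL2 s t) :
    FibreL2 s t :=
  ⟨fun p => b p.1 * v p, (lp.memℓp (c • v)).mono' fun p => by
    rw [lp.coeFn_smul, Pi.smul_apply, norm_mul, norm_smul]
    gcongr
    exact (hb p.1).trans (le_abs_self c)⟩

theorem norm_fibreMul_le {t : T} (b : X → ℂ) {c : ℝ} (hc : 0 ≤ c) (hb : ∀ p, ‖b p‖ ≤ c)
    (v : FibreL2 s t) : ‖fibreMul b hb v‖ ≤ c * ‖v‖ := by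
  have : ‖fibreMul b hb v‖ ≤ ‖c • v‖ := lp.norm_mono (by simp) fun p => by
    rw [lp.coeFn_smul, Pi.smul_apply, norm_smul]
    change ‖b p.1 * v p‖ ≤ _
    rw [norm_mul]
    gcongr
    exact (hb p.1).trans (le_abs_self c)
  rwa [norm_smul, Real.norm_of_nonneg hc] at this

end fibre

section module

variable {X T : Type u} {s : X → T}

/-- Multiplication by a bounded function. -/
noncomputable def mulFun (b : X → ℂ) {c : ℝ} (hb : ∀ p, ‖b p‖ ≤ c) (ξ : HilbMod s) : HilbMod s :=
  mk (fun t => fibreMul b hb (ξ.1 t)) (by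
    have hb' : ∀ p, ‖b p‖ ≤ |c| := fun p => (hb p).trans (le_abs_self c)
    refine squeeze_zero (fun t => norm_nonneg _)
      (fun t => norm_fibreMul_le b (abs_nonneg c) hb' (ξ.1 t)) ?_
    simpa using (tendsto ξ).const_mul |c|)

theorem norm_mulFun_le (b : X → ℂ) {c : ℝ} (hc : 0 ≤ c) (hb : ∀ p, ‖b p‖ ≤ c) (ξ : HilbMod s) :
    ‖mulFun b hb ξ‖ ≤ c * ‖ξ‖ :=
  norm_le (by positivity) fun t => (norm_fibreMul_le b hc hb (ξ.1 t)).trans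
    (by gcongr; exact norm_apply_le ξ t)

theorem tendsto_inner (ξ η : HilbMod s) :
    Tendsto (fun t => inner ℂ (ξ.1 t) (η.1 t)) cofinite (𝓝 0) := by
  rw [tendsto_zero_iff_norm_tendsto_zero]
  refine squeeze_zero (fun t => norm_nonneg _) (fun t => norm_inner_le_norm (ξ.1 t) (η.1 t)) ?_
  simpa using (tendsto ξ).mul (tendsto η)

variable [TopologicalSpace T] [DiscreteTopology T]

/-- The inner product. -/
noncomputable def innerC0 (ξ η : HilbMod s) : C₀(T, ℂ) :=
  c0Mk (fun t => inner ℂ (ξ.1 t) (η.1 t)) (tendsto_inner ξ η)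

theorem innerC0_apply (ξ η : HilbMod s) (t : T) : innerC0 ξ η t = inner ℂ (ξ.1 t) (η.1 t) := rfl

theorem innerC0_eq_tsum (ξ η : HilbMod s) (t : T) :
    innerC0 ξ η t = ∑' p : {p // s p = t}, star (val ξ p.1) * val η p.1 :=
  inner_eq_tsum ξ η t

theorem norm_sq_eq (ξ : HilbMod s) : ‖ξ‖ ^ 2 = ‖innerC0 ξ ξ‖ := by
  have h : ∀ t, ‖innerC0 ξ ξ t‖ = ‖ξ.1 t‖ ^ 2 := fun t => by
    rw [innerC0_apply, inner_self_eq_norm_sq_to_K]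
    simp
  apply le_antisymm
  · refine (Real.le_sqrt (norm_nonneg _) (norm_nonneg _)).1
      (norm_le (Real.sqrt_nonneg _) fun t => Real.le_sqrt_of_sq_le ?_)
    rw [← h]
    exact c0_norm_apply_le _ t
  · refine c0_norm_le _ (by positivity) fun t => ?_
    rw [h]
    gcongr
    exact norm_apply_le ξ t

/-- The square root of a function of the form `⟨ξ, ξ⟩`. -/
noncomputable def absC0 (ξ : HilbMod s) : C₀(T, ℂ) :=
  c0Mk (fun t => (‖ξ.1 t‖ : ℂ)) (by
    rw [tendsto_zero_iff_norm_tendsto_zero]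
    simpa using tendsto ξ)

/-- The right module structure. -/
noncomputable def rsmulHom (s : X → T) : HilbMod s →ₗ[ℂ] C₀(T, ℂ) →ₗ[ℂ] HilbMod s :=
  LinearMap.mk₂ ℂ (fun ξ b => mulFun (fun p => b (s p)) (fun p => c0_norm_apply_le b (s p)) ξ)
    (fun _ _ _ => ext fun _ => mul_add _ _ _) (fun _ _ _ => ext fun _ => mul_left_comm _ _ _)
    (fun _ _ _ => ext fun _ => add_mul _ _ _) (fun _ _ _ => ext fun _ => mul_assoc _ _ _)

theorem val_rsmulHom (ξ : HilbMod s) (b : C₀(T, ℂ)) (p : X) :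
    val (rsmulHom s ξ b) p = b (s p) * val ξ p := rfl

theorem innerC0_add (ξ η ζ : HilbMod s) : innerC0 ξ (η + ζ) = innerC0 ξ η + innerC0 ξ ζ := by
  ext t
  exact inner_add_right (𝕜 := ℂ) (ξ.1 t) (η.1 t) (ζ.1 t)

theorem innerC0_smul (c : ℂ) (ξ η : HilbMod s) : innerC0 ξ (c • η) = c • innerC0 ξ η := by
  ext t
  exact inner_smul_right (𝕜 := ℂ) (ξ.1 t) (η.1 t) c

theorem innerC0_rsmulHom (ξ η : HilbMod s) (b : C₀(T, ℂ)) :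
    innerC0 ξ (rsmulHom s η b) = innerC0 ξ η * b := by
  ext t
  change innerC0 ξ _ t = innerC0 ξ η t * b t
  rw [innerC0_eq_tsum, innerC0_eq_tsum, ← tsum_mul_right]
  refine tsum_congr fun p => ?_
  rw [val_rsmulHom, p.2]
  ring

theorem star_innerC0 (ξ η : HilbMod s) : star (innerC0 ξ η) = innerC0 η ξ := by
  ext t
  exact inner_conj_symm (𝕜 := ℂ) (η.1 t) (ξ.1 t)

theorem innerC0_self (ξ : HilbMod s) : innerC0 ξ ξ = star (absC0 ξ) * absC0 ξ := by
  ext t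
  change inner ℂ (ξ.1 t) (ξ.1 t) = star (‖ξ.1 t‖ : ℂ) * (‖ξ.1 t‖ : ℂ)
  rw [inner_self_eq_norm_sq_to_K]
  simp [sq]

section lsmul

variable {S : Type u} [TopologicalSpace S]

/-- The left multiplication by one function. -/
noncomputable def lsmulAux (r : X → S) (s : X → T) (a : C₀(S, ℂ)) : HilbMod s →ₗ[ℂ] HilbMod s where
  toFun ξ := mulFun (fun p => a (r p)) (fun p => c0_norm_apply_le a (r p)) ξ
  map_add' _ _ := ext fun _ => mul_add _ _ _
  map_smul' _ _ := ext fun _ => mul_left_comm _ _ _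

/-- The left action of functions. -/
noncomputable def lsmulHom (r : X → S) (s : X → T) : C₀(S, ℂ) →ₗ[ℂ] HilbMod s →L[ℂ] HilbMod s where
  toFun a := (lsmulAux r s a).mkContinuous ‖a‖ fun ξ => norm_mulFun_le _ (norm_nonneg a) _ ξ
  map_add' _ _ := ContinuousLinearMap.ext fun _ => ext fun _ => add_mul _ _ _
  map_smul' _ _ := ContinuousLinearMap.ext fun _ => ext fun _ => mul_assoc _ _ _

theorem val_lsmulHom (r : X → S) (a : C₀(S, ℂ)) (ξ : HilbMod s) (p : X) :
    val (lsmulHom r s a ξ) p = a (r p) * val ξ p := rfl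

theorem innerC0_lsmulHom (r : X → S) (a : C₀(S, ℂ)) (ξ η : HilbMod s) :
    innerC0 (lsmulHom r s a ξ) η = innerC0 ξ (lsmulHom r s (star a) η) := by
  ext t
  rw [innerC0_eq_tsum, innerC0_eq_tsum]
  refine tsum_congr fun p => ?_
  rw [val_lsmulHom, val_lsmulHom, star_mul']
  change _ = star (val ξ p.1) * (star (a (r p.1)) * val η p.1)
  ring

end lsmul

end module


section delta

variable {X T : Type u} {s : X → T}

open Classical in
/-- A function supported on one fibre. -/
noncomputable def ofFibre (s : X → T) (t : T) : FibreL2 s t →ₗ[ℂ] HilbMod s where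
  toFun v := ⟨lp.single ⊤ t v, by
    refine tendsto_nhds_of_eventually_eq ?_
    filter_upwards [(Set.finite_singleton t).compl_mem_cofinite] with t' ht'
    rw [lp.single_apply_ne _ _ _ (by simpa using ht'), norm_zero]⟩
  map_add' v w := Subtype.ext (lp.single_add _ _ _ _)
  map_smul' c v := Subtype.ext (lp.single_smul _ _ _ _)

theorem norm_ofFibre (t : T) (v : FibreL2 s t) : ‖ofFibre s t v‖ = ‖v‖ := by
  classical
  exact lp.norm_single (by simp) t v

open Classical in
/-- The characteristic function of a point. -/
noncomputable def delta (s : X → T) (p : X) : HilbMod s := ofFibre s (s p) (lp.single 2 ⟨p, rfl⟩ 1)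

open Classical in
theorem val_ofFibre (t : T) (v : FibreL2 s t) (p : X) :
    val (ofFibre s t v) p = if h : s p = t then v ⟨p, h⟩ else 0 := by
  split_ifs with h
  · subst h
    have : (lp.single ⊤ (s p) v : lp (FibreL2 s) ⊤) (s p) = v := lp.single_apply_self _ _ _
    change (lp.single ⊤ (s p) v : lp (FibreL2 s) ⊤) (s p) ⟨p, rfl⟩ = _
    rw [this]
  · have : (lp.single ⊤ t v : lp (FibreL2 s) ⊤) (s p) = 0 := lp.single_apply_ne _ _ _ h
    change (lp.single ⊤ t v : lp (FibreL2 s) ⊤) (s p) ⟨p, rfl⟩ = _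
    rw [this]
    rfl

open Classical in
theorem val_delta (p q : X) : val (delta s p) q = if q = p then 1 else 0 := by
  rw [delta, val_ofFibre]
  by_cases h : s q = s p
  · rw [dif_pos h]
    by_cases hq : q = p
    · subst hq
      rw [if_pos rfl]
      exact lp.single_apply_self _ _ _
    · rw [if_neg hq]
      exact lp.single_apply_ne _ _ _ fun h' => hq (congrArg Subtype.val h')
  · rw [dif_neg h, if_neg fun h' => h (congrArg s h')]

theorem dense_span_delta (s : X → T) :
    Dense (Submodule.span ℂ (Set.range (delta s)) : Set (HilbMod s)) := by
  classical
  set K := (Submodule.span ℂ (Set.range (delta s))).topologicalClosure with hK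
  suffices h : ∀ ξ, ξ ∈ K from fun ξ => h ξ
  have hKc : IsClosed (K : Set (HilbMod s)) := Submodule.isClosed_topologicalClosure _
  have h₁ : ∀ t (v : FibreL2 s t), ofFibre s t v ∈ K := fun t v => by
    let φ : FibreL2 s t →L[ℂ] HilbMod s := (ofFibre s t).mkContinuous 1
      fun v => by rw [norm_ofFibre, one_mul]
    have h := (lp.hasSum_single (by simp) v).mapL φ
    refine hKc.mem_of_tendsto h (Eventually.of_forall fun F => ?_)
    refine Submodule.sum_mem _ fun p _ => ?_
    have : φ (lp.single 2 p (v p)) = v p • delta s p.1 := by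
      obtain ⟨p, rfl⟩ := p
      change ofFibre s (s p) (lp.single 2 ⟨p, rfl⟩ _) =
        _ • ofFibre s (s p) (lp.single 2 ⟨p, rfl⟩ 1)
      rw [← map_smul, ← lp.single_smul]
      simp
    rw [this]
    exact Submodule.smul_mem _ _ (Submodule.le_topologicalClosure _
      (Submodule.subset_span ⟨_, rfl⟩))
  intro ξ
  rw [← SetLike.mem_coe, ← hKc.closure_eq, Metric.mem_closure_iff]
  intro ε hε
  have hfin : {t | ε / 2 ≤ ‖ξ.1 t‖}.Finite := by
    have := (Metric.tendsto_nhds.1 (tendsto ξ)) (ε / 2) (half_pos hε)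
    rw [eventually_cofinite] at this
    refine this.subset fun t ht => ?_
    simpa using ht
  refine ⟨∑ t ∈ hfin.toFinset, ofFibre s t (ξ.1 t), Submodule.sum_mem _ fun t _ => h₁ t _, ?_⟩
  rw [dist_eq_norm]
  refine lt_of_le_of_lt (norm_le (half_pos hε).le fun t => ?_) (half_lt_self hε)
  have hsum : (∑ t ∈ hfin.toFinset, ofFibre s t (ξ.1 t)).1 t =
      if t ∈ hfin.toFinset then ξ.1 t else 0 := by
    rw [Submodule.coe_sum, lp.coeFn_sum, Finset.sum_apply]
    split_ifs with h
    · rw [Finset.sum_eq_single t]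
      · exact lp.single_apply_self _ _ _
      · exact fun t' _ ht' => lp.single_apply_ne _ _ _ ht'.symm
      · exact fun h' => absurd h h'
    · refine Finset.sum_eq_zero fun t' ht' => lp.single_apply_ne _ _ _ ?_
      rintro rfl
      exact h ht'
  have : (ξ - ∑ t ∈ hfin.toFinset, ofFibre s t (ξ.1 t)).1 t =
      ξ.1 t - (∑ t ∈ hfin.toFinset, ofFibre s t (ξ.1 t)).1 t := rfl
  rw [this, hsum]
  split_ifs with h
  · simpa using (half_pos hε).le
  · rw [sub_zero]
    simp only [Set.Finite.mem_toFinset, Set.mem_ofPred_eq, not_le] at h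
    exact h.le

/-- The finitely supported functions in the Hilbert module. -/
noncomputable def ofFinsupp [TopologicalSpace X] [DiscreteTopology X] (s : X → T) :
    quasiCont X →ₗ[ℂ] HilbMod s := quasiCont.lift (delta s)

theorem val_ofFinsupp [TopologicalSpace X] [DiscreteTopology X] (f : quasiCont X) (p : X) :
    val (ofFinsupp s f) p = f.1 p := by
  classical
  let φ : HilbMod s →ₗ[ℂ] ℂ := ⟨⟨fun ξ => val ξ p, fun _ _ => rfl⟩, fun _ _ => rfl⟩
  let ψ : quasiCont X →ₗ[ℂ] ℂ := LinearMap.proj p ∘ₗ (quasiCont X).subtype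
  suffices h : φ ∘ₗ ofFinsupp s = ψ from LinearMap.congr_fun h f
  refine quasiCont.hom_ext fun q => ?_
  change val (ofFinsupp s (quasiCont.single q)) p = (quasiCont.single q).1 p
  rw [ofFinsupp, quasiCont.lift_single, val_delta, quasiCont.single_apply]

theorem denseRange_ofFinsupp [TopologicalSpace X] [DiscreteTopology X] (s : X → T) :
    DenseRange (ofFinsupp s) := by
  have h := quasiCont.range_eq_span (ofFinsupp s)
  have h' : (fun x => ofFinsupp s (quasiCont.single x)) = delta s :=
    funext fun x => quasiCont.lift_single _ x
  rw [h'] at h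
  have := dense_span_delta s
  rw [← h] at this
  exact this

end delta

section corr

variable {X S T : Type u} [TopologicalSpace S] [DiscreteTopology S] [TopologicalSpace T]
  [DiscreteTopology T]

open Classical in
/-- The characteristic function of a point, as a function vanishing at infinity. -/
noncomputable def c0Single (t : T) : C₀(T, ℂ) :=
  c0Mk (fun t' => if t' = t then 1 else 0) (tendsto_cofinite_of_finite_support
    ((Set.finite_singleton t).subset fun t' ht' => by
      by_contra h
      exact ht' (if_neg h)))

theorem lsmulHom_c0Single_delta (r : X → S) (s : X → T) (p : X) :
    lsmulHom r s (c0Single (r p)) (delta s p) = delta s p := by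
  classical
  refine ext fun q => ?_
  rw [val_lsmulHom, val_delta]
  split_ifs with h
  · rw [h, mul_one]
    exact if_pos rfl
  · rw [mul_zero]

/-- The C⋆-correspondence of a span of discrete sets. -/
noncomputable def corr (r : X → S) (s : X → T) : CStarCorr C₀(S, ℂ) C₀(T, ℂ) where
  carrier := HilbMod s
  rsmul := rsmulHom s
  rsmul_mul ξ b c := ext fun p => by
    simp only [val_rsmulHom]
    change b (s p) * c (s p) * val ξ p = c (s p) * (b (s p) * val ξ p)
    ring
  inner := innerC0
  inner_add := innerC0_add
  inner_smul := innerC0_smul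
  inner_rsmul := innerC0_rsmulHom
  star_inner := star_innerC0
  inner_self_nonneg ξ := ⟨absC0 ξ, innerC0_self ξ⟩
  norm_sq := norm_sq_eq
  lsmul := lsmulHom r s
  lsmul_mul a b ξ := ext fun p => by
    simp only [val_lsmulHom]
    exact mul_assoc _ _ _
  inner_lsmul := innerC0_lsmulHom r
  nondegenerate := (dense_span_delta s).mono (Submodule.span_mono (by
    rintro _ ⟨p, rfl⟩
    exact ⟨_, _, (lsmulHom_c0Single_delta r s p).symm⟩))

end corr

end HilbMod

namespace HilbMod

section norm

variable {X T : Type u} {s : X → T}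

theorem fibre_hasSum_norm_sq {t : T} (v : FibreL2 s t) :
    HasSum (fun p => ‖v p‖ ^ 2) (‖v‖ ^ 2) := by
  have h := lp.hasSum_norm (p := 2) (by simp) v
  simpa using h

theorem hasSum_norm_sq (ξ : HilbMod s) (t : T) :
    HasSum (fun p : {p // s p = t} => ‖val ξ p.1‖ ^ 2) (‖ξ.1 t‖ ^ 2) := by
  have h := fibre_hasSum_norm_sq (ξ.1 t)
  simpa only [val_eq] using h

theorem norm_val_le (ξ : HilbMod s) (p : X) : ‖val ξ p‖ ≤ ‖ξ.1 (s p)‖ :=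
  lp.norm_apply_le_norm (by simp) (ξ.1 (s p)) ⟨p, rfl⟩

end norm

section mul

variable {X Y Z T U : Type u} {s : X → T} {r' : Y → T} {s' : Y → U} {s'' : Z → U}

/-- The fibres of the source map of a composite of spans. -/
noncomputable def fibreEquiv (m : (x : X) → (y : Y) → s x = r' y → Z)
    (hm : Function.Bijective fun p : {p : X × Y // s p.1 = r' p.2} => m p.1.1 p.1.2 p.2)
    (hs : ∀ x y e, s'' (m x y e) = s' y) (u : U) :
    (Σ y : {y // s' y = u}, {x // s x = r' y.1}) ≃ {z // s'' z = u} :=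
  Equiv.ofBijective (fun w => ⟨m w.2.1 w.1.1 w.2.2, (hs _ _ _).trans w.1.2⟩) (by
    constructor
    · rintro ⟨⟨y, hy⟩, ⟨x, hx⟩⟩ ⟨⟨y₁, hy₁⟩, ⟨x₁, hx₁⟩⟩ h
      have h' := hm.1 (a₁ := ⟨(x, y), hx⟩) (a₂ := ⟨(x₁, y₁), hx₁⟩) (congrArg Subtype.val h)
      obtain rfl : x = x₁ := congrArg (fun p => p.1.1) h'
      obtain rfl : y = y₁ := congrArg (fun p => p.1.2) h'
      rfl
    · rintro ⟨z, hz⟩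
      obtain ⟨⟨⟨x, y⟩, e⟩, rfl⟩ := hm.2 z
      exact ⟨⟨⟨y, (hs _ _ _).symm.trans hz⟩, ⟨x, e⟩⟩, rfl⟩)

theorem summable_mul_norm_sq (ξ : HilbMod s) (η : HilbMod s') (u : U) :
    Summable fun w : (Σ y : {y // s' y = u}, {x // s x = r' y.1}) =>
      ‖val ξ w.2.1 * val η w.1.1‖ ^ 2 := by
  rw [summable_sigma_of_nonneg fun _ => by positivity]
  simp only [norm_mul, mul_pow]
  refine ⟨fun y => (hasSum_norm_sq ξ (r' y.1)).summable.mul_right _, ?_⟩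
  simp only [tsum_mul_right, (hasSum_norm_sq ξ _).tsum_eq]
  refine Summable.of_nonneg_of_le (fun y => by positivity) (fun y => ?_)
    ((hasSum_norm_sq η u).summable.mul_left (‖ξ‖ ^ 2))
  gcongr
  exact norm_apply_le ξ _

theorem tsum_mul_norm_sq_le (ξ : HilbMod s) (η : HilbMod s') (u : U) :
    ∑' w : (Σ y : {y // s' y = u}, {x // s x = r' y.1}), ‖val ξ w.2.1 * val η w.1.1‖ ^ 2 ≤
      (‖ξ‖ * ‖η.1 u‖) ^ 2 := by
  have h := summable_mul_norm_sq (r' := r') ξ η u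
  rw [h.tsum_sigma' fun y => h.sigma_factor y]
  simp only [norm_mul, mul_pow, tsum_mul_right, (hasSum_norm_sq ξ _).tsum_eq]
  rw [← (hasSum_norm_sq η u).tsum_eq, ← tsum_mul_left]
  refine Summable.tsum_le_tsum (fun y => ?_) ?_ ((hasSum_norm_sq η u).summable.mul_left _)
  · gcongr
    exact norm_apply_le ξ _
  · refine Summable.of_nonneg_of_le (fun y => by positivity) (fun y => ?_)
      ((hasSum_norm_sq η u).summable.mul_left (‖ξ‖ ^ 2))
    gcongr
    exact norm_apply_le ξ _

variable (m : (x : X) → (y : Y) → s x = r' y → Z)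
  (hm : Function.Bijective fun p : {p : X × Y // s p.1 = r' p.2} => m p.1.1 p.1.2 p.2)
  (hs : ∀ x y e, s'' (m x y e) = s' y)

/-- The restriction of a product to a fibre. -/
noncomputable def mulFibre (ξ : HilbMod s) (η : HilbMod s') (u : U) : FibreL2 s'' u :=
  ⟨fun z => val ξ ((fibreEquiv m hm hs u).symm z).2.1 * val η ((fibreEquiv m hm hs u).symm z).1.1,
    memℓp_gen (by
      have h := (fibreEquiv m hm hs u).symm.summable_iff.2 (summable_mul_norm_sq ξ η u)
      simpa [Function.comp_def] using h)⟩

theorem norm_mulFibre_le (ξ : HilbMod s) (η : HilbMod s') (u : U) :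
    ‖mulFibre m hm hs ξ η u‖ ≤ ‖ξ‖ * ‖η.1 u‖ := by
  refine le_of_sq_le_sq ?_ (by positivity)
  rw [← (fibre_hasSum_norm_sq (mulFibre m hm hs ξ η u)).tsum_eq]
  exact ((fibreEquiv m hm hs u).symm.tsum_eq fun w => ‖val ξ w.2.1 * val η w.1.1‖ ^ 2).trans_le
    (tsum_mul_norm_sq_le ξ η u)

/-- The product of elements of the Hilbert modules of two composable spans. -/
noncomputable def mul (ξ : HilbMod s) (η : HilbMod s') : HilbMod s'' :=
  mk (mulFibre m hm hs ξ η) (by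
    refine squeeze_zero (fun u => norm_nonneg _) (norm_mulFibre_le m hm hs ξ η) ?_
    simpa using (tendsto η).const_mul ‖ξ‖)

theorem val_mul (ξ : HilbMod s) (η : HilbMod s') (x : X) (y : Y) (e : s x = r' y) :
    val (mul m hm hs ξ η) (m x y e) = val ξ x * val η y := by
  have h := val_eq (mul m hm hs ξ η) (t := s' y) ⟨m x y e, hs x y e⟩
  rw [← h]
  have h' : (fibreEquiv m hm hs (s' y)).symm ⟨m x y e, hs x y e⟩ = ⟨⟨y, rfl⟩, ⟨x, e⟩⟩ := by
    rw [Equiv.symm_apply_eq]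
    rfl
  change val ξ ((fibreEquiv m hm hs (s' y)).symm ⟨m x y e, hs x y e⟩).2.1 *
    val η ((fibreEquiv m hm hs (s' y)).symm ⟨m x y e, hs x y e⟩).1.1 = _
  rw [h']

theorem ext_mul {m : (x : X) → (y : Y) → s x = r' y → Z}
    (hm : Function.Bijective fun p : {p : X × Y // s p.1 = r' p.2} => m p.1.1 p.1.2 p.2)
    {ξ η : HilbMod s''} (h : ∀ x y e, val ξ (m x y e) = val η (m x y e)) : ξ = η :=
  ext fun z => by
    obtain ⟨⟨⟨x, y⟩, e⟩, rfl⟩ := hm.2 z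
    exact h x y e

/-- The product as a bilinear map. -/
noncomputable def mulHom : HilbMod s →ₗ[ℂ] HilbMod s' →ₗ[ℂ] HilbMod s'' :=
  LinearMap.mk₂ ℂ (mul m hm hs)
    (fun _ _ _ => ext_mul hm fun _ _ _ => by simp only [val_mul, val_add, add_mul])
    (fun _ _ _ => ext_mul hm fun _ _ _ => by simp only [val_mul, val_smul, mul_assoc])
    (fun _ _ _ => ext_mul hm fun _ _ _ => by simp only [val_mul, val_add, mul_add])
    (fun _ _ _ => ext_mul hm fun _ _ _ => by simp only [val_mul, val_smul, mul_left_comm])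

theorem val_mulHom (ξ : HilbMod s) (η : HilbMod s') (x : X) (y : Y) (e : s x = r' y) :
    val (mulHom m hm hs ξ η) (m x y e) = val ξ x * val η y :=
  val_mul m hm hs ξ η x y e

theorem mulHom_delta (x : X) (y : Y) (e : s x = r' y) :
    mulHom m hm hs (delta s x) (delta s' y) = delta s'' (m x y e) := by
  classical
  refine ext_mul hm fun x' y' e' => ?_
  have h : m x' y' e' = m x y e ↔ x' = x ∧ y' = y := by
    constructor
    · intro h
      have h' := hm.1 (a₁ := ⟨(x', y'), e'⟩) (a₂ := ⟨(x, y), e⟩) h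
      exact ⟨congrArg (fun p => p.1.1) h', congrArg (fun p => p.1.2) h'⟩
    · rintro ⟨rfl, rfl⟩
      rfl
  rw [val_mulHom, val_delta, val_delta, val_delta]
  simp only [h]
  by_cases hx : x' = x <;> by_cases hy : y' = y <;> simp [hx, hy]

theorem dense_mulHom :
    Dense (Submodule.span ℂ {ζ | ∃ ξ η, ζ = mulHom m hm hs ξ η} : Set (HilbMod s'')) :=
  (dense_span_delta s'').mono (Submodule.span_mono (by
    rintro _ ⟨z, rfl⟩
    obtain ⟨⟨⟨x, y⟩, e⟩, rfl⟩ := hm.2 z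
    exact ⟨_, _, (mulHom_delta m hm hs x y e).symm⟩))

variable [TopologicalSpace T] [DiscreteTopology T] [TopologicalSpace U] [DiscreteTopology U]

theorem innerC0_mulHom (ξ ξ' : HilbMod s) (η η' : HilbMod s') :
    innerC0 (mulHom m hm hs ξ η) (mulHom m hm hs ξ' η') =
      innerC0 η (lsmulHom r' s' (innerC0 ξ ξ') η') := by
  ext u
  have hsum := (fibreEquiv m hm hs u).summable_iff.2
    (summable_inner (mulHom m hm hs ξ η) (mulHom m hm hs ξ' η') u)
  rw [innerC0_eq_tsum, innerC0_eq_tsum, ← (fibreEquiv m hm hs u).tsum_eq]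
  refine (hsum.tsum_sigma' fun y => hsum.sigma_factor y).trans (tsum_congr fun y => ?_)
  rw [val_lsmulHom, innerC0_eq_tsum, ← tsum_mul_right, ← tsum_mul_left]
  refine tsum_congr fun x => ?_
  change star (val _ (m x.1 y.1 x.2)) * val _ (m x.1 y.1 x.2) = _
  rw [val_mulHom, val_mulHom, star_mul']
  ring

theorem rsmulHom_mulHom (ξ : HilbMod s) (η : HilbMod s') (b : C₀(U, ℂ)) :
    rsmulHom s'' (mulHom m hm hs ξ η) b = mulHom m hm hs ξ (rsmulHom s' η b) :=
  ext_mul hm fun x y e => by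
    rw [val_rsmulHom, val_mulHom, val_mulHom, val_rsmulHom, hs, mul_left_comm]

theorem lsmulHom_mulHom {S : Type u} [TopologicalSpace S] (r : X → S) (r'' : Z → S)
    (hr : ∀ x y e, r'' (m x y e) = r x) (a : C₀(S, ℂ)) (ξ : HilbMod s) (η : HilbMod s') :
    lsmulHom r'' s'' a (mulHom m hm hs ξ η) = mulHom m hm hs (lsmulHom r s a ξ) η :=
  ext_mul hm fun x y e => by
    rw [val_lsmulHom, val_mulHom, val_mulHom, val_lsmulHom, hr, mul_assoc]

end mul

section one

variable {X T : Type u} [TopologicalSpace T] [DiscreteTopology T] {s : X → T} (e : T ≃ X)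
  (he : ∀ t, s (e t) = t)

open Classical in
/-- The identification of functions with elements of the Hilbert module of a bijection. -/
noncomputable def oneHom : C₀(T, ℂ) →ₗ[ℂ] HilbMod s where
  toFun a := mk (fun t => lp.single 2 ⟨e t, he t⟩ (a t)) (by
    have h : ∀ t, ‖(lp.single 2 ⟨e t, he t⟩ (a t) : FibreL2 s t)‖ = ‖a t‖ := fun t =>
      lp.norm_single (by simp) _ _
    simp only [h]
    simpa using (c0_tendsto a).norm)
  map_add' a b := Subtype.ext (lp.ext (funext fun t => lp.single_add _ _ _ _))
  map_smul' c a := Subtype.ext (lp.ext (funext fun t =>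
    lp.single_smul (E := fun _ : {p // s p = t} => ℂ) 2 ⟨e t, he t⟩ c (a t)))

theorem val_oneHom (a : C₀(T, ℂ)) (t : T) : val (oneHom e he a) (e t) = a t := by
  classical
  have h := val_eq (oneHom e he a) (t := t) ⟨e t, he t⟩
  rw [← h]
  exact lp.single_apply_self _ _ _

theorem oneHom_surjective : Function.Surjective (oneHom e he) := fun ξ =>
  ⟨c0Mk (fun t => val ξ (e t)) (by
    rw [tendsto_zero_iff_norm_tendsto_zero]
    refine squeeze_zero (fun t => norm_nonneg _) (fun t => ?_) (tendsto ξ)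
    have := norm_val_le ξ (e t)
    rwa [he] at this), ext fun p => by
    obtain ⟨t, rfl⟩ := e.surjective p
    exact val_oneHom e he _ t⟩

theorem innerC0_oneHom (a b : C₀(T, ℂ)) :
    innerC0 (oneHom e he a) (oneHom e he b) = star a * b := by
  ext t
  rw [innerC0_eq_tsum, tsum_eq_single ⟨e t, he t⟩]
  · rw [val_oneHom, val_oneHom]
    rfl
  · rintro ⟨p, hp⟩ h
    obtain ⟨t', rfl⟩ := e.surjective p
    exact absurd (Subtype.ext (congrArg e ((he t').symm.trans hp))) h

theorem rsmulHom_oneHom (a b : C₀(T, ℂ)) :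
    rsmulHom s (oneHom e he a) b = oneHom e he (a * b) := ext fun p => by
  obtain ⟨t, rfl⟩ := e.surjective p
  rw [val_rsmulHom, val_oneHom, val_oneHom, he, mul_comm]
  rfl

theorem lsmulHom_oneHom (r : X → T) (hr : ∀ t, r (e t) = t) (a b : C₀(T, ℂ)) :
    lsmulHom r s a (oneHom e he b) = oneHom e he (a * b) := ext fun p => by
  obtain ⟨t, rfl⟩ := e.surjective p
  rw [val_lsmulHom, val_oneHom, val_oneHom, hr]
  rfl

end one

end HilbMod

namespace GrHom

variable {C : Type u} [SmallCategory C] {H : GrHom C}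

theorem IsDiscrete.σ_bijective (hH : H.IsDiscrete) {x y z : C} (f : x ⟶ y) (g : y ⟶ z) :
    Function.Bijective fun p : {p : (H.X g).carrier × (H.X f).carrier //
      (H.X g).s p.1 = (H.X f).r p.2} => (H.σ f g).toHomeo (compMk p.1.1 p.1.2 p.2) := by
  constructor
  · rintro ⟨⟨a, b⟩, e⟩ ⟨⟨a', b'⟩, e'⟩ h
    obtain ⟨rfl, rfl⟩ := hH.σ_inj h
    rfl
  · intro c
    obtain ⟨a, b, e, h⟩ := H.exists_σ f g c
    exact ⟨⟨(a, b), e⟩, h⟩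

/-- The elements of the correspondence of an identity arrow. -/
def IsDiscrete.ιEquiv (hH : H.IsDiscrete) (x : C) : (H.G x).Obj ≃ (H.X (𝟙 x)).carrier :=
  (hH x).arrEquiv.symm.trans (H.ι x).toHomeo.toEquiv

theorem s_ι (x : C) (t : (H.G x).Obj) :
    (H.X (𝟙 x)).s ((H.ι x).toHomeo ((H.G x).unit t)) = t :=
  ((H.ι x).s_map _).trans ((H.G x).s_unit t)

theorem r_ι (x : C) (t : (H.G x).Obj) :
    (H.X (𝟙 x)).r ((H.ι x).toHomeo ((H.G x).unit t)) = t :=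
  ((H.ι x).r_map _).trans ((H.G x).r_unit t)

theorem heq_hilbMod {x y : C} {g g' : x ⟶ y} (hg : g = g') {ξ : HilbMod (H.X g).s}
    {η : HilbMod (H.X g').s} (h : ∀ p p', HEq p p' → HilbMod.val ξ p = HilbMod.val η p') :
    HEq ξ η := by
  subst hg
  exact heq_of_eq (HilbMod.ext fun p => h p p HEq.rfl)

open HilbMod in
/-- The product system of a discrete homomorphism. -/
noncomputable def productSystem (hH : H.IsDiscrete) : ProductSystem C :=
  haveI := fun x => (hH x).1
  { A := fun x => C₀((H.G x).Obj, ℂ)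
    E := fun g => HilbMod.corr (H.X g).r (H.X g).s
    mul := fun f g => mulHom (fun a b e => (H.σ f g).toHomeo (compMk a b e)) (hH.σ_bijective f g)
      (s_σ f g)
    inner_mul := fun f g ξ ξ' η η' => innerC0_mulHom _ _ _ ξ ξ' η η'
    dense_mul := fun f g => dense_mulHom _ _ _
    lsmul_mul := fun f g a ξ η => lsmulHom_mulHom _ _ _ _ _ (r_σ f g) a ξ η
    rsmul_mul := fun f g ξ η b => rsmulHom_mulHom _ _ _ ξ η b
    one := fun x => oneHom (hH.ιEquiv x) (s_ι x)
    one_surjective := fun x => oneHom_surjective _ _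
    inner_one := fun x a b => innerC0_oneHom _ _ a b
    lsmul_one := fun x a b => lsmulHom_oneHom _ _ _ (r_ι x) a b
    rsmul_one := fun x a b => rsmulHom_oneHom _ _ a b
    mul_assoc := fun {w x y z} f g h ξ η ζ => by
      refine heq_hilbMod (Category.assoc f g h) fun p p' hp => ?_
      obtain ⟨a, d, e, rfl⟩ := H.exists_σ (f ≫ g) h p
      obtain ⟨b, c, e₂, rfl⟩ := H.exists_σ f g d
      have e₁ : (H.X h).s a = (H.X g).r b := e.trans (r_σ _ _ _ _ _)
      have e₄ : (H.X (g ≫ h)).s ((H.σ g h).toHomeo (compMk a b e₁)) = (H.X f).r c :=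
        (s_σ _ _ _ _ _).trans e₂
      obtain rfl := eq_of_heq (hp.symm.trans (H.assoc f g h a b c e₁ e₂ e e₄))
      refine (val_mulHom (fun a b e => (H.σ (f ≫ g) h).toHomeo (compMk a b e)) _ _ _ _ a _ e).trans
        (Eq.trans ?_ (val_mulHom (fun a b e => (H.σ f (g ≫ h)).toHomeo (compMk a b e)) _ _ _ _
          _ c e₄).symm)
      refine (congrArg (val ξ a * ·) (val_mulHom (fun a b e => (H.σ f g).toHomeo (compMk a b e))
        _ _ _ _ b c e₂)).trans (Eq.trans ?_ (congrArg (· * val ζ c)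
          (val_mulHom (fun a b e => (H.σ g h).toHomeo (compMk a b e)) _ _ _ _ a b e₁).symm))
      exact (_root_.mul_assoc _ _ _).symm
    one_mul := fun {x y} g a ξ => by
      refine heq_hilbMod (Category.comp_id g) fun p p' hp => ?_
      obtain ⟨d, b, e, rfl⟩ := H.exists_σ g (𝟙 y) p
      obtain ⟨t, rfl⟩ := (hH.ιEquiv y).surjective d
      have ht : t = (H.X g).r b := (s_ι y t).symm.trans e
      have h := H.unit_left g ((H.G y).unit t) b (((H.G y).s_unit t).trans ht) e
      rw [(H.X g).lact_eq_self (hH y)] at h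
      obtain rfl := eq_of_heq (hp.symm.trans h)
      refine (val_mulHom (fun a b e => (H.σ g (𝟙 y)).toHomeo (compMk a b e)) _ _ _ _ _ p'
        e).trans ?_
      refine Eq.trans ?_ (val_lsmulHom _ _ _ _).symm
      exact (congrArg (· * val ξ p') (val_oneHom (hH.ιEquiv y) (s_ι y) a t)).trans
        (congrArg (fun t => a t * val ξ p') ht)
    mul_one := fun {x y} g ξ a => by
      refine heq_hilbMod (Category.id_comp g) fun p p' hp => ?_
      obtain ⟨b, d, e, rfl⟩ := H.exists_σ (𝟙 x) g p
      obtain ⟨t, rfl⟩ := (hH.ιEquiv x).surjective d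
      have ht : (H.X g).s b = t := e.trans (r_ι x t)
      have h := H.unit_right g b ((H.G x).unit t) (ht.trans ((H.G x).r_unit t).symm) e
      rw [(H.X g).ract_eq_self (hH x)] at h
      obtain rfl := eq_of_heq (hp.symm.trans h)
      refine (val_mulHom (fun a b e => (H.σ (𝟙 x) g).toHomeo (compMk a b e)) _ _ _ _ p' _
        e).trans ?_
      refine Eq.trans ?_ (val_rsmulHom _ _ _).symm
      exact (congrArg (val ξ p' * ·) (val_oneHom (hH.ιEquiv x) (s_ι x) a t)).trans
        ((_root_.mul_comm _ _).trans (congrArg (fun t => a t * val ξ p') ht.symm)) }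

end GrHom

namespace EtGroupoid.IsDiscreteSet

variable {G : EtGroupoid.{u}}

theorem finsum_r_eq (hG : G.IsDiscreteSet) {t : G.Obj} (f : {h : G.Arr // G.r h = t} → ℂ) :
    ∑ᶠ h, f h = f ⟨G.unit t, G.r_unit t⟩ := by
  let : Unique {h : G.Arr // G.r h = t} :=
    ⟨⟨⟨G.unit t, G.r_unit t⟩⟩, fun h => Subtype.ext ((hG.eq_unit_r h.1).trans (by rw [h.2]; rfl))⟩
  exact finsum_unique f

theorem conv_eq (hG : G.IsDiscreteSet) (ξ η : G.Arr → ℂ) (g : G.Arr) :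
    ∑ᶠ h : {h : G.Arr // G.r h = G.r g},
      ξ h.1 * η (G.mul (G.inv h.1) g ((G.s_inv _).trans h.2)) = ξ g * η g := by
  refine (hG.finsum_r_eq _).trans ?_
  rw [hG.mul_eq_right]
  exact congrArg (fun h => ξ h * η g) (hG.eq_unit_r g).symm

theorem isStarRep_iff (hG : G.IsDiscreteSet) {A : Type u} [NonUnitalCStarAlgebra A]
    (ρ : quasiCont G.Arr →ₗ[ℂ] A) : G.IsStarRep ρ ↔
      (∀ ξ η ζ : quasiCont G.Arr, (∀ g, ζ.1 g = ξ.1 g * η.1 g) → ρ ζ = ρ ξ * ρ η) ∧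
      ∀ ξ ζ : quasiCont G.Arr, (∀ g, ζ.1 g = star (ξ.1 g)) → ρ ζ = star (ρ ξ) := by
  constructor
  · intro h
    refine ⟨fun ξ η ζ hζ => h.map_conv ξ η ζ fun g => ?_, fun ξ ζ hζ => h.map_star ξ ζ fun g => ?_⟩
    · rw [hG.conv_eq, hζ]
    · rw [hG.inv_eq, hζ]
  · rintro ⟨h₁, h₂⟩
    refine ⟨fun ξ η ζ hζ => h₁ ξ η ζ fun g => ?_, fun ξ ζ hζ => h₂ ξ ζ fun g => ?_⟩
    · rw [hζ, hG.conv_eq]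
    · rw [hζ, hG.inv_eq]

/-- Every ⋆-representation of the functions on a discrete set is contractive for the supremum
norm. -/
theorem norm_le_of_isStarRep (hG : G.IsDiscreteSet) {B : Type u} [NonUnitalCStarAlgebra B]
    {τ : quasiCont G.Arr →ₗ[ℂ] B} (hτ : G.IsStarRep τ) (ξ : quasiCont G.Arr) {c : ℝ} (hc : 0 ≤ c)
    (hξ : ∀ g, ‖ξ.1 g‖ ≤ c) : ‖τ ξ‖ ≤ c := by
  classical
  have := hG.discreteTopology_arr
  obtain ⟨hmul, hstar⟩ := (hG.isStarRep_iff τ).1 hτ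
  let := CStarAlgebra.spectralOrder B
  let := CStarAlgebra.spectralOrderedRing B
  have hmem : ∀ f : G.Arr → ℂ, (∀ g, ξ.1 g = 0 → f g = 0) → f ∈ quasiCont G.Arr := fun f hf =>
    quasiCont.mem_of_finite_support ((quasiCont.finite_support ξ).subset fun g hg h => hg (hf g h))
  let e : quasiCont G.Arr := ⟨fun g => if ξ.1 g = 0 then 0 else 1, hmem _ fun g hg => if_pos hg⟩
  let a : quasiCont G.Arr := ⟨fun g => star (ξ.1 g), hmem _ fun g hg => by simp [hg]⟩
  let b : quasiCont G.Arr := ⟨fun g => star (ξ.1 g) * ξ.1 g, hmem _ fun g hg => by simp [hg]⟩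
  let d : quasiCont G.Arr := ⟨fun g => if ξ.1 g = 0 then 0 else (√(c ^ 2 - ‖ξ.1 g‖ ^ 2) : ℝ),
    hmem _ fun g hg => if_pos hg⟩
  have he : IsStarProjection (τ e) := by
    refine ⟨(hmul e e e fun g => ?_).symm, (hstar e e fun g => ?_).symm⟩
    · by_cases h : ξ.1 g = 0 <;> simp [e, h]
    · by_cases h : ξ.1 g = 0 <;> simp [e, h]
  have ha : τ a = star (τ ξ) := hstar ξ a fun g => rfl
  have hb : τ b = star (τ ξ) * τ ξ := by rw [← ha]; exact hmul a ξ b fun g => rfl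
  have hd : star (τ d) * τ d = (c ^ 2 : ℂ) • τ e - τ b := by
    rw [← hstar d d fun g => ?_, ← map_smul, ← map_sub]
    · refine (hmul d d _ fun g => ?_).symm
      by_cases h : ξ.1 g = 0
      · simp [e, b, d, h]
      · have h0 : 0 ≤ c ^ 2 - ‖ξ.1 g‖ ^ 2 := sub_nonneg.2 (by gcongr; exact hξ g)
        simp only [e, b, d, h, Submodule.coe_sub, Submodule.coe_smul, Pi.sub_apply, Pi.smul_apply,
          if_false]
        rw [← Complex.ofReal_mul, Real.mul_self_sqrt h0]
        simp only [smul_eq_mul, mul_one, Complex.star_def, Complex.ofReal_sub, Complex.ofReal_pow]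
        rw [mul_comm (starRingEnd ℂ _), Complex.mul_conj, Complex.normSq_eq_norm_sq]
        simp
    · by_cases h : ξ.1 g = 0 <;> simp [d, h]
  have hle : star (τ ξ) * τ ξ ≤ (c ^ 2 : ℂ) • τ e := by
    rw [← hb, ← sub_nonneg, ← hd]
    exact star_mul_self_nonneg _
  have h := CStarAlgebra.norm_le_norm_of_nonneg_of_le (star_mul_self_nonneg _) hle
  rw [CStarRing.norm_star_mul_self, norm_smul] at h
  have h1 : ‖τ e‖ ≤ 1 := he.norm_le_one
  have h2 : ‖(c ^ 2 : ℂ)‖ = c ^ 2 := by simp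
  rw [h2] at h
  refine abs_le_of_sq_le_sq' ?_ hc |>.2
  nlinarith [norm_nonneg (τ e), sq_nonneg c]

/-- The restriction of a function to the units. -/
noncomputable def toC0 (hG : G.IsDiscreteSet) : quasiCont G.Arr →ₗ[ℂ] C₀(G.Obj, ℂ) :=
  haveI := hG.1
  haveI := hG.discreteTopology_arr
  { toFun := fun ξ => c0Mk (fun t => ξ.1 (G.unit t)) (tendsto_cofinite_of_finite_support
      ((quasiCont.finite_support ξ).preimage (Function.LeftInverse.injective G.r_unit).injOn))
    map_add' := fun _ _ => rfl
    map_smul' := fun _ _ => rfl }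

theorem toC0_apply (hG : G.IsDiscreteSet) (ξ : quasiCont G.Arr) (t : G.Obj) :
    hG.toC0 ξ t = ξ.1 (G.unit t) := rfl

theorem isCStar_toC0 (hG : G.IsDiscreteSet) : G.IsCStar hG.toC0 := by
  have := hG.1
  have := hG.discreteTopology_arr
  refine ⟨(hG.isStarRep_iff _).2 ⟨fun ξ η ζ h => ?_, fun ξ ζ h => ?_⟩, fun a => ?_,
    fun τ hτ ξ => hG.norm_le_of_isStarRep hτ ξ (norm_nonneg _) fun g => ?_⟩
  · ext t
    exact h _
  · ext t
    exact h _
  · rw [Metric.mem_closure_iff]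
    intro ε hε
    have hfin : {t | ε / 2 ≤ ‖a t‖}.Finite := by
      have := (Metric.tendsto_nhds.1 (c0_tendsto a)) (ε / 2) (half_pos hε)
      rw [eventually_cofinite] at this
      refine this.subset fun t ht => ?_
      simpa using ht
    classical
    let ξ : quasiCont G.Arr := ⟨fun g => if ε / 2 ≤ ‖a (G.s g)‖ then a (G.s g) else 0,
      quasiCont.mem_of_finite_support (by
        refine (hfin.image G.unit).subset fun g hg => ⟨G.s g, ?_, (hG.eq_unit_s g).symm⟩
        by_contra h
        exact hg (if_neg h))⟩
    refine ⟨_, ⟨ξ, rfl⟩, ?_⟩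
    rw [dist_eq_norm]
    refine lt_of_le_of_lt (c0_norm_le _ (half_pos hε).le fun t => ?_) (half_lt_self hε)
    change ‖a t - (if ε / 2 ≤ ‖a (G.s (G.unit t))‖ then a (G.s (G.unit t)) else 0)‖ ≤ ε / 2
    rw [G.s_unit]
    split_ifs with h
    · simpa using (half_pos hε).le
    · rw [sub_zero]
      exact (not_le.1 h).le
  · have h := c0_norm_apply_le (hG.toC0 ξ) (G.s g)
    rwa [hG.toC0_apply, ← hG.eq_unit_s] at h

end EtGroupoid.IsDiscreteSet

namespace GrHom

variable {C : Type u} [SmallCategory C] {H : GrHom C}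

theorem IsDiscrete.conv_ract (hH : H.IsDiscrete) {x y : C} (g : x ⟶ y)
    (ξ : (H.X g).carrier → ℂ) (γ : (H.G x).Arr → ℂ) (p : (H.X g).carrier) :
    ∑ᶠ a : {a : (H.G x).Arr // (H.G x).r a = (H.X g).s p},
      ξ ((H.X g).ract p a.1 a.2.symm) * γ ((H.G x).inv a.1) =
      ξ p * γ ((H.G x).unit ((H.X g).s p)) := by
  refine ((hH x).finsum_r_eq _).trans ?_
  rw [(H.X g).ract_eq_self (hH x), (hH x).inv_eq]

theorem IsDiscrete.conv_lact (hH : H.IsDiscrete) {x y : C} (g : x ⟶ y)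
    (ξ : (H.X g).carrier → ℂ) (γ : (H.G y).Arr → ℂ) (p : (H.X g).carrier) :
    ∑ᶠ a : {a : (H.G y).Arr // (H.G y).r a = (H.X g).r p},
      γ a.1 * ξ ((H.X g).lact ((H.G y).inv a.1) p (((H.G y).s_inv _).trans a.2)) =
      γ ((H.G y).unit ((H.X g).r p)) * ξ p := by
  refine ((hH y).finsum_r_eq _).trans ?_
  rw [(H.X g).lact_eq_self (hH y)]

theorem IsDiscrete.conv_σ (hH : H.IsDiscrete) {x y z : C} (f : x ⟶ y) (g : y ⟶ z)
    (ξ : (H.X g).carrier → ℂ) (η : (H.X f).carrier → ℂ) (p : (H.X g).carrier)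
    (q : (H.X f).carrier) (e : (H.X g).s p = (H.X f).r q) :
    ∑ᶠ k : {k : (H.G y).Arr // (H.G y).r k = (H.X g).s p},
        ξ ((H.X g).ract p k.1 k.2.symm) *
          η ((H.X f).lact ((H.G y).inv k.1) q (((H.G y).s_inv _).trans (k.2.trans e))) =
      ξ p * η q := by
  refine ((hH y).finsum_r_eq _).trans ?_
  rw [(H.X g).ract_eq_self (hH y), (H.X f).lact_eq_self (hH y)]

theorem IsDiscrete.conv_inner (hH : H.IsDiscrete) {x y : C} (g : x ⟶ y)
    (ξ η : (H.X g).carrier → ℂ) (a : (H.G x).Arr) :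
    ∑ᶠ p : {p : (H.X g).carrier // (H.X g).s p = (H.G x).r a},
      star (ξ p.1) * η ((H.X g).ract p.1 a p.2) =
    ∑ᶠ p : {p : (H.X g).carrier // (H.X g).s p = (H.G x).r a}, star (ξ p.1) * η p.1 :=
  finsum_congr fun p => by rw [(H.X g).ract_eq_self (hH x)]

/-- The product system of a discrete homomorphism is a model. -/
noncomputable def cstarModel (hH : H.IsDiscrete) : H.CStarModel (productSystem hH) :=
  haveI := fun x => (hH x).1
  haveI := fun x => (hH x).discreteTopology_arr
  haveI := fun {x y : C} (g : x ⟶ y) => hH.discreteTopology g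
  { toA := fun x => (hH x).toC0
    isCStar := fun x => (hH x).isCStar_toC0
    toE := fun g => HilbMod.ofFinsupp (H.X g).s
    denseRange := fun g => HilbMod.denseRange_ofFinsupp _
    inner := fun {x y} g ξ η γ h => by
      have key : HilbMod.innerC0 (HilbMod.ofFinsupp (H.X g).s ξ) (HilbMod.ofFinsupp (H.X g).s η) =
          (hH x).toC0 γ := by
        ext t
        rw [HilbMod.innerC0_eq_tsum, EtGroupoid.IsDiscreteSet.toC0_apply, h, hH.conv_inner,
          (H.G x).r_unit]
        simp only [HilbMod.val_ofFinsupp]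
        refine tsum_eq_finsum (((quasiCont.finite_support ξ).preimage
          Subtype.val_injective.injOn).subset fun p hp h' => hp ?_)
        have h' : ξ.1 p.1 = 0 := h'
        simp [h']
      exact key
    rsmul := fun {x y} g ξ ζ γ h => by
      have key : HilbMod.rsmulHom (H.X g).s (HilbMod.ofFinsupp (H.X g).s ξ) ((hH x).toC0 γ) =
          HilbMod.ofFinsupp (H.X g).s ζ := HilbMod.ext fun p => by
        rw [HilbMod.val_rsmulHom, HilbMod.val_ofFinsupp, HilbMod.val_ofFinsupp, h, hH.conv_ract,
          mul_comm, EtGroupoid.IsDiscreteSet.toC0_apply]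
      exact key
    lsmul := fun {x y} g ξ ζ γ h => by
      have key : HilbMod.lsmulHom (H.X g).r (H.X g).s ((hH y).toC0 γ)
          (HilbMod.ofFinsupp (H.X g).s ξ) = HilbMod.ofFinsupp (H.X g).s ζ := HilbMod.ext fun p => by
        rw [HilbMod.val_lsmulHom, HilbMod.val_ofFinsupp, HilbMod.val_ofFinsupp, h, hH.conv_lact,
          EtGroupoid.IsDiscreteSet.toC0_apply]
      exact key
    mul := fun {x y z} f g ξ η ζ h => by
      have key : HilbMod.mulHom (fun a b e => (H.σ f g).toHomeo (compMk a b e))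
          (hH.σ_bijective f g) (s_σ f g) (HilbMod.ofFinsupp (H.X g).s ξ)
          (HilbMod.ofFinsupp (H.X f).s η) = HilbMod.ofFinsupp (H.X (f ≫ g)).s ζ :=
        HilbMod.ext_mul (hH.σ_bijective f g) fun p q e => by
          refine (HilbMod.val_mulHom _ _ _ _ _ p q e).trans ?_
          rw [HilbMod.val_ofFinsupp, HilbMod.val_ofFinsupp, HilbMod.val_ofFinsupp, h, hH.conv_σ]
          exact e
      exact key
    one := fun x γ ζ h => by
      have key : HilbMod.oneHom (hH.ιEquiv x) (s_ι x) ((hH x).toC0 γ) =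
          HilbMod.ofFinsupp (H.X (𝟙 x)).s ζ := HilbMod.ext fun p => by
        obtain ⟨t, rfl⟩ := (hH.ιEquiv x).surjective p
        refine (HilbMod.val_oneHom (hH.ιEquiv x) (s_ι x) _ t).trans ?_
        rw [HilbMod.val_ofFinsupp]
        exact (h _).symm
      exact key }

end GrHom

/-! ## Hilbert modules -/

namespace CStarCorr

variable {A B : Type u} [NonUnitalCStarAlgebra A] [NonUnitalCStarAlgebra B] (E : CStarCorr A B)

theorem add_inner (ξ η ζ : E.carrier) : E.inner (ξ + η) ζ = E.inner ξ ζ + E.inner η ζ := by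
  rw [← E.star_inner ζ, E.inner_add, star_add, E.star_inner, E.star_inner]

theorem smul_inner (c : ℂ) (ξ η : E.carrier) : E.inner (c • ξ) η = star c • E.inner ξ η := by
  rw [← E.star_inner η, E.inner_smul, star_smul, E.star_inner]

theorem rsmul_inner (ξ η : E.carrier) (b : B) : E.inner (E.rsmul ξ b) η = star b * E.inner ξ η := by
  rw [← E.star_inner η, E.inner_rsmul, star_mul, E.star_inner]

/-- The inner product as a linear map in the second variable. -/
def innerHom (ξ : E.carrier) : E.carrier →ₗ[ℂ] B where
  toFun := E.inner ξ
  map_add' := E.inner_add ξ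
  map_smul' c η := E.inner_smul c ξ η

theorem innerHom_apply (ξ η : E.carrier) : E.innerHom ξ η = E.inner ξ η := rfl

theorem norm_rsmul_le (ξ : E.carrier) (b : B) : ‖E.rsmul ξ b‖ ≤ ‖ξ‖ * ‖b‖ := by
  refine le_of_sq_le_sq ?_ (by positivity)
  rw [E.norm_sq, E.inner_rsmul, E.rsmul_inner, mul_pow, E.norm_sq ξ]
  calc ‖star b * E.inner ξ ξ * b‖ ≤ ‖star b‖ * ‖E.inner ξ ξ‖ * ‖b‖ :=
        (norm_mul_le _ _).trans (by gcongr; exact norm_mul_le _ _)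
    _ = _ := by rw [norm_star]; ring

/-- The Cauchy–Schwarz inequality. -/
theorem norm_inner_le (ξ η : E.carrier) : ‖E.inner ξ η‖ ≤ ‖ξ‖ * ‖η‖ := by
  let := CStarAlgebra.spectralOrder B
  have := CStarAlgebra.spectralOrderedRing B
  rcases eq_or_ne ξ 0 with rfl | hξ
  · have : E.inner 0 η = 0 := by simpa using E.smul_inner 0 0 η
    simp [this]
  set b := E.inner ξ η with hb
  have hb' : star b = E.inner η ξ := E.star_inner ξ η
  set c : ℝ := ‖ξ‖ ^ 2 with hc
  have hc0 : 0 < c := by positivity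
  have h₁ : 0 ≤ E.inner (E.rsmul ξ b + (-(c : ℂ)) • η) (E.rsmul ξ b + (-(c : ℂ)) • η) := by
    obtain ⟨d, hd⟩ := E.inner_self_nonneg (E.rsmul ξ b + (-(c : ℂ)) • η)
    rw [hd]
    exact star_mul_self_nonneg d
  have h₂ : E.inner (E.rsmul ξ b + (-(c : ℂ)) • η) (E.rsmul ξ b + (-(c : ℂ)) • η) =
      star b * E.inner ξ ξ * b - (2 * c) • (star b * b) + (c * c) • E.inner η η := by
    simp only [E.inner_add, E.add_inner, E.inner_smul, E.smul_inner, E.inner_rsmul, E.rsmul_inner,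
      ← hb, ← hb']
    have : star (-(c : ℂ)) = -(c : ℂ) := by simp
    rw [this]
    have h : ∀ (x : ℝ) (y : B), x • y = (x : ℂ) • y := fun x y => (Complex.coe_smul x y).symm
    rw [h, h]
    push_cast
    module
  have h₃ : star b * E.inner ξ ξ * b ≤ c • (star b * b) := by
    rw [hc, E.norm_sq]
    exact CStarAlgebra.star_left_conjugate_le_norm_smul (hb := E.star_inner ξ ξ)
  have h₄ : 0 ≤ c • (c • E.inner η η - star b * b) := by
    rw [h₂] at h₁
    refine h₁.trans ?_
    have : c • (c • E.inner η η - star b * b) =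
      c • (star b * b) - (2 * c) • (star b * b) + (c * c) • E.inner η η := by module
    rw [this]
    gcongr
  have h₅ : star b * b ≤ c • E.inner η η := by
    rw [← sub_nonneg]
    have := smul_nonneg (inv_nonneg.2 hc0.le) h₄
    rwa [smul_smul, inv_mul_cancel₀ hc0.ne', one_smul] at this
  have h₆ := CStarAlgebra.norm_le_norm_of_nonneg_of_le (star_mul_self_nonneg _) h₅
  rw [CStarRing.norm_star_mul_self, norm_smul, ← E.norm_sq, Real.norm_of_nonneg hc0.le, hc] at h₆
  refine le_of_sq_le_sq ?_ (by positivity)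
  linarith [mul_pow ‖ξ‖ ‖η‖ 2]

/-- The rank-one operator `|ξ⟩⟨η|`. -/
noncomputable def rankOne (ξ η : E.carrier) : E.carrier →L[ℂ] E.carrier :=
  (E.rsmul ξ ∘ₗ E.innerHom η).mkContinuous (‖ξ‖ * ‖η‖) fun ζ =>
    (E.norm_rsmul_le ξ _).trans (by
      rw [mul_assoc]
      gcongr
      exact E.norm_inner_le η ζ)

theorem rankOne_apply (ξ η ζ : E.carrier) : E.rankOne ξ η ζ = E.rsmul ξ (E.inner η ζ) := rfl

theorem isRankOne_rankOne (ξ η : E.carrier) : E.IsRankOne ξ η (E.rankOne ξ η) := fun _ => rfl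

theorem IsRankOne.eq {E : CStarCorr A B} {ξ η : E.carrier} {T : E.carrier →L[ℂ] E.carrier}
    (h : E.IsRankOne ξ η T) : T = E.rankOne ξ η :=
  ContinuousLinearMap.ext h

theorem rankOne_mem_compacts (ξ η : E.carrier) : E.rankOne ξ η ∈ E.compacts :=
  Submodule.le_topologicalClosure _ (Submodule.subset_span ⟨ξ, η, E.isRankOne_rankOne ξ η⟩)

theorem inner_rankOne (ξ η ζ ζ' : E.carrier) :
    E.inner (E.rankOne ξ η ζ) ζ' = E.inner ζ (E.rankOne η ξ ζ') := by
  rw [rankOne_apply, rankOne_apply, rsmul_inner, inner_rsmul, star_inner]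

theorem norm_adjoint_le {T T' : E.carrier →L[ℂ] E.carrier}
    (h : ∀ ζ ζ', E.inner (T ζ) ζ' = E.inner ζ (T' ζ')) : ‖T'‖ ≤ ‖T‖ := by
  refine T'.opNorm_le_bound (norm_nonneg _) fun ζ => ?_
  have h₁ : ‖T' ζ‖ ^ 2 ≤ ‖T‖ * ‖T' ζ‖ * ‖ζ‖ := by
    rw [E.norm_sq, ← h]
    exact (E.norm_inner_le _ _).trans (by gcongr; exact T.le_opNorm _)
  rcases (norm_nonneg (T' ζ)).eq_or_lt with h₀ | h₀
  · rw [← h₀]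
    positivity
  · nlinarith

end CStarCorr

theorem le_of_forall_pow_two_pow_le {a b c : ℝ} (hb : 0 ≤ b)
    (h : ∀ m : ℕ, a ^ 2 ^ m ≤ c * b ^ 2 ^ m) : a ≤ b := by
  by_contra! hab
  rcases hb.eq_or_lt with rfl | hb
  · have := h 0
    simp only [pow_zero, pow_one, mul_zero] at this
    exact absurd this (not_le.2 hab)
  have h₁ : 1 < a / b := (one_lt_div hb).2 hab
  have h₂ : Tendsto (fun m : ℕ => (a / b) ^ 2 ^ m) atTop atTop :=
    (tendsto_pow_atTop_atTop_of_one_lt h₁).comp (tendsto_pow_atTop_atTop_of_one_lt one_lt_two)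
  obtain ⟨m, hm⟩ := (h₂.eventually_gt_atTop c).exists
  rw [div_pow, lt_div_iff₀ (by positivity)] at hm
  exact absurd (h m) (not_le.2 hm)

/-! ## The map on compact operators induced by a representation of a Hilbert module -/

namespace CStarCorr

variable {A B D : Type u} [NonUnitalCStarAlgebra A] [NonUnitalCStarAlgebra B]
  [NonUnitalCStarAlgebra D] {E : CStarCorr A B} {π : B →⋆ₙₐ[ℂ] D} {t : E.carrier →ₗ[ℂ] D}

theorem norm_rep_le (hi : ∀ ξ η, star (t ξ) * t η = π (E.inner ξ η)) (ξ : E.carrier) :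
    ‖t ξ‖ ≤ ‖ξ‖ := by
  refine le_of_sq_le_sq ?_ (norm_nonneg _)
  rw [sq, ← CStarRing.norm_star_mul_self, hi, E.norm_sq]
  exact NonUnitalStarAlgHom.norm_apply_le π _

/-- The graph of the map `|ξ⟩⟨η| ↦ t(ξ) t(η)^*` on operators of finite rank. -/
def finiteRankGraph (t : E.carrier →ₗ[ℂ] D) : Submodule ℂ ((E.carrier →L[ℂ] E.carrier) × D) :=
  Submodule.span ℂ (Set.range fun p : E.carrier × E.carrier =>
    (E.rankOne p.1 p.2, t p.1 * star (t p.2)))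

theorem finiteRankGraph_mul (hi : ∀ ξ η, star (t ξ) * t η = π (E.inner ξ η))
    (hr : ∀ ξ b, t (E.rsmul ξ b) = t ξ * π b) {v : (E.carrier →L[ℂ] E.carrier) × D}
    (hv : v ∈ finiteRankGraph t) (ζ : E.carrier) : v.2 * t ζ = t (v.1 ζ) := by
  induction hv using Submodule.span_induction with
  | mem v hv =>
    obtain ⟨⟨ξ, η⟩, rfl⟩ := hv
    change t ξ * star (t η) * t ζ = t (E.rsmul ξ (E.inner η ζ))
    rw [hr, ← hi, mul_assoc]
  | zero => simp
  | add v w _ _ hv hw => simp [add_mul, hv, hw]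
  | smul c v _ hv => simp [smul_mul_assoc, hv]

theorem finiteRankGraph_star {v : (E.carrier →L[ℂ] E.carrier) × D} (hv : v ∈ finiteRankGraph t) :
    ∃ T', (T', star v.2) ∈ finiteRankGraph t ∧
      ∀ ζ ζ', E.inner (v.1 ζ) ζ' = E.inner ζ (T' ζ') := by
  induction hv using Submodule.span_induction with
  | mem v hv =>
    obtain ⟨⟨ξ, η⟩, rfl⟩ := hv
    exact ⟨E.rankOne η ξ, Submodule.subset_span ⟨(η, ξ), by simp⟩, E.inner_rankOne ξ η⟩
  | zero =>
    refine ⟨0, by rw [Prod.snd_zero, star_zero]; exact zero_mem _, fun ζ ζ' => ?_⟩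
    have h₁ := E.smul_inner 0 0 ζ'
    have h₂ := E.inner_smul 0 ζ 0
    simp only [zero_smul, star_zero] at h₁ h₂
    exact h₁.trans h₂.symm
  | add v w _ _ hv hw =>
    obtain ⟨T₁, h₁, h₁'⟩ := hv
    obtain ⟨T₂, h₂, h₂'⟩ := hw
    refine ⟨T₁ + T₂, by simpa using add_mem h₁ h₂, fun ζ ζ' => ?_⟩
    simp only [Prod.fst_add, add_apply, E.add_inner, E.inner_add, h₁', h₂']
  | smul c v _ hv =>
    obtain ⟨T₁, h₁, h₁'⟩ := hv
    refine ⟨star c • T₁, by simpa using Submodule.smul_mem _ (star c) h₁, fun ζ ζ' => ?_⟩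
    simp only [Prod.smul_fst, smul_apply, E.smul_inner, E.inner_smul, h₁']

theorem exists_norm_mul_le (ht : ∀ ξ, ‖t ξ‖ ≤ ‖ξ‖) {v : (E.carrier →L[ℂ] E.carrier) × D}
    (hv : v ∈ finiteRankGraph t) :
    ∃ c : ℝ, ∀ (S : E.carrier →L[ℂ] E.carrier) (h : D), (∀ ζ, h * t ζ = t (S ζ)) →
      ‖h * v.2‖ ≤ c * ‖S‖ := by
  induction hv using Submodule.span_induction with
  | mem v hv =>
    obtain ⟨⟨ξ, η⟩, rfl⟩ := hv
    refine ⟨‖ξ‖ * ‖η‖, fun S h hS => ?_⟩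
    change ‖h * (t ξ * star (t η))‖ ≤ _
    rw [← mul_assoc, hS]
    calc ‖t (S ξ) * star (t η)‖ ≤ ‖t (S ξ)‖ * ‖star (t η)‖ := norm_mul_le _ _
      _ ≤ (‖S‖ * ‖ξ‖) * ‖η‖ := by
        rw [norm_star]
        gcongr
        · exact (ht _).trans (S.le_opNorm ξ)
        · exact ht η
      _ = _ := by ring
  | zero => exact ⟨0, fun S h _ => by simp⟩
  | add v w _ _ hv hw =>
    obtain ⟨c, hc⟩ := hv
    obtain ⟨d, hd⟩ := hw
    refine ⟨c + d, fun S h hS => ?_⟩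
    rw [Prod.snd_add, mul_add, add_mul]
    exact (norm_add_le _ _).trans (add_le_add (hc S h hS) (hd S h hS))
  | smul z v _ hv =>
    obtain ⟨c, hc⟩ := hv
    refine ⟨‖z‖ * c, fun S h hS => ?_⟩
    rw [Prod.smul_snd, mul_smul_comm, norm_smul, mul_assoc]
    gcongr
    exact hc S h hS

theorem norm_le_of_mem_finiteRankGraph (hi : ∀ ξ η, star (t ξ) * t η = π (E.inner ξ η))
    (hr : ∀ ξ b, t (E.rsmul ξ b) = t ξ * π b) {v : (E.carrier →L[ℂ] E.carrier) × D}
    (hv : v ∈ finiteRankGraph t) : ‖v.2‖ ≤ ‖v.1‖ := by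
  obtain ⟨T', hT', hadj⟩ := finiteRankGraph_star hv
  obtain ⟨c, hc⟩ := exists_norm_mul_le (norm_rep_le hi) hv
  obtain ⟨T, k⟩ := v
  dsimp only at *
  let sq (m : ℕ) : (E.carrier →L[ℂ] E.carrier) × D :=
    Nat.rec (T * T', k * star k) (fun _ w => w * w) m
  have sq_succ : ∀ m, sq (m + 1) = sq m * sq m := fun _ => rfl
  have h_mul : ∀ m ζ, (sq m).2 * t ζ = t ((sq m).1 ζ) := by
    intro m
    induction m with
    | zero =>
      intro ζ
      change k * star k * t ζ = t (T (T' ζ))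
      rw [mul_assoc, finiteRankGraph_mul hi hr hT', finiteRankGraph_mul hi hr hv]
    | succ m ih =>
      intro ζ
      rw [sq_succ, Prod.snd_mul, mul_assoc, ih, ih]
      rfl
  have h_star : ∀ m, star (sq m).2 = (sq m).2 := by
    intro m
    induction m with
    | zero => exact (star_mul _ _).trans (by rw [star_star]; rfl)
    | succ m ih => rw [sq_succ, Prod.snd_mul, star_mul, ih]
  have h_comm : ∀ m, (sq m).2 * (k * star k) = k * star k * (sq m).2 := by
    intro m
    induction m with
    | zero => rfl
    | succ m ih => rw [sq_succ, Prod.snd_mul, mul_assoc, ih, ← mul_assoc, ih, mul_assoc]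
  have h_norm : ∀ m, ‖(sq m).1‖ ≤ ‖T * T'‖ ^ 2 ^ m := by
    intro m
    induction m with
    | zero => simp [sq]
    | succ m ih =>
      rw [sq_succ, Prod.fst_mul, pow_succ, pow_mul, pow_two]
      exact (norm_mul_le _ _).trans (mul_le_mul ih ih (norm_nonneg _) (by positivity))
  rcases (norm_nonneg k).eq_or_lt with h₀ | h₀
  · rw [← h₀]
    exact norm_nonneg _
  have h_step : ∀ m, (‖(sq m).2 * k‖ / ‖k‖) ^ 2 ≤ ‖(sq (m + 1)).2 * k‖ / ‖k‖ := by
    intro m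
    have h : ‖(sq m).2 * k‖ ^ 2 ≤ ‖(sq (m + 1)).2 * k‖ * ‖k‖ := by
      rw [pow_two, ← CStarRing.norm_self_mul_star, star_mul, h_star]
      have : (sq m).2 * k * (star k * (sq m).2) = (sq (m + 1)).2 * k * star k := by
        calc (sq m).2 * k * (star k * (sq m).2) = (sq m).2 * (k * star k * (sq m).2) := by
              simp only [mul_assoc]
          _ = (sq (m + 1)).2 * k * star k := by
              rw [← h_comm, sq_succ, Prod.snd_mul]
              simp only [mul_assoc]
      rw [this]
      exact (norm_mul_le _ _).trans_eq (by rw [norm_star])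
    rw [div_pow, div_le_div_iff₀ (by positivity) h₀]
    nlinarith
  have h_pow : ∀ m, (‖(sq 0).2 * k‖ / ‖k‖) ^ 2 ^ m ≤ ‖(sq m).2 * k‖ / ‖k‖ := by
    intro m
    induction m with
    | zero => simp
    | succ m ih =>
      rw [pow_succ, pow_mul]
      exact (pow_le_pow_left₀ (by positivity) ih 2).trans (h_step m)
  have h_le : ‖(sq 0).2 * k‖ / ‖k‖ ≤ ‖T * T'‖ := by
    refine le_of_forall_pow_two_pow_le (c := |c| / ‖k‖) (norm_nonneg _) fun m => ?_
    refine (h_pow m).trans ?_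
    rw [div_mul_eq_mul_div]
    gcongr
    refine (hc _ _ (h_mul m)).trans ?_
    exact mul_le_mul (le_abs_self c) (h_norm m) (norm_nonneg _) (abs_nonneg c)
  have h_cube : ‖k‖ ^ 2 ≤ ‖(sq 0).2 * k‖ / ‖k‖ := by
    rw [le_div_iff₀ h₀]
    have h₁ : ‖k * star k * (k * star k)‖ = ‖k‖ ^ 4 := by
      have : ‖k * star k * star (k * star k)‖ = ‖k‖ ^ 4 := by
        rw [CStarRing.norm_self_mul_star, CStarRing.norm_self_mul_star]
        ring
      rwa [star_mul, star_star] at this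
    have h₂ : ‖k‖ ^ 4 ≤ ‖(sq 0).2 * k‖ * ‖k‖ := by
      rw [← h₁, ← mul_assoc, ← norm_star k]
      exact norm_mul_le _ _
    nlinarith
  have h_TT : ‖T * T'‖ ≤ ‖T‖ * ‖T‖ :=
    (norm_mul_le _ _).trans (by gcongr; exact E.norm_adjoint_le hadj)
  refine le_of_sq_le_sq ?_ (norm_nonneg _)
  linarith [h_cube.trans (h_le.trans h_TT), pow_two ‖T‖]

theorem exists_map_compacts (hi : ∀ ξ η, star (t ξ) * t η = π (E.inner ξ η))
    (hr : ∀ ξ b, t (E.rsmul ξ b) = t ξ * π b) :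
    ∃ ψ : E.compacts →L[ℂ] D, ∀ ξ η (T : E.compacts), E.IsRankOne ξ η T.1 →
      ψ T = t ξ * star (t η) := by
  have h_mem : ∀ v ∈ finiteRankGraph t,
      v.1 ∈ Submodule.span ℂ {T | ∃ ξ η, E.IsRankOne ξ η T} := by
    intro v hv
    induction hv using Submodule.span_induction with
    | mem v hv =>
      obtain ⟨⟨ξ, η⟩, rfl⟩ := hv
      exact Submodule.subset_span ⟨ξ, η, E.isRankOne_rankOne ξ η⟩
    | zero => exact zero_mem _
    | add v w _ _ hv hw => exact add_mem hv hw
    | smul c v _ hv => exact Submodule.smul_mem _ c hv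
  let e : finiteRankGraph t →ₗ[ℂ] E.compacts :=
    LinearMap.codRestrict _ (LinearMap.fst ℂ _ _ ∘ₗ (finiteRankGraph t).subtype) fun v =>
      Submodule.le_topologicalClosure _ (h_mem v.1 v.2)
  let f : finiteRankGraph t →ₗ[ℂ] D := LinearMap.snd ℂ _ _ ∘ₗ (finiteRankGraph t).subtype
  have hd : DenseRange e := by
    change Dense _
    rw [Subtype.dense_iff]
    intro T hT
    refine closure_mono ?_ hT
    intro S hS
    have : ∃ k, (S, k) ∈ finiteRankGraph t := by
      induction hS using Submodule.span_induction with
      | mem S hS =>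
        obtain ⟨ξ, η, h⟩ := hS
        exact ⟨_, Submodule.subset_span ⟨(ξ, η), by rw [h.eq]⟩⟩
      | zero => exact ⟨0, zero_mem _⟩
      | add S S' _ _ h h' =>
        obtain ⟨k, hk⟩ := h
        obtain ⟨k', hk'⟩ := h'
        exact ⟨k + k', add_mem hk hk'⟩
      | smul c S _ h =>
        obtain ⟨k, hk⟩ := h
        exact ⟨c • k, Submodule.smul_mem _ c hk⟩
    obtain ⟨k, hk⟩ := this
    exact ⟨e ⟨_, hk⟩, ⟨_, rfl⟩, rfl⟩
  have : IsBoundedSMul ℂ E.compacts :=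
    NormedSpace.toIsBoundedSMul (𝕜 := ℂ) (E := E.compacts)
  refine ⟨f.extendOfNorm e, fun ξ η T hT => ?_⟩
  let v : finiteRankGraph t := ⟨_, Submodule.subset_span ⟨(ξ, η), rfl⟩⟩
  have hv : T = e v := Subtype.ext hT.eq
  rw [hv]
  exact LinearMap.extendOfNorm_eq hd
    ⟨1, fun v => (norm_le_of_mem_finiteRankGraph hi hr v.2).trans_eq (one_mul _).symm⟩ v

end CStarCorr

namespace quasiCont

variable {X : Type u} [TopologicalSpace X] [DiscreteTopology X]

/-- Pointwise multiplication by a function. -/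
noncomputable def mulBy (w : X → ℂ) : quasiCont X →ₗ[ℂ] quasiCont X := lift fun p => w p • single p

theorem mulBy_single (w : X → ℂ) (p : X) : mulBy w (single p) = w p • single p := lift_single _ p

theorem hermitian_ext {D : Type*} [NonUnitalCStarAlgebra D]
    {f g : quasiCont X → quasiCont X →ₗ[ℂ] D} (hf : ∀ ξ η, star (f ξ η) = f η ξ)
    (hg : ∀ ξ η, star (g ξ η) = g η ξ)
    (h : ∀ p q, f (single p) (single q) = g (single p) (single q)) (ξ η : quasiCont X) :
    f ξ η = g ξ η := by
  have h₁ : ∀ p, f (single p) = g (single p) := fun p => hom_ext (h p)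
  have h₂ : f ξ = g ξ := hom_ext fun q => by rw [← hf, ← hg, h₁]
  rw [h₂]

end quasiCont

namespace GrHom.CStarModel

variable {C : Type u} [SmallCategory C] {H : GrHom C} {P : ProductSystem C}

section

variable (M : H.CStarModel P) (hH : H.IsDiscrete)

/-- The element of the coefficient algebra given by a point. -/
noncomputable def ptA (x : C) (t : (H.G x).Obj) : P.A x :=
  haveI := (hH x).discreteTopology_arr
  M.toA x (quasiCont.single ((H.G x).unit t))

/-- The element of the correspondence given by a point. -/
noncomputable def ptE {x y : C} (g : x ⟶ y) (p : (H.X g).carrier) : (P.E g).carrier :=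
  haveI := hH.discreteTopology g
  M.toE g (quasiCont.single p)

theorem unit_inj {G : EtGroupoid.{u}} {t t' : G.Obj} : G.unit t = G.unit t' ↔ t = t' :=
  ⟨fun h => by rw [← G.s_unit t, h, G.s_unit], congrArg _⟩

theorem star_ptA (x : C) (t : (H.G x).Obj) : star (M.ptA hH x t) = M.ptA hH x t := by
  have := (hH x).discreteTopology_arr
  refine (((hH x).isStarRep_iff _).1 (M.isCStar x).isStarRep).2 _ _ (fun g => ?_) |>.symm
  rw [quasiCont.single_apply]
  split_ifs <;> simp

theorem ptA_mul_self (x : C) (t : (H.G x).Obj) :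
    M.ptA hH x t * M.ptA hH x t = M.ptA hH x t := by
  have := (hH x).discreteTopology_arr
  refine (((hH x).isStarRep_iff _).1 (M.isCStar x).isStarRep).1 _ _ _ (fun g => ?_) |>.symm
  rw [quasiCont.single_apply]
  split_ifs <;> simp

theorem ptA_mul_of_ne (x : C) {t t' : (H.G x).Obj} (h : t ≠ t') :
    M.ptA hH x t * M.ptA hH x t' = 0 := by
  have := (hH x).discreteTopology_arr
  rw [← map_zero (M.toA x)]
  refine (((hH x).isStarRep_iff _).1 (M.isCStar x).isStarRep).1 _ _ _ (fun g => ?_) |>.symm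
  rw [quasiCont.single_apply, quasiCont.single_apply]
  split_ifs with h₁ h₂
  · exact absurd (unit_inj.1 (h₁.symm.trans h₂)) h
  all_goals simp

theorem inner_ptE_self {x y : C} (g : x ⟶ y) (p : (H.X g).carrier) :
    (P.E g).inner (M.ptE hH g p) (M.ptE hH g p) = M.ptA hH x ((H.X g).s p) := by
  have := (hH x).discreteTopology_arr
  have := hH.discreteTopology g
  refine M.inner g _ _ _ fun a => ?_
  rw [hH.conv_inner]
  simp only [quasiCont.single_apply]
  split_ifs with h
  · rw [finsum_eq_single _ ⟨p, by rw [h, (H.G x).r_unit]⟩]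
    · simp
    · intro q hq
      rw [if_neg fun h' => hq (Subtype.ext h')]
      simp
  · refine (finsum_eq_zero_of_forall_eq_zero fun q => ?_).symm
    rw [if_neg, mul_zero]
    intro h'
    refine h ?_
    rw [← h', q.2, ← (hH x).eq_unit_r]

theorem inner_ptE_of_ne {x y : C} (g : x ⟶ y) {p q : (H.X g).carrier} (h : p ≠ q) :
    (P.E g).inner (M.ptE hH g p) (M.ptE hH g q) = 0 := by
  have := hH.discreteTopology g
  rw [← map_zero (M.toA x)]
  refine M.inner g _ _ _ fun a => ?_
  rw [hH.conv_inner]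
  refine (finsum_eq_zero_of_forall_eq_zero fun q' => ?_).symm
  rw [quasiCont.single_apply, quasiCont.single_apply]
  split_ifs with h₁ h₂
  · exact absurd (h₁.symm.trans h₂) h
  all_goals simp

theorem rsmul_ptE {x y : C} (g : x ⟶ y) (p : (H.X g).carrier) :
    (P.E g).rsmul (M.ptE hH g p) (M.ptA hH x ((H.X g).s p)) = M.ptE hH g p := by
  have := (hH x).discreteTopology_arr
  have := hH.discreteTopology g
  refine M.rsmul g _ _ _ fun q => ?_
  rw [hH.conv_ract, quasiCont.single_apply, quasiCont.single_apply]
  by_cases h : q = p <;> simp [h]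

theorem lsmul_ptE {x y : C} (g : x ⟶ y) (p : (H.X g).carrier) :
    (P.E g).lsmul (M.ptA hH y ((H.X g).r p)) (M.ptE hH g p) = M.ptE hH g p := by
  have := (hH y).discreteTopology_arr
  have := hH.discreteTopology g
  refine M.lsmul g _ _ _ fun q => ?_
  rw [hH.conv_lact, quasiCont.single_apply, quasiCont.single_apply]
  by_cases h : q = p <;> simp [h]

theorem lsmul_ptE_of_ne {x y : C} (g : x ⟶ y) {p : (H.X g).carrier} {t : (H.G y).Obj}
    (h : (H.X g).r p ≠ t) : (P.E g).lsmul (M.ptA hH y t) (M.ptE hH g p) = 0 := by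
  rw [← M.lsmul_ptE hH, ← (P.E g).lsmul_mul, M.ptA_mul_of_ne hH y h.symm]
  simp

theorem mul_ptE {x y z : C} (f : x ⟶ y) (g : y ⟶ z) (p : (H.X g).carrier) (q : (H.X f).carrier)
    (e : (H.X g).s p = (H.X f).r q) :
    P.mul f g (M.ptE hH g p) (M.ptE hH f q) =
      M.ptE hH (f ≫ g) ((H.σ f g).toHomeo (compMk p q e)) := by
  have := hH.discreteTopology f
  have := hH.discreteTopology g
  have := hH.discreteTopology (f ≫ g)
  refine M.mul f g _ _ _ fun p' q' e' => ?_
  rw [hH.conv_σ f g _ _ p' q' e', quasiCont.single_apply, quasiCont.single_apply,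
    quasiCont.single_apply]
  by_cases h : p' = p ∧ q' = q
  · obtain ⟨rfl, rfl⟩ := h
    simp
  · rw [if_neg fun h' => h (hH.σ_inj h')]
    by_cases hp : p' = p
    · rw [if_neg fun hq => h ⟨hp, hq⟩, mul_zero]
    · rw [if_neg hp, zero_mul]

theorem one_ptA (x : C) (t : (H.G x).Obj) :
    P.one x (M.ptA hH x t) = M.ptE hH (𝟙 x) ((H.ι x).toHomeo ((H.G x).unit t)) := by
  have := (hH x).discreteTopology_arr
  have := hH.discreteTopology (𝟙 x)
  refine M.one x _ _ fun a => ?_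
  have h : (H.ι x).toHomeo a = (H.ι x).toHomeo ((H.G x).unit t) ↔ a = (H.G x).unit t :=
    (H.ι x).toHomeo.injective.eq_iff
  classical
  refine (quasiCont.single_apply _ _).trans
    (Eq.trans ?_ (quasiCont.single_apply (X := (H.G x).Arr) _ a).symm)
  by_cases h' : a = (H.G x).unit t
  · exact (if_pos (h.2 h')).trans (if_pos h').symm
  · exact (if_neg fun h'' => h' (h.1 h'')).trans (if_neg h').symm

theorem dense_ptA (x : C) : Dense (Submodule.span ℂ (Set.range (M.ptA hH x)) : Set (P.A x)) := by
  have := (hH x).discreteTopology_arr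
  have h := quasiCont.range_eq_span (M.toA x)
  have h' : (Set.range fun g => M.toA x (quasiCont.single g)) = Set.range (M.ptA hH x) := by
    ext a
    constructor
    · rintro ⟨g, rfl⟩
      exact ⟨(H.G x).s g, congrArg (fun g => M.toA x (quasiCont.single g)) ((hH x).2 g).symm⟩
    · rintro ⟨t, rfl⟩
      exact ⟨_, rfl⟩
  rw [h'] at h
  rw [← h]
  exact (M.isCStar x).denseRange

theorem dense_ptE {x y : C} (g : x ⟶ y) :
    Dense (Submodule.span ℂ (Set.range (M.ptE hH g)) : Set (P.E g).carrier) := by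
  have := hH.discreteTopology g
  have h := quasiCont.range_eq_span (M.toE g)
  exact h ▸ M.denseRange g

theorem exists_mul_ptA (x : C) (a : P.A x) (t : (H.G x).Obj) :
    ∃ c : ℂ, a * M.ptA hH x t = c • M.ptA hH x t ∧ ‖c‖ ≤ ‖a‖ := by
  have h : ∃ c : ℂ, a * M.ptA hH x t = c • M.ptA hH x t := by
    let K : Submodule ℂ (P.A x) := Submodule.comap
      (LinearMap.mulRight ℂ (M.ptA hH x t)) (Submodule.span ℂ {M.ptA hH x t})
    have hK : IsClosed (K : Set (P.A x)) := by
      have h₁ : IsClosed (Submodule.span ℂ {M.ptA hH x t} : Set (P.A x)) :=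
        Submodule.closed_of_finiteDimensional _
      have h₂ : Continuous fun b : P.A x => b * M.ptA hH x t := by fun_prop
      exact h₁.preimage h₂
    have hle : Submodule.span ℂ (Set.range (M.ptA hH x)) ≤ K := by
      rw [Submodule.span_le]
      rintro _ ⟨t', rfl⟩
      change M.ptA hH x t' * M.ptA hH x t ∈ Submodule.span ℂ {M.ptA hH x t}
      by_cases h : t' = t
      · rw [h, M.ptA_mul_self]
        exact Submodule.mem_span_singleton_self _
      · rw [M.ptA_mul_of_ne hH x h]
        exact zero_mem _
    have ha : a ∈ K := hK.closure_subset_iff.2 hle (M.dense_ptA hH x a)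
    obtain ⟨c, hc⟩ := Submodule.mem_span_singleton.1 ha
    exact ⟨c, hc.symm⟩
  by_cases h₀ : M.ptA hH x t = 0
  · exact ⟨0, by simp [h₀], by simp⟩
  · obtain ⟨c, hc⟩ := h
    refine ⟨c, hc, ?_⟩
    have h₁ : ‖c‖ * ‖M.ptA hH x t‖ ≤ ‖a‖ * ‖M.ptA hH x t‖ := by
      rw [← norm_smul, ← hc]
      exact norm_mul_le _ _
    exact le_of_mul_le_mul_right h₁ (norm_pos_iff.2 h₀)

theorem lsmul_ptE_eq {x y : C} (g : x ⟶ y) (p : (H.X g).carrier) {a : P.A y} {c : ℂ}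
    (h : a * M.ptA hH y ((H.X g).r p) = c • M.ptA hH y ((H.X g).r p)) :
    (P.E g).lsmul a (M.ptE hH g p) = c • M.ptE hH g p := by
  conv_lhs => rw [← M.lsmul_ptE hH, ← (P.E g).lsmul_mul, h]
  rw [map_smul, smul_apply, M.lsmul_ptE]

end

theorem norm_lsmul_le (M : H.CStarModel P) (hH : H.IsDiscrete) {x y : C} (g : x ⟶ y) (a : P.A y) (ξ : (P.E g).carrier) :
    ‖(P.E g).lsmul a ξ‖ ≤ ‖a‖ * ‖ξ‖ := by
  have := hH.discreteTopology g
  choose c hc hca using M.exists_mul_ptA hH y a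
  let w (p : (H.X g).carrier) : ℂ := (√(‖a‖ ^ 2 - ‖c ((H.X g).r p)‖ ^ 2) : ℝ)
  have hl : ∀ f, (P.E g).lsmul a (M.toE g f) =
      M.toE g (quasiCont.mulBy (fun p => c ((H.X g).r p)) f) := by
    refine LinearMap.congr_fun (quasiCont.hom_ext
      (φ := ((P.E g).lsmul a).toLinearMap ∘ₗ M.toE g) (ψ := M.toE g ∘ₗ _) fun p => ?_)
    change (P.E g).lsmul a (M.ptE hH g p) = M.toE g (quasiCont.mulBy _ (quasiCont.single p))
    rw [quasiCont.mulBy_single, map_smul]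
    exact M.lsmul_ptE_eq hH g p (hc _)
  have hw : ∀ p, star (w p) * w p + star (c ((H.X g).r p)) * c ((H.X g).r p) = (‖a‖ : ℂ) ^ 2 := by
    intro p
    have h₀ : 0 ≤ ‖a‖ ^ 2 - ‖c ((H.X g).r p)‖ ^ 2 := sub_nonneg.2 (by gcongr; exact hca _)
    have h₁ : star (w p) * w p = ((‖a‖ ^ 2 - ‖c ((H.X g).r p)‖ ^ 2 : ℝ) : ℂ) := by
      rw [show star (w p) = w p from Complex.conj_ofReal _, ← Complex.ofReal_mul,
        Real.mul_self_sqrt h₀]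
    have h₂ : star (c ((H.X g).r p)) * c ((H.X g).r p) = ((‖c ((H.X g).r p)‖ ^ 2 : ℝ) : ℂ) := by
      rw [mul_comm, Complex.star_def, Complex.mul_conj, Complex.normSq_eq_norm_sq]
    rw [h₁, h₂]
    push_cast
    ring
  have key : ∀ ξ η : quasiCont (H.X g).carrier,
      (P.E g).inner (M.toE g (quasiCont.mulBy w ξ)) (M.toE g (quasiCont.mulBy w η)) +
        (P.E g).inner ((P.E g).lsmul a (M.toE g ξ)) ((P.E g).lsmul a (M.toE g η)) =
      (‖a‖ : ℂ) ^ 2 • (P.E g).inner (M.toE g ξ) (M.toE g η) := by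
    refine quasiCont.hermitian_ext
      (f := fun ξ => (P.E g).innerHom (M.toE g (quasiCont.mulBy w ξ)) ∘ₗ M.toE g ∘ₗ
        quasiCont.mulBy w + (P.E g).innerHom ((P.E g).lsmul a (M.toE g ξ)) ∘ₗ
          ((P.E g).lsmul a).toLinearMap ∘ₗ M.toE g)
      (g := fun ξ => (‖a‖ : ℂ) ^ 2 • (P.E g).innerHom (M.toE g ξ) ∘ₗ M.toE g)
      (fun ξ η => ?_) (fun ξ η => ?_) fun p q => ?_
    · exact (star_add _ _).trans (congrArg₂ (· + ·) ((P.E g).star_inner _ _)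
        ((P.E g).star_inner _ _))
    · refine (star_smul _ _).trans (congrArg₂ (· • ·) ?_ ((P.E g).star_inner _ _))
      simp
    · change (P.E g).inner (M.toE g (quasiCont.mulBy w (quasiCont.single p)))
        (M.toE g (quasiCont.mulBy w (quasiCont.single q))) +
        (P.E g).inner ((P.E g).lsmul a (M.ptE hH g p)) ((P.E g).lsmul a (M.ptE hH g q)) =
        (‖a‖ : ℂ) ^ 2 • (P.E g).inner (M.ptE hH g p) (M.ptE hH g q)
      rw [quasiCont.mulBy_single, quasiCont.mulBy_single, map_smul, map_smul,
        M.lsmul_ptE_eq hH g p (hc _), M.lsmul_ptE_eq hH g q (hc _)]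
      change (P.E g).inner (w p • M.ptE hH g p) (w q • M.ptE hH g q) + _ = _
      simp only [(P.E g).inner_smul, (P.E g).smul_inner, smul_smul]
      by_cases h : p = q
      · subst h
        rw [← add_smul, mul_comm (w p), mul_comm (c _), hw]
      · rw [M.inner_ptE_of_ne hH g h]
        simp
  refine (M.denseRange g).induction_on (p := fun ξ => ‖(P.E g).lsmul a ξ‖ ≤ ‖a‖ * ‖ξ‖) ξ
    (isClosed_le (by fun_prop) (by fun_prop)) fun f => ?_
  let := CStarAlgebra.spectralOrder (P.A x)
  have := CStarAlgebra.spectralOrderedRing (P.A x)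
  have hnn : ∀ ζ, 0 ≤ (P.E g).inner ζ ζ := fun ζ => by
    obtain ⟨d, hd⟩ := (P.E g).inner_self_nonneg ζ
    rw [hd]
    exact star_mul_self_nonneg d
  have hle := CStarAlgebra.norm_le_norm_of_nonneg_of_le (hnn _)
    ((le_add_of_nonneg_left (hnn _)).trans_eq (key f f))
  rw [← (P.E g).norm_sq, norm_smul, ← (P.E g).norm_sq] at hle
  refine le_of_sq_le_sq ?_ (by positivity)
  rw [mul_pow]
  simpa using hle

theorem norm_mul_le (M : H.CStarModel P) (hH : H.IsDiscrete) {x y z : C} (f : x ⟶ y)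
    (g : y ⟶ z) (ξ : (P.E g).carrier)
    (η : (P.E f).carrier) : ‖P.mul f g ξ η‖ ≤ ‖ξ‖ * ‖η‖ := by
  refine le_of_sq_le_sq ?_ (by positivity)
  rw [(P.E _).norm_sq, P.inner_mul]
  calc _ ≤ ‖η‖ * ‖(P.E f).lsmul ((P.E g).inner ξ ξ) η‖ := (P.E f).norm_inner_le _ _
    _ ≤ ‖η‖ * (‖(P.E g).inner ξ ξ‖ * ‖η‖) := by
      gcongr
      exact M.norm_lsmul_le hH f _ _
    _ = _ := by
      rw [← (P.E g).norm_sq]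
      ring

theorem lsmul_ptA (M : H.CStarModel P) (hH : H.IsDiscrete) {x y : C} (g : x ⟶ y) (t : (H.G y).Obj)
    (hfin : {p | (H.X g).r p = t}.Finite) :
    (P.E g).lsmul (M.ptA hH y t) =
      ∑ p ∈ hfin.toFinset, (P.E g).rankOne (M.ptE hH g p) (M.ptE hH g p) := by
  classical
  refine ContinuousLinearMap.ext_on (M.dense_ptE hH g) ?_
  rintro _ ⟨q, rfl⟩
  rw [sum_apply]
  simp only [CStarCorr.rankOne_apply]
  by_cases h : (H.X g).r q = t
  · subst h
    rw [M.lsmul_ptE, Finset.sum_eq_single q]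
    · rw [M.inner_ptE_self, M.rsmul_ptE]
    · intro p _ hp
      rw [M.inner_ptE_of_ne hH g hp, map_zero]
    · intro h
      simp at h
  · rw [M.lsmul_ptE_of_ne hH g h, Finset.sum_eq_zero]
    intro p hp
    rw [M.inner_ptE_of_ne hH g, map_zero]
    rintro rfl
    simp at hp
    exact h hp

/-- The left action as a continuous map. -/
noncomputable def lsmulL (M : H.CStarModel P) (hH : H.IsDiscrete) {x y : C} (g : x ⟶ y) :
    P.A y →L[ℂ] (P.E g).carrier →L[ℂ] (P.E g).carrier :=
  (P.E g).lsmul.mkContinuous 1 fun a => by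
    rw [one_mul]
    exact ContinuousLinearMap.opNorm_le_bound _ (norm_nonneg a) (M.norm_lsmul_le hH g a)

theorem isProper (M : H.CStarModel P) (hH : H.IsDiscrete)
    (hfin : ∀ {x y : C} (g : x ⟶ y) (t : (H.G y).Obj), {p | (H.X g).r p = t}.Finite) :
    P.IsProper := by
  intro x y g a
  have hK : IsClosed ((P.E g).compacts : Set ((P.E g).carrier →L[ℂ] (P.E g).carrier)) :=
    Submodule.isClosed_topologicalClosure _
  have hle : Submodule.span ℂ (Set.range (M.ptA hH y)) ≤
      (P.E g).compacts.comap (M.lsmulL hH g).toLinearMap := by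
    rw [Submodule.span_le]
    rintro _ ⟨t, rfl⟩
    change (P.E g).lsmul (M.ptA hH y t) ∈ (P.E g).compacts
    rw [M.lsmul_ptA hH g t (hfin g t)]
    exact Submodule.sum_mem _ fun p _ => (P.E g).rankOne_mem_compacts _ _
  exact (hK.preimage (M.lsmulL hH g).continuous).closure_subset_iff.2 hle (M.dense_ptA hH y a)

end GrHom.CStarModel

/-- A ⋆-homomorphism between C⋆-algebras as a continuous linear map. -/
noncomputable def NonUnitalStarAlgHom.toCLM {A B : Type*} [NonUnitalCStarAlgebra A]
    [NonUnitalCStarAlgebra B] (Φ : A →⋆ₙₐ[ℂ] B) : A →L[ℂ] B :=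
  ⟨{ toFun := Φ, map_add' := map_add Φ, map_smul' := map_smul Φ }, Φ.continuous_of_cstar⟩

theorem ContinuousLinearMap.eq_of_dense_span {V W ι : Type*} [NormedAddCommGroup V]
    [NormedSpace ℂ V] [NormedAddCommGroup W] [NormedSpace ℂ W] {v : ι → V}
    (hv : Dense (Submodule.span ℂ (Set.range v) : Set V)) {φ ψ : V →L[ℂ] W}
    (h : ∀ i, φ (v i) = ψ (v i)) (x : V) : φ x = ψ x := by
  have : φ = ψ := ContinuousLinearMap.ext_on hv (by rintro _ ⟨i, rfl⟩; exact h i)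
  rw [this]

namespace CStarCorr

variable {A B D : Type u} [NonUnitalCStarAlgebra A] [NonUnitalCStarAlgebra B]
  [NonUnitalCStarAlgebra D] {E : CStarCorr A B} {π : B →⋆ₙₐ[ℂ] D} {t : E.carrier →ₗ[ℂ] D}

theorem rep_rsmul (hi : ∀ ξ η, star (t ξ) * t η = π (E.inner ξ η)) (ξ : E.carrier) (b : B) :
    t (E.rsmul ξ b) = t ξ * π b := by
  rw [← sub_eq_zero, ← CStarRing.star_mul_self_eq_zero_iff, star_sub, sub_mul, mul_sub, mul_sub,
    star_mul, ← mul_assoc, hi, hi, mul_assoc (star (π b)) (star (t ξ)) (t (E.rsmul ξ b)), hi,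
    mul_assoc (star (π b)), ← mul_assoc (star (t ξ)), hi, E.inner_rsmul, E.inner_rsmul,
    E.rsmul_inner]
  simp only [map_mul, map_star, mul_assoc, sub_self]

end CStarCorr

/-- A family of projections and partial isometries indexed by the points of the discrete sets in a
discrete homomorphism, satisfying the Cuntz–Krieger relations. -/
structure GrHom.CKFamily {C : Type u} [SmallCategory C] (H : GrHom C) (B : Type u)
    [NonUnitalCStarAlgebra B] where
  P (x : C) : (H.G x).Obj → B
  S {x y : C} (g : x ⟶ y) : (H.X g).carrier → B
  isStarProjection : ∀ x t, IsStarProjection (P x t)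
  orthogonal : ∀ x {t t'}, t ≠ t' → P x t * P x t' = 0
  orthogonal_of_ne : ∀ {x y}, x ≠ y → ∀ t t', P x t * P y t' = 0
  S_σ : ∀ {x y z : C} (f : x ⟶ y) (g : y ⟶ z) (p q e),
    S (f ≫ g) ((H.σ f g).toHomeo (compMk p q e)) = S g p * S f q
  S_ι : ∀ x t, S (𝟙 x) ((H.ι x).toHomeo ((H.G x).unit t)) = P x t
  star_S_mul_S : ∀ {x y : C} (g : x ⟶ y) (p), star (S g p) * S g p = P x ((H.X g).s p)
  star_S_mul_S_of_ne : ∀ {x y : C} (g : x ⟶ y) {p q}, p ≠ q → star (S g q) * S g p = 0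
  sum_eq : ∀ {x y : C} (g : x ⟶ y) (t),
    ∑ᶠ p ∈ {p | (H.X g).r p = t}, S g p * star (S g p) = P y t

namespace GrHom.CKFamily

variable {C : Type u} [SmallCategory C] {H : GrHom C} {B : Type u} [NonUnitalCStarAlgebra B]
  (Q : H.CKFamily B)

theorem S_congr {x y : C} {g g' : x ⟶ y} (hg : g = g') {p : (H.X g).carrier}
    {p' : (H.X g').carrier} (hp : HEq p p') : Q.S g p = Q.S g' p' := by
  subst hg
  rw [eq_of_heq hp]

theorem P_mul_S (hH : H.IsDiscrete) {x y : C} (g : x ⟶ y) (p : (H.X g).carrier) :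
    Q.P y ((H.X g).r p) * Q.S g p = Q.S g p := by
  rw [← Q.S_ι, ← Q.S_σ g (𝟙 y) _ p (s_ι y _)]
  refine Q.S_congr (Category.comp_id g) ((H.unit_left g _ p ((H.G y).s_unit _) _).trans ?_)
  rw [(H.X g).lact_eq_self (hH y)]

theorem S_mul_P (hH : H.IsDiscrete) {x y : C} (g : x ⟶ y) (p : (H.X g).carrier) :
    Q.S g p * Q.P x ((H.X g).s p) = Q.S g p := by
  rw [← Q.S_ι, ← Q.S_σ (𝟙 x) g p _ (r_ι x _).symm]
  refine Q.S_congr (Category.id_comp g) ((H.unit_right g p _ ((H.G x).r_unit _).symm _).trans ?_)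
  rw [(H.X g).ract_eq_self (hH x)]

variable {P : ProductSystem C}

theorem exists_π (M : H.CStarModel P) (hH : H.IsDiscrete) (x : C) :
    ∃ π : P.A x →⋆ₙₐ[ℂ] B, ∀ t, π (M.ptA hH x t) = Q.P x t := by
  have := (hH x).discreteTopology_arr
  classical
  let τ : quasiCont (H.G x).Arr →ₗ[ℂ] B := quasiCont.lift fun g => Q.P x ((H.G x).s g)
  have hτ : ∀ ξ {s : Finset (H.G x).Arr}, (quasiCont.finite_support ξ).toFinset ⊆ s →
      τ ξ = ∑ g ∈ s, ξ.1 g • Q.P x ((H.G x).s g) := by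
    intro ξ s hs
    rw [quasiCont.map_eq_sum τ ξ]
    simp only [τ, quasiCont.lift_single]
    refine Finset.sum_subset hs fun g _ hg => ?_
    have : ξ.1 g = 0 := by simpa using hg
    rw [this, zero_smul]
  have hmul : ∀ ξ η ζ : quasiCont (H.G x).Arr, (∀ g, ζ.1 g = ξ.1 g * η.1 g) →
      τ ζ = τ ξ * τ η := by
    intro ξ η ζ h
    let s := (quasiCont.finite_support ξ).toFinset ∪ (quasiCont.finite_support η).toFinset
    have hζ : (quasiCont.finite_support ζ).toFinset ⊆ s := by
      intro g hg
      refine Finset.mem_union_left _ ?_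
      simp only [Set.Finite.mem_toFinset, Function.mem_support, h] at hg ⊢
      exact left_ne_zero_of_mul hg
    rw [hτ ξ (Finset.subset_union_left (s₂ := (quasiCont.finite_support η).toFinset)),
      hτ η (Finset.subset_union_right (s₁ := (quasiCont.finite_support ξ).toFinset)), hτ ζ hζ,
      Finset.sum_mul_sum]
    refine Finset.sum_congr rfl fun g hg => ?_
    rw [Finset.sum_eq_single g]
    · rw [smul_mul_smul_comm, (Q.isStarProjection x _).isIdempotentElem.eq, h]
    · intro g' _ hg'
      rw [smul_mul_smul_comm, Q.orthogonal x, smul_zero]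
      intro hs
      refine hg' ?_
      rw [(hH x).eq_unit_s g', (hH x).eq_unit_s g, hs]
    · exact fun h' => absurd hg h'
  have hstar : ∀ ξ ζ : quasiCont (H.G x).Arr, (∀ g, ζ.1 g = star (ξ.1 g)) →
      τ ζ = star (τ ξ) := by
    intro ξ ζ h
    have hζ : (quasiCont.finite_support ζ).toFinset ⊆ (quasiCont.finite_support ξ).toFinset := by
      intro g hg
      simpa [h] using hg
    rw [hτ ξ subset_rfl, hτ ζ hζ, star_sum]
    refine Finset.sum_congr rfl fun g _ => ?_
    rw [star_smul, (Q.isStarProjection x _).isSelfAdjoint.star_eq, h]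
  have hrep : (H.G x).IsStarRep τ := ((hH x).isStarRep_iff τ).2 ⟨hmul, hstar⟩
  obtain ⟨hmul', hstar'⟩ := ((hH x).isStarRep_iff _).1 (M.isCStar x).isStarRep
  obtain ⟨Φ, hΦ⟩ := exists_nonUnitalStarAlgHom_of_denseRange (M.toA x) τ (M.isCStar x).denseRange
    ((M.isCStar x).norm_max τ hrep)
    (fun ξ η => ⟨⟨fun g => ξ.1 g * η.1 g, quasiCont.mem_of_finite_support
      ((quasiCont.finite_support ξ).subset fun g hg => left_ne_zero_of_mul hg)⟩,
      hmul' _ _ _ fun _ => rfl, hmul _ _ _ fun _ => rfl⟩)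
    (fun ξ => ⟨⟨fun g => star (ξ.1 g), quasiCont.mem_of_finite_support
      ((quasiCont.finite_support ξ).subset fun g hg => by simpa using hg)⟩,
      hstar' _ _ fun _ => rfl, hstar _ _ fun _ => rfl⟩)
  refine ⟨Φ, fun t => (hΦ _).trans ?_⟩
  rw [quasiCont.lift_single, (H.G x).s_unit]

theorem exists_t (M : H.CStarModel P) (hH : H.IsDiscrete) {x y : C} (g : x ⟶ y)
    {π : P.A x →⋆ₙₐ[ℂ] B} (hπ : ∀ t, π (M.ptA hH x t) = Q.P x t) :
    ∃ t : (P.E g).carrier →L[ℂ] B, (∀ p, t (M.ptE hH g p) = Q.S g p) ∧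
      ∀ ξ η, star (t ξ) * t η = π ((P.E g).inner ξ η) := by
  have := hH.discreteTopology g
  let τ : quasiCont (H.X g).carrier →ₗ[ℂ] B := quasiCont.lift (Q.S g)
  have hi : ∀ ξ η, star (τ ξ) * τ η = π ((P.E g).inner (M.toE g ξ) (M.toE g η)) := by
    refine quasiCont.hermitian_ext (f := fun ξ => LinearMap.mulLeft ℂ (star (τ ξ)) ∘ₗ τ)
      (g := fun ξ => π.toCLM.toLinearMap ∘ₗ (P.E g).innerHom (M.toE g ξ) ∘ₗ M.toE g)
      (fun ξ η => ?_) (fun ξ η => ?_) fun p q => ?_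
    · change star (star (τ ξ) * τ η) = star (τ η) * τ ξ
      rw [star_mul, star_star]
    · change star (π ((P.E g).inner _ _)) = π ((P.E g).inner _ _)
      rw [← map_star, (P.E g).star_inner]
    · change star (τ (quasiCont.single p)) * τ (quasiCont.single q) =
        π ((P.E g).inner (M.ptE hH g p) (M.ptE hH g q))
      rw [quasiCont.lift_single, quasiCont.lift_single]
      by_cases h : p = q
      · rw [h, Q.star_S_mul_S, M.inner_ptE_self, hπ]
      · rw [Q.star_S_mul_S_of_ne g (Ne.symm h), M.inner_ptE_of_ne hH g h, map_zero]
  have hb : ∀ ξ, ‖τ ξ‖ ≤ 1 * ‖M.toE g ξ‖ := by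
    intro ξ
    rw [one_mul]
    refine le_of_sq_le_sq ?_ (norm_nonneg _)
    rw [sq, ← CStarRing.norm_star_mul_self, hi, (P.E g).norm_sq]
    exact NonUnitalStarAlgHom.norm_apply_le π _
  have hext : ∀ ξ, τ.extendOfNorm (M.toE g) (M.toE g ξ) = τ ξ :=
    LinearMap.extendOfNorm_eq (M.denseRange g) ⟨1, hb⟩
  refine ⟨τ.extendOfNorm (M.toE g), fun p => (hext _).trans (quasiCont.lift_single _ _),
    fun ξ η => ?_⟩
  have hc : ∀ ζ, Continuous ((P.E g).inner ζ) := fun ζ =>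
    ((P.E g).innerHom ζ).mkContinuous ‖ζ‖ ((P.E g).norm_inner_le ζ) |>.continuous
  have h₁ : ∀ f η, star (τ f) * τ.extendOfNorm (M.toE g) η =
      π ((P.E g).inner (M.toE g f) η) := fun f η =>
    (M.denseRange g).induction_on (p := fun η => star (τ f) * τ.extendOfNorm (M.toE g) η =
      π ((P.E g).inner (M.toE g f) η)) η
      (isClosed_eq (by fun_prop) (π.continuous_of_cstar.comp (hc _)))
      fun f' => by rw [hext, hi]
  refine (M.denseRange g).induction_on (p := fun η => star (τ.extendOfNorm (M.toE g) ξ) *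
    τ.extendOfNorm (M.toE g) η = π ((P.E g).inner ξ η)) η
    (isClosed_eq (by fun_prop) (π.continuous_of_cstar.comp (hc _))) fun f => ?_
  have := congrArg star (h₁ f ξ)
  rwa [star_mul, star_star, ← map_star π, (P.E g).star_inner, ← hext] at this

end GrHom.CKFamily

namespace GrHom.CStarModel

variable {C : Type u} [SmallCategory C] {H : GrHom C} {P : ProductSystem C}

theorem mul_ptE_of_ne (M : H.CStarModel P) (hH : H.IsDiscrete) {x y z : C} (f : x ⟶ y)
    (g : y ⟶ z) {p : (H.X g).carrier} {q : (H.X f).carrier} (h : (H.X g).s p ≠ (H.X f).r q) :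
    P.mul f g (M.ptE hH g p) (M.ptE hH f q) = 0 := by
  rw [← norm_eq_zero, ← sq_eq_zero_iff, (P.E _).norm_sq, P.inner_mul, M.inner_ptE_self,
    M.lsmul_ptE_of_ne hH f h.symm, ← (P.E f).innerHom_apply, map_zero, norm_zero]

/-- The multiplication by a fixed element on the left. -/
noncomputable def mulL (M : H.CStarModel P) (hH : H.IsDiscrete) {x y z : C} (f : x ⟶ y)
    (g : y ⟶ z) (ξ : (P.E g).carrier) : (P.E f).carrier →L[ℂ] (P.E (f ≫ g)).carrier :=
  (P.mul f g ξ).mkContinuous ‖ξ‖ (M.norm_mul_le hH f g ξ)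

/-- The multiplication by a fixed element on the right. -/
noncomputable def mulR (M : H.CStarModel P) (hH : H.IsDiscrete) {x y z : C} (f : x ⟶ y)
    (g : y ⟶ z) (η : (P.E f).carrier) : (P.E g).carrier →L[ℂ] (P.E (f ≫ g)).carrier :=
  ((P.mul f g).flip η).mkContinuous ‖η‖ fun ξ => by
    rw [mul_comm]
    exact M.norm_mul_le hH f g ξ η

end GrHom.CStarModel

/-- The identification of the coefficient algebra with the correspondence of an identity. -/
noncomputable def ProductSystem.oneL {C : Type u} [SmallCategory C] (P : ProductSystem C) (x : C) :
    P.A x →L[ℂ] (P.E (𝟙 x)).carrier :=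
  (P.one x).mkContinuous 1 fun a => by
    rw [_root_.one_mul]
    refine le_of_sq_le_sq ?_ (norm_nonneg _)
    rw [(P.E _).norm_sq, P.inner_one, CStarRing.norm_star_mul_self, sq]

namespace GrHom.CKFamily

variable {C : Type u} [SmallCategory C] {H : GrHom C} {B : Type u} [NonUnitalCStarAlgebra B]
  {P : ProductSystem C}

theorem exists_covRep (Q : H.CKFamily B) (M : H.CStarModel P) (hH : H.IsDiscrete)
    (hfin : ∀ {x y : C} (g : x ⟶ y) (t : (H.G y).Obj), {p | (H.X g).r p = t}.Finite) :
    ∃ ρ : P.CovRep B, (∀ x t, ρ.π x (M.ptA hH x t) = Q.P x t) ∧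
      ∀ {x y : C} (g : x ⟶ y) (p), ρ.t g (M.ptE hH g p) = Q.S g p := by
  choose π hπ using Q.exists_π M hH
  choose t ht hi using fun {x y : C} (g : x ⟶ y) => Q.exists_t M hH g (hπ x)
  have hr := fun {x y : C} (g : x ⟶ y) =>
    CStarCorr.rep_rsmul (π := π x) (t := (t g).toLinearMap) (hi g)
  refine ⟨{
    π := π
    t := fun g => (t g).toLinearMap
    orthogonal := fun {x y} hxy a b => ?_
    t_one := fun x a => ?_
    inner := hi
    lsmul := fun {x y} g a ξ => ?_
    rsmul := hr
    mul := fun {x y z} f g ξ η => ?_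
    covariant := fun {x y} g => ?_ }, hπ, ht⟩
  · refine ContinuousLinearMap.eq_of_dense_span (M.dense_ptA hH x)
      (φ := (ContinuousLinearMap.mul ℂ B).flip (π y b) ∘L (π x).toCLM) (ψ := 0) (fun t => ?_) a
    refine ContinuousLinearMap.eq_of_dense_span (M.dense_ptA hH y)
      (φ := ContinuousLinearMap.mul ℂ B (π x (M.ptA hH x t)) ∘L (π y).toCLM) (ψ := 0)
      (fun t' => ?_) b
    change π x (M.ptA hH x t) * π y (M.ptA hH y t') = 0
    rw [hπ, hπ, Q.orthogonal_of_ne hxy]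
  · refine ContinuousLinearMap.eq_of_dense_span (M.dense_ptA hH x)
      (φ := t (𝟙 x) ∘L P.oneL x) (ψ := (π x).toCLM) (fun t₀ => ?_) a
    change t (𝟙 x) (P.one x (M.ptA hH x t₀)) = π x (M.ptA hH x t₀)
    rw [M.one_ptA, ht, Q.S_ι, hπ]
  · refine ContinuousLinearMap.eq_of_dense_span (M.dense_ptE hH g)
      (φ := t g ∘L (P.E g).lsmul a) (ψ := ContinuousLinearMap.mul ℂ B (π y a) ∘L t g)
      (fun p => ?_) ξ
    change t g ((P.E g).lsmul a (M.ptE hH g p)) = π y a * t g (M.ptE hH g p)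
    obtain ⟨c, hc, -⟩ := M.exists_mul_ptA hH y a ((H.X g).r p)
    rw [M.lsmul_ptE_eq hH g p hc, map_smul, ht, ← Q.P_mul_S hH, ← mul_assoc, ← hπ, ← map_mul, hc,
      map_smul, smul_mul_assoc]
  · refine ContinuousLinearMap.eq_of_dense_span (M.dense_ptE hH g)
      (φ := t (f ≫ g) ∘L M.mulR hH f g η)
      (ψ := (ContinuousLinearMap.mul ℂ B).flip (t f η) ∘L t g) (fun p => ?_) ξ
    refine ContinuousLinearMap.eq_of_dense_span (M.dense_ptE hH f)
      (φ := t (f ≫ g) ∘L M.mulL hH f g (M.ptE hH g p))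
      (ψ := ContinuousLinearMap.mul ℂ B (t g (M.ptE hH g p)) ∘L t f) (fun q => ?_) η
    change t (f ≫ g) (P.mul f g (M.ptE hH g p) (M.ptE hH f q)) =
      t g (M.ptE hH g p) * t f (M.ptE hH f q)
    by_cases h : (H.X g).s p = (H.X f).r q
    · rw [M.mul_ptE hH f g p q h, ht, ht, ht, Q.S_σ]
    · rw [M.mul_ptE_of_ne hH f g h, ht, ht, map_zero, ← Q.S_mul_P hH g p, ← Q.P_mul_S hH f q,
        mul_assoc, ← mul_assoc (Q.P _ _), Q.orthogonal y h, zero_mul, mul_zero]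
  · obtain ⟨ψ, hψ⟩ := CStarCorr.exists_map_compacts (π := π x) (t := (t g).toLinearMap) (hi g) (hr g)
    refine ⟨ψ, hψ, fun a T hT => ?_⟩
    let L : P.A y →L[ℂ] (P.E g).compacts :=
      (M.lsmulL hH g).codRestrict _ fun a => M.isProper hH hfin g a
    obtain rfl : T = L a := Subtype.ext hT
    refine ContinuousLinearMap.eq_of_dense_span (M.dense_ptA hH y) (φ := ψ ∘L L)
      (ψ := (π y).toCLM) (fun t₀ => ?_) a
    change ψ (L (M.ptA hH y t₀)) = π y (M.ptA hH y t₀)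
    have hL : L (M.ptA hH y t₀) = ∑ p ∈ (hfin g t₀).toFinset,
        ⟨_, (P.E g).rankOne_mem_compacts (M.ptE hH g p) (M.ptE hH g p)⟩ := by
      refine Subtype.ext ((M.lsmul_ptA hH g t₀ (hfin g t₀)).trans ?_)
      rw [Submodule.coe_sum]
    rw [hL, map_sum, hπ, ← Q.sum_eq g t₀, finsum_mem_eq_finite_toFinset_sum _ (hfin g t₀)]
    refine Finset.sum_congr rfl fun p _ => ?_
    rw [hψ _ _ _ ((P.E g).isRankOne_rankOne _ _)]
    exact congrArg (fun b => b * star b) (ht g p)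

/-- The family given by a covariant representation. -/
noncomputable def ofCovRep (M : H.CStarModel P) (hH : H.IsDiscrete)
    (hfin : ∀ {x y : C} (g : x ⟶ y) (t : (H.G y).Obj), {p | (H.X g).r p = t}.Finite)
    (ρ : P.CovRep B) : H.CKFamily B where
  P x t := ρ.π x (M.ptA hH x t)
  S g p := ρ.t g (M.ptE hH g p)
  isStarProjection x t := by
    refine ⟨?_, ?_⟩
    · change _ * _ = _
      rw [← map_mul, M.ptA_mul_self]
    · change star _ = _
      rw [← map_star, M.star_ptA]
  orthogonal x t t' h := by rw [← map_mul, M.ptA_mul_of_ne hH x h, map_zero]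
  orthogonal_of_ne h t t' := ρ.orthogonal h _ _
  S_σ f g p q e := by rw [← M.mul_ptE, ρ.mul]
  S_ι x t := by rw [← M.one_ptA, ρ.t_one]
  star_S_mul_S g p := by rw [ρ.inner, M.inner_ptE_self]
  star_S_mul_S_of_ne g p q h := by rw [ρ.inner, M.inner_ptE_of_ne hH g h.symm, map_zero]
  sum_eq {x y} g t := by
    obtain ⟨ψ, hψ, hψ'⟩ := ρ.covariant g
    rw [← hψ' _ ⟨_, M.isProper hH hfin g (M.ptA hH y t)⟩ rfl,
      finsum_mem_eq_finite_toFinset_sum _ (hfin g t)]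
    have hL : (⟨_, M.isProper hH hfin g (M.ptA hH y t)⟩ : (P.E g).compacts) =
        ∑ p ∈ (hfin g t).toFinset,
          ⟨_, (P.E g).rankOne_mem_compacts (M.ptE hH g p) (M.ptE hH g p)⟩ := by
      refine Subtype.ext ((M.lsmul_ptA hH g t (hfin g t)).trans ?_)
      rw [Submodule.coe_sum]
    rw [hL, map_sum]
    refine Finset.sum_congr rfl fun p _ => ?_
    rw [hψ _ _ _ ((P.E g).isRankOne_rankOne _ _)]

end GrHom.CKFamily

theorem ProductSystem.CovRep.map_eq_of_pt {C : Type u} [SmallCategory C] {H : GrHom C}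
    {P : ProductSystem C} (M : H.CStarModel P) (hH : H.IsDiscrete) {O B : Type u}
    [NonUnitalCStarAlgebra O] [NonUnitalCStarAlgebra B] (ρ : P.CovRep O) (τ : P.CovRep B)
    (Φ : O →⋆ₙₐ[ℂ] B) (h₁ : ∀ x t, Φ (ρ.π x (M.ptA hH x t)) = τ.π x (M.ptA hH x t))
    (h₂ : ∀ {x y : C} (g : x ⟶ y) (p), Φ (ρ.t g (M.ptE hH g p)) = τ.t g (M.ptE hH g p)) :
    (∀ x a, Φ (ρ.π x a) = τ.π x a) ∧ ∀ {x y : C} (g : x ⟶ y) (ξ), Φ (ρ.t g ξ) = τ.t g ξ := by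
  have hc : ∀ {D : Type u} [NonUnitalCStarAlgebra D] (σ : P.CovRep D) {x y : C} (g : x ⟶ y) ξ,
      ‖σ.t g ξ‖ ≤ 1 * ‖ξ‖ := fun σ _ _ g ξ => by
    rw [_root_.one_mul]
    exact CStarCorr.norm_rep_le (σ.inner g) ξ
  refine ⟨fun x => ?_, fun {x y} g => ?_⟩
  · exact ContinuousLinearMap.eq_of_dense_span (M.dense_ptA hH x)
      (φ := Φ.toCLM ∘L (ρ.π x).toCLM) (ψ := (τ.π x).toCLM) (h₁ x)
  · exact ContinuousLinearMap.eq_of_dense_span (M.dense_ptE hH g)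
      (φ := Φ.toCLM ∘L (ρ.t g).mkContinuous 1 (hc ρ g))
      (ψ := (τ.t g).mkContinuous 1 (hc τ g)) (h₂ g)

namespace GrHom.CKFamily

variable {C : Type u} [SmallCategory C] {B : Type u} [NonUnitalCStarAlgebra B]

/-- Transport of a family along an isomorphism. -/
def comap {H H' : GrHom C} (hH' : H'.IsDiscrete) (θ : H.Iso H') (Q : H'.CKFamily B) :
    H.CKFamily B where
  P x t := Q.P x (θ.obj x t)
  S g p := Q.S g (θ.corr g p)
  isStarProjection x t := Q.isStarProjection x _
  orthogonal x t t' h := Q.orthogonal x ((θ.obj x).injective.ne h)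
  orthogonal_of_ne h t t' := Q.orthogonal_of_ne h _ _
  S_σ {x y z} f g p q e := by
    rw [θ.corr_σ f g p q e ((θ.corr_s g p).trans ((congrArg (θ.obj y) e).trans
      (θ.corr_r f q).symm)), Q.S_σ]
  S_ι x t := by
    have h := θ.corr_ι x ((H.G x).unit t)
    rw [θ.arr_unit hH'] at h
    exact (congrArg (Q.S (𝟙 x)) h).trans (Q.S_ι x _)
  star_S_mul_S g p := by rw [Q.star_S_mul_S, θ.corr_s]
  star_S_mul_S_of_ne g p q h := Q.star_S_mul_S_of_ne g ((θ.corr g).injective.ne h)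
  sum_eq {x y} g t := by
    rw [← Q.sum_eq g]
    refine finsum_mem_eq_of_bijOn (θ.corr g) ⟨fun p hp => ?_, (θ.corr g).injective.injOn,
      fun p hp => ?_⟩ fun _ _ => rfl
    · exact (θ.corr_r g p).trans (congrArg (θ.obj y) hp)
    · obtain ⟨p, rfl⟩ := (θ.corr g).surjective p
      exact ⟨p, (θ.obj y).injective ((θ.corr_r g p).symm.trans hp), rfl⟩

end GrHom.CKFamily

namespace ConducheFibration

variable {C : Type u} [SmallCategory C] {F : ConducheFibration C} {B : Type u}
  [NonUnitalCStarAlgebra B]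

/-- A family for a fibration as a family indexed by fibres. -/
def Family.toCKFamily (q : F.Family B) : F.toGrHom.CKFamily B where
  P x X := q.P (Subtype.val (p := fun X => F.F.obj X = x) X)
  S g α := q.S (ArrFib.hom (F := F) (g := g) α)
  isStarProjection x X := q.isStarProjection _
  orthogonal x X X' h := q.orthogonal fun h' => h (Subtype.ext h')
  orthogonal_of_ne {x y} h X Y := q.orthogonal fun h' => h (by
    rw [← X.2, h']
    exact Y.2)
  S_σ {x y z} f g α β e := by
    obtain ⟨X, Y, hX, hY, φ, h⟩ := α
    obtain ⟨Z, X', hZ, hX', χ, h'⟩ := β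
    obtain rfl : X = X' := congrArg Subtype.val e
    rw [← q.S_comp]
    change q.S (χ ≫ 𝟙 X ≫ φ) = q.S (χ ≫ φ)
    rw [Category.id_comp]
  S_ι x X := (q.S_id _).symm
  star_S_mul_S g α := q.star_S_mul_S _
  star_S_mul_S_of_ne g α β h := q.star_S_mul_S_of_ne g α β h
  sum_eq {x y} g X := by
    obtain ⟨X, rfl⟩ := X
    rw [← q.sum_eq X g]
    refine finsum_mem_congr (Set.ext fun α => ?_) fun _ _ => rfl
    exact Subtype.ext_iff

theorem CKFamily.P_congr (Q : F.toGrHom.CKFamily B) (X : F.E) {x y : C} (hx : F.F.obj X = x)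
    (hy : F.F.obj X = y) :
    Q.P x (⟨X, hx⟩ : F.ObjFib x) = Q.P y (⟨X, hy⟩ : F.ObjFib y) := by
  subst hx hy
  rfl

theorem CKFamily.S_hom (Q : F.toGrHom.CKFamily B) {x y : C} (g : x ⟶ y) (α : F.ArrFib g) :
    Q.S (F.F.map α.hom) (ArrFib.ofHom α.hom) = Q.S g α :=
  ArrFib.ind (motive := fun g α => Q.S (F.F.map α.hom) (ArrFib.ofHom α.hom) = Q.S g α)
    (fun _ => rfl) g α

/-- A family indexed by fibres as a family for a fibration. -/
def Family.ofCKFamily (Q : F.toGrHom.CKFamily B) : F.Family B where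
  P X := Q.P (F.F.obj X) (⟨X, rfl⟩ : F.ObjFib _)
  S α := Q.S (F.F.map α) (ArrFib.ofHom α)
  isStarProjection X := Q.isStarProjection _ _
  partial_isometry α := by
    rw [mul_assoc]
    exact (congrArg (Q.S (F.F.map α) (ArrFib.ofHom α) * ·) (Q.star_S_mul_S _ _)).trans
      (Q.S_mul_P F.isDiscrete_toGrHom (F.F.map α) (ArrFib.ofHom α))
  orthogonal {X Y} h := by
    by_cases hXY : F.F.obj X = F.F.obj Y
    · rw [CKFamily.P_congr Q X rfl hXY]
      exact Q.orthogonal _ fun h' => h (congrArg Subtype.val h')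
    · exact Q.orthogonal_of_ne hXY _ _
  S_comp β α := (Q.S_congr (F.F.map_comp β α) (ofHom_comp_heq β α)).trans
    (Q.S_σ (F.F.map β) (F.F.map α) (ArrFib.ofHom α) (ArrFib.ofHom β) rfl)
  S_id X := ((Q.S_congr (F.F.map_id X) (ofHom_id_heq X)).trans (Q.S_ι _ _)).symm
  star_S_mul_S α := Q.star_S_mul_S _ _
  star_S_mul_S_of_ne g α β h := by
    rw [CKFamily.S_hom, CKFamily.S_hom]
    exact Q.star_S_mul_S_of_ne g h
  sum_eq X x g := by
    refine Eq.trans ?_ (Q.sum_eq g (⟨X, rfl⟩ : F.ObjFib _))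
    refine finsum_mem_congr (Set.ext fun α =>
      (Subtype.ext_iff (a1 := α.r) (a2 := ⟨X, rfl⟩)).symm) fun α _ => ?_
    rw [CKFamily.S_hom]

variable {H : GrHom C} {P : ProductSystem C}

theorem toA_deltaObj (M : H.CStarModel P) (hH : H.IsDiscrete) (θ : F.toGrHom.Iso H) (X : F.E) :
    M.toA _ (F.deltaObj θ X) = M.ptA hH _ (θ.obj (F.F.obj X) (⟨X, rfl⟩ : F.ObjFib _)) := by
  have := (hH (F.F.obj X)).discreteTopology_arr
  exact congrArg (fun a => M.toA _ (quasiCont.single a)) (θ.arr_unit hH _ _)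

theorem exists_family (hF : F.IsRowFinite) (θ : F.toGrHom.Iso H) (M : H.CStarModel P)
    (ρ : P.CovRep B) : ∃ q : F.Family B,
      (∀ X, q.P X = ρ.π _ (M.toA _ (F.deltaObj θ X))) ∧
      ∀ {Y X : F.E} (α : Y ⟶ X), q.S α = ρ.t _ (M.toE _ (F.deltaArr θ α)) := by
  have hH := θ.isDiscrete F.isDiscrete_toGrHom
  refine ⟨.ofCKFamily ((GrHom.CKFamily.ofCovRep M hH
    ((F.isRowFinite_iff_finite θ).1 hF) ρ).comap hH θ), fun X => ?_, fun α => rfl⟩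
  rw [toA_deltaObj M hH]
  rfl

theorem exists_covRep (hF : F.IsRowFinite) (θ : F.toGrHom.Iso H) (M : H.CStarModel P)
    (q : F.Family B) : ∃ ρ : P.CovRep B,
      (∀ X, q.P X = ρ.π _ (M.toA _ (F.deltaObj θ X))) ∧
      ∀ {Y X : F.E} (α : Y ⟶ X), q.S α = ρ.t _ (M.toE _ (F.deltaArr θ α)) := by
  have hF' := F.isDiscrete_toGrHom
  have hH := θ.isDiscrete hF'
  obtain ⟨ρ, h₁, h₂⟩ := (q.toCKFamily.comap hF' (θ.symmOfDiscrete hF' hH)).exists_covRep M hH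
    ((F.isRowFinite_iff_finite θ).1 hF)
  refine ⟨ρ, fun X => ?_, fun α => ?_⟩
  · rw [toA_deltaObj M hH, h₁]
    exact congrArg (q.toCKFamily.P (F.F.obj X)) ((θ.obj (F.F.obj X)).symm_apply_apply
      (⟨X, rfl⟩ : F.ObjFib _)).symm
  · refine Eq.trans ?_ (h₂ (F.F.map α) (θ.corr _ (F.arrPt α))).symm
    exact congrArg (q.toCKFamily.S (F.F.map α)) ((θ.corr (F.F.map α)).symm_apply_apply
      (F.arrPt α)).symm

theorem covRep_map_eq (θ : F.toGrHom.Iso H) (M : H.CStarModel P) {O : Type u}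
    [NonUnitalCStarAlgebra O] (ρ : P.CovRep O) (τ : P.CovRep B) (Φ : O →⋆ₙₐ[ℂ] B)
    (h₁ : ∀ X, Φ (ρ.π _ (M.toA _ (F.deltaObj θ X))) = τ.π _ (M.toA _ (F.deltaObj θ X)))
    (h₂ : ∀ {Y X : F.E} (α : Y ⟶ X), Φ (ρ.t _ (M.toE _ (F.deltaArr θ α))) =
      τ.t _ (M.toE _ (F.deltaArr θ α))) :
    (∀ x a, Φ (ρ.π x a) = τ.π x a) ∧ ∀ {x y : C} (g : x ⟶ y) (ξ), Φ (ρ.t g ξ) = τ.t g ξ := by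
  have hH := θ.isDiscrete F.isDiscrete_toGrHom
  refine ρ.map_eq_of_pt M hH τ Φ (fun x t => ?_) fun {x y} g p => ?_
  · obtain ⟨⟨X, rfl⟩, rfl⟩ := (θ.obj x).surjective t
    have := h₁ X
    rwa [toA_deltaObj M hH] at this
  · obtain ⟨α, rfl⟩ := (θ.corr g).surjective p
    exact ArrFib.ind (motive := fun g α => Φ (ρ.t g (M.ptE hH g (θ.corr g α))) =
      τ.t g (M.ptE hH g (θ.corr g α))) (fun α => h₂ α) g α

theorem exists_universal_covRep (hF : F.IsRowFinite) (θ : F.toGrHom.Iso H)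
    (M : H.CStarModel P) :
    ∃ (O : Type u) (_ : NonUnitalCStarAlgebra O) (ρ : P.CovRep O), ρ.IsUniversal := by
  obtain ⟨A, _, p, hp⟩ := exists_universal_family hF
  obtain ⟨ρ, h₁, h₂⟩ := exists_covRep hF θ M p
  refine ⟨A, inferInstance, ρ, fun τ => ?_⟩
  obtain ⟨q, hq₁, hq₂⟩ := exists_family hF θ M τ
  obtain ⟨Φ, ⟨hΦ₁, hΦ₂⟩, hΦ⟩ := hp q
  refine ⟨Φ, covRep_map_eq θ M ρ τ Φ (fun X => ?_) (fun α => ?_), fun Ψ ⟨hΨ₁, hΨ₂⟩ => hΦ Ψ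
    ⟨fun X => ?_, fun α => ?_⟩⟩
  · rw [← h₁, hΦ₁, hq₁]
  · rw [← h₂, hΦ₂, hq₂]
  · rw [h₁, hΨ₁, hq₁]
  · rw [h₂, hΨ₂, hq₂]

theorem existsUnique_equiv (hF : F.IsRowFinite) (θ : F.toGrHom.Iso H) (M : H.CStarModel P)
    {A : Type u} [NonUnitalCStarAlgebra A] {p : F.Family A} (hp : p.IsUniversal)
    {O : Type u} [NonUnitalCStarAlgebra O] {ρ : P.CovRep O} (hρ : ρ.IsUniversal) :
    ∃! Φ : A ≃⋆ₐ[ℂ] O,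
      (∀ X : F.E, Φ (p.P X) = ρ.π (F.F.obj X) (M.toA (F.F.obj X) (F.deltaObj θ X))) ∧
      ∀ {Y X : F.E} (α : Y ⟶ X), Φ (p.S α) =
        ρ.t (F.F.map α) (M.toE (F.F.map α) (F.deltaArr θ α)) := by
  obtain ⟨q, hq₁, hq₂⟩ := exists_family hF θ M ρ
  obtain ⟨τ, hτ₁, hτ₂⟩ := exists_covRep hF θ M p
  obtain ⟨Φ, ⟨hΦ₁, hΦ₂⟩, hΦ⟩ := hp q
  obtain ⟨Ψ, ⟨hΨ₁, hΨ₂⟩, -⟩ := hρ τ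
  have h₁ : Ψ.comp Φ = NonUnitalStarAlgHom.id ℂ A := (hp p).unique
    ⟨fun X => by
      change Ψ (Φ (p.P X)) = p.P X
      rw [hΦ₁, hq₁, hΨ₁, hτ₁], fun α => by
      change Ψ (Φ (p.S α)) = p.S α
      rw [hΦ₂, hq₂, hΨ₂, hτ₂]⟩ ⟨fun _ => rfl, fun _ => rfl⟩
  have h₂ : Φ.comp Ψ = NonUnitalStarAlgHom.id ℂ O := (hρ ρ).unique
    (covRep_map_eq θ M ρ ρ _
      (fun X => by
        change Φ (Ψ _) = _
        rw [hΨ₁, ← hτ₁, hΦ₁, hq₁])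
      (fun α => by
        change Φ (Ψ _) = _
        rw [hΨ₂, ← hτ₂, hΦ₂, hq₂])) ⟨fun _ _ => rfl, fun _ _ => rfl⟩
  have hb : Function.Bijective Φ := Function.bijective_iff_has_inverse.2
    ⟨Ψ, DFunLike.congr_fun h₁, DFunLike.congr_fun h₂⟩
  refine ⟨StarAlgEquiv.ofBijective Φ hb, ⟨fun X => (hΦ₁ X).trans (hq₁ X),
    fun α => (hΦ₂ α).trans (hq₂ α)⟩, fun Φ' ⟨h, h'⟩ => ?_⟩
  have := hΦ (Φ' : A →⋆ₙₐ[ℂ] O) ⟨fun X => (h X).trans (hq₁ X).symm,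
    fun α => (h' α).trans (hq₂ α).symm⟩
  exact DFunLike.ext _ _ fun a => DFunLike.congr_fun this a

end ConducheFibration

theorem mainTheorem4 {C : Type u} [SmallCategory C] :
    -- `F ↦ F.toGrHom` is a bijection on isomorphism classes
    (∀ F : ConducheFibration C, F.toGrHom.IsDiscrete) ∧
    (∀ F F' : ConducheFibration C, F.Isomorphic F' ↔ Nonempty (F.toGrHom.Iso F'.toGrHom)) ∧
    (∀ H : GrHom C, H.IsDiscrete → ∃ F : ConducheFibration C, Nonempty (F.toGrHom.Iso H)) ∧
    -- for these homomorphisms, strict isomorphism and bicategorical equivalence are the same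
    (∀ H H' : GrHom C, H.IsDiscrete → H'.IsDiscrete →
      (Nonempty (H.Iso H') ↔ Nonempty (H.Equivalence H'))) ∧
    -- row-finiteness corresponds to properness
    (∀ (F : ConducheFibration C) (H : GrHom C), Nonempty (F.toGrHom.Iso H) →
      (F.IsRowFinite ↔ H.IsProper)) ∧
    -- the C⋆-algebra of a row-finite fibration is an absolute Cuntz–Pimsner algebra
    (∀ F : ConducheFibration C, F.IsRowFinite →
      (∃ (A : Type u) (_ : NonUnitalCStarAlgebra A) (p : F.Family A), p.IsUniversal) ∧
      ∀ (H : GrHom C) (θ : F.toGrHom.Iso H),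
        (∃ P : ProductSystem C, Nonempty (H.CStarModel P)) ∧
        ∀ (P : ProductSystem C) (M : H.CStarModel P),
          P.IsProper ∧
          (∃ (O : Type u) (_ : NonUnitalCStarAlgebra O) (ρ : P.CovRep O), ρ.IsUniversal) ∧
          ∀ (A : Type u) [NonUnitalCStarAlgebra A] (p : F.Family A), p.IsUniversal →
          ∀ (O : Type u) [NonUnitalCStarAlgebra O] (ρ : P.CovRep O), ρ.IsUniversal →
            ∃! Φ : A ≃⋆ₐ[ℂ] O,
              (∀ X : F.E, Φ (p.P X) =
                ρ.π (F.F.obj X) (M.toA (F.F.obj X) (F.deltaObj θ X))) ∧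
              ∀ {Y X : F.E} (α : Y ⟶ X), Φ (p.S α) =
                ρ.t (F.F.map α) (M.toE (F.F.map α) (F.deltaArr θ α))) := by
  refine ⟨ConducheFibration.isDiscrete_toGrHom, fun F F' => ConducheFibration.isomorphic_iff, fun H hH => H.exists_fibration hH,
    fun H H' hH hH' => GrHom.nonempty_iso_iff hH hH',
    fun F H ⟨θ⟩ => F.isRowFinite_iff_isProper θ, fun F hF => ⟨
      ConducheFibration.exists_universal_family hF,
      fun H θ => ⟨⟨_, ⟨GrHom.cstarModel (θ.isDiscrete F.isDiscrete_toGrHom)⟩⟩, fun P M => ⟨?_,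
        ConducheFibration.exists_universal_covRep hF θ M, fun A _ p hp O _ ρ hρ =>
          ConducheFibration.existsUnique_equiv hF θ M hp hρ⟩⟩⟩⟩
  exact M.isProper (θ.isDiscrete F.isDiscrete_toGrHom) ((F.isRowFinite_iff_finite θ).1 hF)
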